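/- All graphs are finite and simple. For an edge $e$ of a graph $G=(V,E)$ let $N[e]\subseteq E$ be the set of edges that share at least one endpoint with $e$ (so $e\in N[e]$). A set $D\subseteq E$ is an edge dominating set of $G$ if $N[e]\cap D\neq\emptyset$ for every $e\in E$, and it is minimal if no proper subset of it is an edge dominating set. Let $\|G\|=|V|+2|E|$ denote the size of $G$. There are an algorithm (a random access machine program with addition, subtraction and comparison of natural numbers as unit-time operations, with a write-only output tape, and with space measured as the number of bits of the addresses and contents of the nonzero memory cells) and polynomials $p,q,r$ such that, given any graph $G$ as input, the algorithm terminates after listing all minimal edge dominating sets of $G$, each exactly once, where 1. the first set is output within time $p(\|G\|)$; 2. the time between two consecutive outputs, and the time between the last output and termination, are at most $q(\|G\|)$; 3. the space in use (not counting the output tape) is at most $r(\|G\|)$ at every moment. Moreover, a set $D$ is a minimal edge dominating set of $G$ if and only if it is an inclusion-minimal transversal of the edge-neighbourhood hypergraph $(E,\{N[e] : e\in E\})$, that is, an inclusion-minimal subset of $E$ that meets every $N[e]$, $e\in E$. -/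

import Mathlib

/-! ### Edge dominating sets and transversals -/

namespace EdgeDom

/-- The closed edge neighbourhood `N[e]`: the edges of `G` sharing an endpoint with `e`
(so `e` itself belongs to it when `e` is an edge of `G`). -/
def edgeNbhd {V : Type*} (G : SimpleGraph V) (e : Sym2 V) : Set (Sym2 V) :=
  {f | f ∈ G.edgeSet ∧ ∃ x, x ∈ e ∧ x ∈ f}

/-- A set `D` of edges of `G` such that `N[e]` meets `D` for every edge `e` of `G`. -/
def IsEdgeDominatingSet {V : Type*} (G : SimpleGraph V) (D : Set (Sym2 V)) : Prop :=
  D ⊆ G.edgeSet ∧ ∀ e ∈ G.edgeSet, (edgeNbhd G e ∩ D).Nonempty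

/-- A hypergraph: a vertex set together with a family of subsets of it. -/
structure Hypergraph (α : Type*) where
  verts : Set α
  hyperedges : Set (Set α)
  subset_verts : ∀ F ∈ hyperedges, F ⊆ verts

/-- A set of vertices meeting every hyperedge. -/
def Hypergraph.IsTransversal {α : Type*} (H : Hypergraph α) (T : Set α) : Prop :=
  T ⊆ H.verts ∧ ∀ F ∈ H.hyperedges, (F ∩ T).Nonempty

/-- The edge-neighbourhood hypergraph `(E, {N[e] | e ∈ E})` of `G`. -/
def edgeNbhdHypergraph {V : Type*} (G : SimpleGraph V) : Hypergraph (Sym2 V) where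
  verts := G.edgeSet
  hyperedges := edgeNbhd G '' G.edgeSet
  subset_verts := by
    rintro _ ⟨e, _, rfl⟩ f hf
    exact hf.1

/-- The size `|V| + ∑_{e ∈ E} |e|` of a graph on `n` vertices (every edge has two endpoints). -/
noncomputable def graphSize {n : ℕ} (G : SimpleGraph (Fin n)) : ℕ :=
  n + 2 * G.edgeSet.ncard

end EdgeDom

/-! ### The machine model

A random access machine in structured form: while-programs whose memory consists of cells
`(a, i, j)`, "entry `(i, j)` of the array named `a`", each holding a natural number. The array
name is fixed in the program text, the indices are computed. A program has a write-only output
tape. Every elementary action takes one time unit; the arithmetic is addition, truncated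
subtraction and comparison, so that one time unit is polynomial in the bit size of the memory. -/

namespace RamWhile

/-- Expressions; comparisons have value `1` (true) or `0` (false). -/
inductive Expr : Type
  | const (k : ℕ)
  | cell (a : ℕ) (i j : Expr)
  | add (e f : Expr)
  | sub (e f : Expr)
  | lt (e f : Expr)
  | eq (e f : Expr)

/-- Programs. `assign a i j e` is `a[i, j] := e`; `write e` writes the number `e` on the output
tape; `emit` writes the separator that completes the current output; `cond e c d` executes `c` if
`e ≠ 0` and `d` otherwise; `loop e c` repeats `c` while `e ≠ 0`. -/
inductive Cmd : Type
  | skip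
  | assign (a : ℕ) (i j e : Expr)
  | write (e : Expr)
  | emit
  | seq (c d : Cmd)
  | cond (e : Expr) (c d : Cmd)
  | loop (e : Expr) (c : Cmd)

/-- Memory contents: all but finitely many cells hold `0`. -/
abbrev Store : Type := ℕ × ℕ × ℕ →₀ ℕ

/-- The value of an expression. -/
def Expr.eval (s : Store) : Expr → ℕ
  | const k => k
  | cell a i j => s (a, i.eval s, j.eval s)
  | add e f => e.eval s + f.eval s
  | sub e f => e.eval s - f.eval s
  | lt e f => if e.eval s < f.eval s then 1 else 0
  | eq e f => if e.eval s = f.eval s then 1 else 0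

/-- A configuration: the commands still to be executed, in order (always a list of parts of the
program whose length is bounded in terms of the program alone), the memory, and the output tape,
where `none` is the separator. -/
structure Config where
  todo : List Cmd
  store : Store
  tape : List (Option ℕ)

/-- One time unit. A configuration with nothing left to execute does not change. -/
noncomputable def step (x : Config) : Config :=
  match x.todo with
  | [] => x
  | .skip :: k => { x with todo := k }
  | .assign a i j e :: k =>
      { x with
        todo := k
        store := x.store.update (a, i.eval x.store, j.eval x.store) (e.eval x.store) }
  | .write e :: k => { x with todo := k, tape := x.tape ++ [some (e.eval x.store)] }
  | .emit :: k => { x with todo := k, tape := x.tape ++ [none] }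
  | .seq c d :: k => { x with todo := c :: d :: k }
  | .cond e c d :: k => { x with todo := (if e.eval x.store ≠ 0 then c else d) :: k }
  | .loop e c :: k =>
      { x with todo := if e.eval x.store ≠ 0 then c :: .loop e c :: k else k }

/-- The configuration after `t` time units, when `c` is started on the memory `s` with an empty
output tape. -/
noncomputable def run (c : Cmd) (s : Store) (t : ℕ) : Config :=
  step^[t] ⟨[c], s, []⟩

/-- The program has terminated. -/
def Config.Halted (x : Config) : Prop := x.todo = []

/-- The number of completed outputs. -/
def Config.numOutputs (x : Config) : ℕ := x.tape.count none

/-- The space in use, in bits: for every cell with a nonzero content, the number of bits of its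
address and of its content. -/
noncomputable def Config.space (x : Config) : ℕ :=
  x.store.sum fun p v => p.1.size + p.2.1.size + p.2.2.size + v.size

/-- Started on `s`, the program `c` terminates and outputs exactly the words `ws`, in this order,
where the first output (or the termination, if `ws` is empty) comes within `pre` time units, the
time between two consecutive outputs and the time between the last output and the termination are
at most `delay`, and the space in use never exceeds `space`. Here `τ j` is the time at which output
number `j` (counted from `0`) is completed, and `τ ws.length` is the time of termination. -/
def Enumerates (c : Cmd) (s : Store) (ws : List (List ℕ)) (pre delay space : ℕ) : Prop :=
  ∃ τ : ℕ → ℕ,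
    (∀ j < ws.length, ∀ t, j < (run c s t).numOutputs ↔ τ j ≤ t) ∧
    (∀ t, (run c s t).Halted ↔ τ ws.length ≤ t) ∧
    (run c s (τ ws.length)).tape = ws.flatMap (fun w => w.map some ++ [none]) ∧
    τ 0 ≤ pre ∧
    (∀ j < ws.length, τ (j + 1) ≤ τ j + delay) ∧
    ∀ t, (run c s t).space ≤ space

open Classical in
/-- The input: cell `(0, 0, 0)` holds the number `n` of vertices, cell `(1, u, v)` holds `1` if `u`
and `v` are adjacent vertices, and all other cells hold `0`. -/
noncomputable def inputStore {n : ℕ} (G : SimpleGraph (Fin n)) : Store :=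
  Finsupp.single (0, 0, 0) n +
    ∑ p : Fin n × Fin n with G.Adj p.1 p.2, Finsupp.single (1, (p.1 : ℕ), (p.2 : ℕ)) 1

/-- The word for a set of edges: the concatenation of `u v` over its elements `{u, v}`, `u < v`,
in lexicographic order. -/
def encode {n : ℕ} (D : Finset (Sym2 (Fin n))) : List ℕ :=
  (List.finRange n).flatMap fun u =>
    (List.finRange n).flatMap fun v =>
      if u < v ∧ s(u, v) ∈ D then [(u : ℕ), (v : ℕ)] else []

end RamWhile

namespace EdgeDom

/-! ### Minimal edge dominating sets as star forests -/

/-! By `minimal_iff_isGood` the minimal edge dominating sets are the star forests D described by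
`IsGood`: every edge of the graph has a covered endpoint, and each leaf b of a star with several
leaves has an uncovered neighbour w, so that bw is no longer dominated once the edge at b is
removed. An isolated edge of D is its own witness.

These sets are listed by reverse search. The root is a greedy maximal matching M. Every other D gets
a parent of smaller `rank`, the result of its first good move, where moves are numbered below n^10
and a move is good if its result is again in the family, has smaller rank, and determines D through
the inverse move. The children of a node are therefore found by undoing all n^10 moves and keeping
those D whose first good move has the number being tried. The traversal of this tree needs no stack:
its state is the current set and the current move number.

The combinatorial core is `exists_goodMove`. If changing at most five edges leads to a set of
smaller rank, toggling these edges is such a move, and it is its own inverse. So let D be locally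
optimal. A matching other than M can be exchanged towards M (`eq_of_matching`), so D has a star with
centre c and at least two leaves. Take a leaf a and an uncovered neighbour w of a. The `flip`
replaces ca by aw and drops the leaves that relied on w alone, keeping one per star. Given w, a and
c, it can be undone: the dropped leaves are exactly the uncovered neighbours of w, and each returns
to the smallest centre that can take it. That this is the old centre follows from local optimality:
adjacent leaves are restricted by `adj_leaves` and `not_adj_centre`, and a smaller centre is
excluded by `not_reattach`, since `weight` breaks ties in favour of small centres.

The delay is polynomial because a search step that finds no child lowers `potential`: it raises the
move number or goes to a parent of smaller rank. Completeness is `visits_good`. There are no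
repetitions because a deterministic walk that ends cannot be in the same state twice
(`nodup_found`).

For the machine, `Dfn` is a class of functions computable in polynomial time, closed under
substitution and bounded sums; bounded quantifiers, products, quotients and minima follow, so each
search step is definable. `enumerates_loop` turns a loop of such steps into an enumeration with
bounded delay. Space is bounded by controlling the memory at the loop tests and observing that few
bits can be added in between (`small_iterate`). -/

/-- The unordered pairs `{u, v}` and `{x, y}` are equal. -/
def SamePair (u v x y : ℕ) : Prop := (u = x ∧ v = y) ∨ (u = y ∧ v = x)

/-- The vertex `v` is covered by an edge of `D`. -/
def Cov (D : ℕ → ℕ → Prop) (v : ℕ) : Prop := ∃ u, D v u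

/-- `D` is a star forest in the graph `A`, the uncovered vertices are independent and every leaf of
a star with at least two leaves has an uncovered neighbour. -/
structure IsGood (A D : ℕ → ℕ → Prop) : Prop where
  symm : ∀ u v, D u v → D v u
  sub : ∀ u v, D u v → A u v
  dom : ∀ u v, A u v → Cov D u ∨ Cov D v
  star : ∀ c b b', D c b → D c b' → b ≠ b' → (∀ x, D b x → x = c) ∧ ∃ w, A b w ∧ ¬ Cov D w

/-- A graph on the vertices `0, …, n - 1`. -/
structure IsGraph (n : ℕ) (A : ℕ → ℕ → Prop) : Prop where
  symm : ∀ u v, A u v → A v u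
  irrefl : ∀ u, ¬ A u u
  lt : ∀ u v, A u v → u < n

theorem IsGraph.lt' {n : ℕ} {A : ℕ → ℕ → Prop} (h : IsGraph n A) {u v : ℕ} (huv : A u v) : v < n :=
  h.lt v u (h.symm u v huv)

/-! ### Indicator sums and the rank. -/

open Classical in
/-- The indicator of a proposition. -/
noncomputable def ind (P : Prop) : ℕ := if P then 1 else 0

theorem ind_true {P : Prop} (h : P) : ind P = 1 := by simp [ind, h]

theorem ind_false {P : Prop} (h : ¬ P) : ind P = 0 := by simp [ind, h]

theorem ind_le_one (P : Prop) : ind P ≤ 1 := by unfold ind; split <;> omega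

theorem ind_mono {P Q : Prop} (h : P → Q) : ind P ≤ ind Q := by
  by_cases hP : P
  · rw [ind_true hP, ind_true (h hP)]
  · rw [ind_false hP]; omega

theorem ind_congr {P Q : Prop} (h : P ↔ Q) : ind P = ind Q := by rw [propext h]

/-- The number of edges of `D` at `v`. -/
noncomputable def deg (n : ℕ) (D : ℕ → ℕ → Prop) (v : ℕ) : ℕ := ∑ u ∈ Finset.range n, ind (D v u)

/-- The number of leaves of a star forest that exceed the first one of their star. -/
noncomputable def excess (n : ℕ) (D : ℕ → ℕ → Prop) : ℕ := ∑ v ∈ Finset.range n, (deg n D v - 1)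

/-- The sum of all endpoints of the edges of `D`, taken over ordered pairs. -/
noncomputable def weight (n : ℕ) (D : ℕ → ℕ → Prop) : ℕ :=
  ∑ u ∈ Finset.range n, ∑ v ∈ Finset.range n, ind (D u v) * (u + v)

/-- The number of ordered pairs in `M` but not in `D`. -/
noncomputable def missing (n : ℕ) (M D : ℕ → ℕ → Prop) : ℕ :=
  ∑ u ∈ Finset.range n, ∑ v ∈ Finset.range n, ind (M u v ∧ ¬ D u v)

open Classical in
/-- The rank of a node of the search tree. -/
noncomputable def rank (n : ℕ) (M D : ℕ → ℕ → Prop) : ℕ :=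
  if excess n D = 0 then missing n M D
  else (n * (n * (n + n)) + 1) * excess n D + weight n D

theorem weight_le (n : ℕ) (D : ℕ → ℕ → Prop) : weight n D ≤ n * (n * (n + n)) := by
  have : ∀ u ∈ Finset.range n, ∑ v ∈ Finset.range n, ind (D u v) * (u + v) ≤ n * (n + n) := by
    intro u hu
    have := Finset.sum_le_card_nsmul (Finset.range n) (fun v => ind (D u v) * (u + v)) (n + n) ?_
    · simpa using this
    · intro v hv
      simp only [Finset.mem_range] at hu hv
      calc ind (D u v) * (u + v) ≤ 1 * (n + n) := Nat.mul_le_mul (ind_le_one _) (by omega)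
        _ = n + n := one_mul _
  simpa [weight] using Finset.sum_le_card_nsmul (Finset.range n) _ _ this

theorem missing_le (n : ℕ) (M D : ℕ → ℕ → Prop) : missing n M D ≤ n * n := by
  have : ∀ u ∈ Finset.range n, ∑ v ∈ Finset.range n, ind (M u v ∧ ¬ D u v) ≤ n := by
    intro u _
    simpa using Finset.sum_le_card_nsmul (Finset.range n) (fun v => ind (M u v ∧ ¬ D u v)) 1
      (fun v _ => ind_le_one _)
  simpa [missing] using Finset.sum_le_card_nsmul (Finset.range n) _ _ this

theorem deg_le (n : ℕ) (D : ℕ → ℕ → Prop) (v : ℕ) : deg n D v ≤ n := by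
  simpa [deg] using Finset.sum_le_card_nsmul (Finset.range n) (fun u => ind (D v u)) 1
    (fun u _ => ind_le_one _)

theorem excess_le (n : ℕ) (D : ℕ → ℕ → Prop) : excess n D ≤ n * n := by
  have : ∀ v ∈ Finset.range n, deg n D v - 1 ≤ n := fun v _ => by
    have := deg_le n D v
    omega
  simpa [excess] using Finset.sum_le_card_nsmul (Finset.range n) _ _ this

theorem missing_le_weight_bound (n : ℕ) (M D : ℕ → ℕ → Prop) :
    missing n M D ≤ n * (n * (n + n)) := by
  refine (missing_le n M D).trans (Nat.mul_le_mul le_rfl ?_)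
  rcases Nat.eq_zero_or_pos n with h | h
  · simp [h]
  · exact Nat.le_mul_of_pos_right n (by omega)

/-- A bound for the ranks. -/
def rankBound (n : ℕ) : ℕ := (n * (n * (n + n)) + 1) * (n * n) + n * (n * (n + n))

theorem rank_le (n : ℕ) (M D : ℕ → ℕ → Prop) : rank n M D ≤ rankBound n := by
  unfold rank rankBound
  split
  · have := missing_le_weight_bound n M D
    omega
  · exact Nat.add_le_add (Nat.mul_le_mul le_rfl (excess_le n D)) (weight_le n D)

/-- The multiplier in `rank` exceeds both `weight` and `missing`, so the excess dominates, also when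
it drops to 0 and the rank switches to `missing`. -/
theorem rank_lt_of_excess_lt {n : ℕ} {M D E : ℕ → ℕ → Prop} (h : excess n E < excess n D) :
    rank n M E < rank n M D := by
  have hD : ¬ excess n D = 0 := by omega
  have h1 := weight_le n E
  have h2 := missing_le_weight_bound n M E
  have h3 : (n * (n * (n + n)) + 1) * (excess n E + 1) ≤ (n * (n * (n + n)) + 1) * excess n D :=
    Nat.mul_le_mul le_rfl h
  rw [Nat.mul_add, Nat.mul_one] at h3
  unfold rank
  rw [if_neg hD]
  split
  · omega
  · omega

theorem deg_mono {n : ℕ} {D E : ℕ → ℕ → Prop} {v : ℕ} (h : ∀ u, E v u → D v u) :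
    deg n E v ≤ deg n D v :=
  Finset.sum_le_sum fun u _ => ind_mono (h u)

theorem deg_lt {n : ℕ} {D E : ℕ → ℕ → Prop} {v u : ℕ} (h : ∀ u, E v u → D v u) (hu : u < n)
    (hD : D v u) (hE : ¬ E v u) : deg n E v < deg n D v := by
  refine Finset.sum_lt_sum (fun u _ => ind_mono (h u)) ⟨u, Finset.mem_range.2 hu, ?_⟩
  rw [ind_true hD, ind_false hE]
  exact one_pos

theorem deg_le_one {n : ℕ} {D : ℕ → ℕ → Prop} {v : ℕ} (h : ∀ u u', D v u → D v u' → u = u') :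
    deg n D v ≤ 1 := by
  by_cases hv : ∃ u, D v u
  · obtain ⟨u, hu⟩ := hv
    calc deg n D v ≤ ∑ x ∈ Finset.range n, if u = x then 1 else 0 := by
          refine Finset.sum_le_sum fun x _ => ?_
          by_cases hx : D v x
          · rw [if_pos (h u x hu hx), ind_true hx]
          · rw [ind_false hx]; omega
      _ ≤ 1 := by rw [Finset.sum_ite_eq]; split <;> omega
  · have : deg n D v = 0 := Finset.sum_eq_zero fun x _ => ind_false fun hx => hv ⟨x, hx⟩
    omega

theorem one_le_deg {n : ℕ} {D : ℕ → ℕ → Prop} {v u : ℕ} (hu : u < n) (h : D v u) :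
    1 ≤ deg n D v := by
  have := Finset.single_le_sum (f := fun u => ind (D v u)) (fun i _ => Nat.zero_le _)
    (Finset.mem_range.2 hu)
  rw [ind_true h] at this
  exact this

theorem two_le_deg {n : ℕ} {D : ℕ → ℕ → Prop} {v u u' : ℕ} (hu : u < n) (hu' : u' < n)
    (h : D v u) (h' : D v u') (hne : u ≠ u') : 2 ≤ deg n D v := by
  have h1 : deg n (fun x y => D x y ∧ y ≠ u) v < deg n D v :=
    deg_lt (fun y hy => hy.1) hu h (fun hy => hy.2 rfl)
  have h2 : 1 ≤ deg n (fun x y => D x y ∧ y ≠ u) v := one_le_deg hu' ⟨h', hne.symm⟩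
  omega

theorem excess_eq_zero_of_matching {n : ℕ} {D : ℕ → ℕ → Prop}
    (h : ∀ c b b', D c b → D c b' → b = b') : excess n D = 0 :=
  Finset.sum_eq_zero fun v _ => by
    have := deg_le_one (n := n) (h v)
    omega

/-- The excess drops if the degrees do not grow, except possibly to `1`, and a centre loses a
leaf. -/
theorem excess_lt {n : ℕ} {D E : ℕ → ℕ → Prop} {c : ℕ} (hc : c < n)
    (h : ∀ v, (∀ u, E v u → D v u) ∨ ∀ u u', E v u → E v u' → u = u')
    (hlt : deg n E c < deg n D c) (h2 : 2 ≤ deg n D c) : excess n E < excess n D := by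
  refine Finset.sum_lt_sum (fun v _ => ?_) ⟨c, Finset.mem_range.2 hc, by omega⟩
  rcases h v with h | h
  · have := deg_mono (n := n) h
    omega
  · have := deg_le_one (n := n) h
    omega

/-! ### Local moves -/

theorem not_samePair {L : List (ℕ × ℕ)} {u v x y : ℕ} (h1 : (u, v) ∉ L) (h2 : (v, u) ∉ L)
    (h : (x, y) ∈ L) : ¬ SamePair u v x y := by
  rintro (⟨rfl, rfl⟩ | ⟨rfl, rfl⟩)
  exacts [h1 h, h2 h]

/-- `D` and `E` differ in at most five edges. -/
def LocalMove (D E : ℕ → ℕ → Prop) : Prop :=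
  ∃ L : List (ℕ × ℕ), L.length ≤ 5 ∧ ∀ u v, (u, v) ∉ L → (v, u) ∉ L → (D u v ↔ E u v)

/-- No local move improves `D`. -/
def LocallyOptimal (n : ℕ) (A M D : ℕ → ℕ → Prop) : Prop :=
  ∀ E, IsGood A E → LocalMove D E → ¬ rank n M E < rank n M D

section
variable {n : ℕ} {A M D : ℕ → ℕ → Prop}

theorem IsGood.leaf (hD : IsGood A D) {q p b : ℕ} (h : D p q) (hb : D p b) (hne : b ≠ q) :
    (∀ x, D q x → x = p) ∧ ∃ w, A q w ∧ ¬ Cov D w :=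
  hD.star p q b h hb hne.symm

/-- Replace the edges pq and cz by qz. The spare leaves b and b', distinct from q and z, keep p and
c covered, so coverage and private neighbours survive, while p loses a leaf and the excess drops.
The case p = c is allowed. -/
theorem not_adj_leaves (hA : IsGraph n A) (hD : IsGood A D) (hopt : LocallyOptimal n A M D)
    {p q c z b b' : ℕ} (hpq : D p q) (hpb : D p b) (hbq : b ≠ q) (hbz : b ≠ z)
    (hcz : D c z) (hcb : D c b') (hbz' : b' ≠ z) (hbq' : b' ≠ q) (hqz : A q z) : False := by
  obtain ⟨hq, -⟩ := hD.leaf hpq hpb hbq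
  obtain ⟨hz, -⟩ := hD.leaf hcz hcb hbz'
  have hqz' : q ≠ z := fun h => hA.irrefl z (h ▸ hqz)
  have hpz : p ≠ z := fun h => by subst h; exact hbq ((hz b hpb).trans (hz q hpq).symm)
  have hcq : c ≠ q := fun h => by subst h; exact hbz' ((hq b' hcb).trans (hq z hcz).symm)
  have hpq' : p ≠ q := fun h => hA.irrefl q (hD.sub _ _ (h ▸ hpq))
  have hcz' : c ≠ z := fun h => hA.irrefl z (hD.sub _ _ (h ▸ hcz))
  have hs := hD.symm
  set E : ℕ → ℕ → Prop := fun u v =>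
    (D u v ∧ ¬ SamePair u v p q ∧ ¬ SamePair u v c z) ∨ SamePair u v q z with hE
  have hcov : ∀ v, Cov E v ↔ Cov D v := by
    intro v
    constructor
    · rintro ⟨u, ⟨h, -⟩ | ⟨rfl, rfl⟩ | ⟨rfl, rfl⟩⟩
      exacts [⟨u, h⟩, ⟨p, hs _ _ hpq⟩, ⟨c, hs _ _ hcz⟩]
    · rintro ⟨u, h⟩
      by_cases h1 : v = q
      · exact ⟨z, Or.inr (Or.inl ⟨h1, rfl⟩)⟩
      by_cases h2 : v = z
      · exact ⟨q, Or.inr (Or.inr ⟨h2, rfl⟩)⟩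
      by_cases h3 : v = p
      · refine ⟨b, Or.inl ⟨h3 ▸ hpb, ?_, ?_⟩⟩ <;> unfold SamePair <;> omega
      by_cases h4 : v = c
      · refine ⟨b', Or.inl ⟨h4 ▸ hcb, ?_, ?_⟩⟩ <;> unfold SamePair <;> omega
      refine ⟨u, Or.inl ⟨h, ?_, ?_⟩⟩ <;> unfold SamePair <;> omega
  have hEq : ∀ x, E q x → x = z := by
    rintro x (⟨h, h1, h2⟩ | ⟨h, h'⟩ | ⟨h, h'⟩)
    · exact absurd (Or.inr ⟨rfl, hq x h⟩) h1
    · exact h'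
    · omega
  have hEz : ∀ x, E z x → x = q := by
    rintro x (⟨h, h1, h2⟩ | ⟨h, h'⟩ | ⟨h, h'⟩)
    · exact absurd (Or.inr ⟨rfl, hz x h⟩) h2
    · omega
    · exact h'
  have hother : ∀ v u, v ≠ q → v ≠ z → E v u → D v u ∧ u ≠ q ∧ u ≠ z := by
    rintro v u h1 h2 (⟨h, h3, h4⟩ | ⟨h, h'⟩ | ⟨h, h'⟩)
    · refine ⟨h, ?_, ?_⟩
      · rintro rfl
        exact h3 (Or.inl ⟨hq v (hs _ _ h), rfl⟩)
      · rintro rfl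
        exact h4 (Or.inl ⟨hz v (hs _ _ h), rfl⟩)
    · exact absurd h h1
    · exact absurd h h2
  refine hopt E ⟨?_, ?_, ?_, ?_⟩ ⟨[(p, q), (c, z), (q, z)], by simp, ?_⟩ ?_
  · rintro u v (⟨h, h1, h2⟩ | h)
    · refine Or.inl ⟨hs _ _ h, ?_, ?_⟩ <;> unfold SamePair at * <;> omega
    · right; unfold SamePair at *; omega
  · rintro u v (⟨h, -⟩ | ⟨rfl, rfl⟩ | ⟨rfl, rfl⟩)
    exacts [hD.sub _ _ h, hqz, hA.symm _ _ hqz]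
  · intro u v h
    rw [hcov, hcov]
    exact hD.dom u v h
  · intro x y y' hy hy' hne
    by_cases h1 : x = q
    · subst h1; exact absurd ((hEq _ hy).trans (hEq _ hy').symm) hne
    by_cases h2 : x = z
    · subst h2; exact absurd ((hEz _ hy).trans (hEz _ hy').symm) hne
    obtain ⟨hy, hyq, hyz⟩ := hother x y h1 h2 hy
    obtain ⟨hy', -, -⟩ := hother x y' h1 h2 hy'
    obtain ⟨hl, w, hw, hw'⟩ := hD.star x y y' hy hy' hne
    exact ⟨fun t ht => hl t (hother y t hyq hyz ht).1, w, hw, fun h => hw' ((hcov w).1 h)⟩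
  · intro u v h1 h2
    have := fun x y => not_samePair (x := x) (y := y) h1 h2
    simp only [hE]
    rw [eq_false (this p q (by simp)), eq_false (this c z (by simp)), eq_false (this q z (by simp))]
    simp
  · refine rank_lt_of_excess_lt (excess_lt (c := p) (hA.lt _ _ (hD.sub _ _ hpq)) ?_ ?_ ?_)
    · intro v
      by_cases h1 : v = q
      · subst h1; exact Or.inr fun u u' h h' => (hEq u h).trans (hEq u' h').symm
      by_cases h2 : v = z
      · subst h2; exact Or.inr fun u u' h h' => (hEz u h).trans (hEz u' h').symm
      exact Or.inl fun u h => (hother v u h1 h2 h).1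
    · exact deg_lt (u := q) (fun u h => (hother p u hpq' hpz h).1) (hA.lt _ _ hqz) hpq
        fun h => (hother p q hpq' hpz h).2.1 rfl
    · exact two_le_deg (hA.lt _ _ hqz) (hA.lt' (hD.sub _ _ hpb)) hpq hpb hbq.symm

/-- Adjacent leaves of stars with several leaves are the two leaves of one star. -/
theorem adj_leaves (hA : IsGraph n A) (hD : IsGood A D) (hopt : LocallyOptimal n A M D)
    {p q c z b b' : ℕ} (hpq : D p q) (hpb : D p b) (hbq : b ≠ q)
    (hcz : D c z) (hcb : D c b') (hbz' : b' ≠ z) (hqz : A q z) :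
    p = c ∧ ∀ x, D p x → x = q ∨ x = z := by
  obtain ⟨hq, -⟩ := hD.leaf hpq hpb hbq
  obtain ⟨hz, -⟩ := hD.leaf hcz hcb hbz'
  -- For different centres b and b' are automatically distinct from z and q, since a leaf has only
  -- one centre. For a common centre, a third leaf serves as both spare leaves.
  have hpc : p = c := by
    by_contra hne
    refine not_adj_leaves hA hD hopt hpq hpb hbq ?_ hcz hcb hbz' ?_ hqz
    · rintro rfl
      exact hne (hz p (hD.symm _ _ hpb))
    · rintro rfl
      exact hne (hq c (hD.symm _ _ hcb)).symm
  refine ⟨hpc, fun x hx => ?_⟩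
  subst hpc
  by_contra hne
  rw [not_or] at hne
  exact not_adj_leaves hA hD hopt hpq hx hne.1 hne.2 hcz hx hne.2 hne.1 hqz

/-- Replace pq, pz and cy by qz and py: the leaf b keeps c covered, coverage is unchanged, and p is
left with one edge. This move uses all five edges that `LocalMove` permits. -/
theorem not_adj_centre (hA : IsGraph n A) (hD : IsGood A D) (hopt : LocallyOptimal n A M D)
    {p q z c y b : ℕ} (hpq : D p q) (hpz : D p z) (hqz : A q z) (hp : ∀ x, D p x → x = q ∨ x = z)
    (hcy : D c y) (hcb : D c b) (hby : b ≠ y) (hyq : y ≠ q) (hyz : y ≠ z) (hpy : A p y) :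
    False := by
  have hqz' : q ≠ z := fun h => hA.irrefl z (h ▸ hqz)
  obtain ⟨hq, -⟩ := hD.leaf hpq hpz hqz'.symm
  obtain ⟨hz, -⟩ := hD.leaf hpz hpq hqz'
  obtain ⟨hy, -⟩ := hD.leaf hcy hcb hby
  have hs := hD.symm
  have hcp : c ≠ p := fun h => by subst h; rcases hp y hcy with h | h <;> omega
  have hpq' : p ≠ q := fun h => hA.irrefl q (hD.sub _ _ (h ▸ hpq))
  have hpz' : p ≠ z := fun h => hA.irrefl z (hD.sub _ _ (h ▸ hpz))
  have hpy' : p ≠ y := fun h => hA.irrefl y (h ▸ hpy)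
  have hcy' : c ≠ y := fun h => hA.irrefl y (hD.sub _ _ (h ▸ hcy))
  have hcq : c ≠ q := fun h => by subst h; exact hpy' (hq y hcy).symm
  have hcz : c ≠ z := fun h => by subst h; exact hpy' (hz y hcy).symm
  set E : ℕ → ℕ → Prop := fun u v =>
    (D u v ∧ ¬ SamePair u v p q ∧ ¬ SamePair u v p z ∧ ¬ SamePair u v c y) ∨
      SamePair u v q z ∨ SamePair u v p y with hE
  have hbq : b ≠ q := fun h => by subst h; exact hcp (hq c (hs _ _ hcb))
  have hbz : b ≠ z := fun h => by subst h; exact hcp (hz c (hs _ _ hcb))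
  have hcov : ∀ v, Cov E v ↔ Cov D v := by
    intro v
    constructor
    · rintro ⟨u, ⟨h, -⟩ | (⟨rfl, rfl⟩ | ⟨rfl, rfl⟩) | (⟨rfl, rfl⟩ | ⟨rfl, rfl⟩)⟩
      exacts [⟨u, h⟩, ⟨p, hs _ _ hpq⟩, ⟨p, hs _ _ hpz⟩, ⟨q, hpq⟩, ⟨c, hs _ _ hcy⟩]
    · rintro ⟨u, h⟩
      by_cases h1 : v = q
      · exact ⟨z, Or.inr (Or.inl (Or.inl ⟨h1, rfl⟩))⟩
      by_cases h2 : v = z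
      · exact ⟨q, Or.inr (Or.inl (Or.inr ⟨h2, rfl⟩))⟩
      by_cases h3 : v = p
      · exact ⟨y, Or.inr (Or.inr (Or.inl ⟨h3, rfl⟩))⟩
      by_cases h3 : v = y
      · exact ⟨p, Or.inr (Or.inr (Or.inr ⟨h3, rfl⟩))⟩
      by_cases h4 : v = c
      · refine ⟨b, Or.inl ⟨h4 ▸ hcb, ?_, ?_, ?_⟩⟩ <;> unfold SamePair <;> omega
      refine ⟨u, Or.inl ⟨h, ?_, ?_, ?_⟩⟩ <;> unfold SamePair <;> omega
  have hEq : ∀ x, E q x → x = z := by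
    rintro x (⟨h, h1, h2⟩ | (⟨h, h'⟩ | ⟨h, h'⟩) | (⟨h, h'⟩ | ⟨h, h'⟩))
    · exact absurd (Or.inr ⟨rfl, hq x h⟩) h1
    all_goals omega
  have hEz : ∀ x, E z x → x = q := by
    rintro x (⟨h, h1, h2, h3⟩ | (⟨h, h'⟩ | ⟨h, h'⟩) | (⟨h, h'⟩ | ⟨h, h'⟩))
    · exact absurd (Or.inr ⟨rfl, hz x h⟩) h2
    all_goals omega
  have hEy : ∀ x, E y x → x = p := by
    rintro x (⟨h, h1, h2, h3⟩ | (⟨h, h'⟩ | ⟨h, h'⟩) | (⟨h, h'⟩ | ⟨h, h'⟩))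
    · exact absurd (Or.inr ⟨rfl, hy x h⟩) h3
    all_goals omega
  have hEp : ∀ x, E p x → x = y := by
    rintro x (⟨h, h1, h2, h3⟩ | (⟨h, h'⟩ | ⟨h, h'⟩) | (⟨h, h'⟩ | ⟨h, h'⟩))
    · rcases hp x h with rfl | rfl
      · exact absurd (Or.inl ⟨rfl, rfl⟩) h1
      · exact absurd (Or.inl ⟨rfl, rfl⟩) h2
    all_goals omega
  have hother : ∀ v u, v ≠ q → v ≠ z → v ≠ y → v ≠ p → E v u →
      D v u ∧ u ≠ q ∧ u ≠ z ∧ u ≠ y ∧ u ≠ p := by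
    rintro v u h1 h2 h3 h4 (⟨h, h5, h6, h7⟩ | (⟨h, h'⟩ | ⟨h, h'⟩) | (⟨h, h'⟩ | ⟨h, h'⟩))
    · refine ⟨h, ?_, ?_, ?_, ?_⟩ <;> rintro rfl
      · exact h4 (hq v (hs _ _ h))
      · exact h4 (hz v (hs _ _ h))
      · exact h7 (Or.inl ⟨hy v (hs _ _ h), rfl⟩)
      · rcases hp v (hs _ _ h) with h | h <;> omega
    all_goals omega
  refine hopt E ⟨?_, ?_, ?_, ?_⟩ ⟨[(p, q), (p, z), (c, y), (q, z), (p, y)], by simp, ?_⟩ ?_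
  · rintro u v (⟨h, h1, h2, h3⟩ | h)
    · refine Or.inl ⟨hs _ _ h, ?_, ?_, ?_⟩ <;> unfold SamePair at * <;> omega
    · right; unfold SamePair at *; omega
  · rintro u v (⟨h, -⟩ | (⟨rfl, rfl⟩ | ⟨rfl, rfl⟩) | (⟨rfl, rfl⟩ | ⟨rfl, rfl⟩))
    exacts [hD.sub _ _ h, hqz, hA.symm _ _ hqz, hpy, hA.symm _ _ hpy]
  · intro u v h
    rw [hcov, hcov]
    exact hD.dom u v h
  · intro x s s' hs1 hs2 hne
    by_cases h1 : x = q
    · subst h1; exact absurd ((hEq _ hs1).trans (hEq _ hs2).symm) hne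
    by_cases h2 : x = z
    · subst h2; exact absurd ((hEz _ hs1).trans (hEz _ hs2).symm) hne
    by_cases h3 : x = y
    · subst h3; exact absurd ((hEy _ hs1).trans (hEy _ hs2).symm) hne
    by_cases h4 : x = p
    · subst h4; exact absurd ((hEp _ hs1).trans (hEp _ hs2).symm) hne
    obtain ⟨hs1, g1, g2, g3, g4⟩ := hother x s h1 h2 h3 h4 hs1
    obtain ⟨hs2, -⟩ := hother x s' h1 h2 h3 h4 hs2
    obtain ⟨hl, w, hw, hw'⟩ := hD.star x s s' hs1 hs2 hne
    exact ⟨fun t ht => hl t (hother s t g1 g2 g3 g4 ht).1, w, hw, fun h => hw' ((hcov w).1 h)⟩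
  · intro u v h1 h2
    have := fun x y => not_samePair (x := x) (y := y) h1 h2
    simp only [hE]
    rw [eq_false (this p q (by simp)), eq_false (this p z (by simp)),
      eq_false (this c y (by simp)), eq_false (this q z (by simp)), eq_false (this p y (by simp))]
    simp
  · have hd : 2 ≤ deg n D p := two_le_deg (hA.lt _ _ hqz) (hA.lt' hqz) hpq hpz hqz'
    refine rank_lt_of_excess_lt (excess_lt (c := p) (hA.lt _ _ hpy) ?_ ?_ hd)
    · intro v
      by_cases h1 : v = q
      · subst h1; exact Or.inr fun u u' h h' => (hEq u h).trans (hEq u' h').symm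
      by_cases h2 : v = z
      · subst h2; exact Or.inr fun u u' h h' => (hEz u h).trans (hEz u' h').symm
      by_cases h3 : v = y
      · subst h3; exact Or.inr fun u u' h h' => (hEy u h).trans (hEy u' h').symm
      by_cases h4 : v = p
      · subst h4; exact Or.inr fun u u' h h' => (hEp u h).trans (hEp u' h').symm
      exact Or.inl fun u h => (hother v u h1 h2 h3 h4 h).1
    · exact lt_of_le_of_lt (deg_le_one fun u u' h h' => (hEp u h).trans (hEp u' h').symm) hd

/-- A leaf cannot be moved to a smaller centre. -/
theorem not_reattach (hA : IsGraph n A) (hD : IsGood A D) (hopt : LocallyOptimal n A M D)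
    {z p b p' : ℕ} (hpz : D p z) (hpb : D p b) (hbz : b ≠ z) (hzp : A z p') (hcp : Cov D p')
    (hst : ∀ y, D p' y → (∀ x, D y x → x = p' ∨ x = z) ∧ ∃ w, A y w ∧ ¬ Cov D w)
    (hlt : p' < p) : False := by
  obtain ⟨hz, hzw⟩ := hD.leaf hpz hpb hbz
  have hs := hD.symm
  have hpz' : p ≠ z := fun h => hA.irrefl z (hD.sub _ _ (h ▸ hpz))
  have hzp' : z ≠ p' := fun h => hA.irrefl p' (h ▸ hzp)
  -- Only the edge at z moves. The vertex p keeps b and p' was covered before, so coverage is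
  -- unchanged; one surplus leaf passes from p to p', so the excess stays the same and the weight
  -- falls by 2(p - p'). The alternative `x = z` in `hst` admits the star whose only leaves are z
  -- and p': there p' becomes the centre and p a leaf.
  set E : ℕ → ℕ → Prop := fun u v =>
    (D u v ∧ ¬ SamePair u v z p) ∨ SamePair u v z p' with hE
  have hEz : ∀ x, E z x → x = p' := by
    rintro x (⟨h, h1⟩ | ⟨h, h'⟩ | ⟨h, h'⟩)
    · exact absurd (Or.inl ⟨rfl, hz x h⟩) h1
    all_goals omega
  have hother : ∀ v u, v ≠ z → v ≠ p' → E v u → D v u ∧ u ≠ z := by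
    rintro v u h1 h2 (⟨h, h3⟩ | ⟨h, h'⟩ | ⟨h, h'⟩)
    · refine ⟨h, ?_⟩
      rintro rfl
      exact h3 (Or.inr ⟨hz v (hs _ _ h), rfl⟩)
    all_goals omega
  have hEp' : ∀ x, E p' x → D p' x ∧ x ≠ z ∨ x = z := by
    rintro x (⟨h, h1⟩ | ⟨h, h'⟩ | ⟨h, h'⟩)
    · by_cases hx : x = z
      · exact Or.inr hx
      · exact Or.inl ⟨h, hx⟩
    · omega
    · exact Or.inr h'
  have hDp'z : ¬ D p' z := fun h => by have := hz p' (hs _ _ h); omega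
  have hcov : ∀ v, Cov E v ↔ Cov D v := by
    intro v
    constructor
    · rintro ⟨u, ⟨h, -⟩ | ⟨rfl, rfl⟩ | ⟨rfl, rfl⟩⟩
      exacts [⟨u, h⟩, ⟨p, hs _ _ hpz⟩, hcp]
    · rintro ⟨u, h⟩
      by_cases h1 : v = z
      · exact ⟨p', Or.inr (Or.inl ⟨h1, rfl⟩)⟩
      by_cases h2 : v = p
      · refine ⟨b, Or.inl ⟨h2 ▸ hpb, ?_⟩⟩; unfold SamePair; omega
      · refine ⟨u, Or.inl ⟨h, ?_⟩⟩; unfold SamePair; omega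
  have hstar : ∀ x y y', E x y → E x y' → y ≠ y' → ∀ t, E y t → t = x := by
    intro x y y' hy hy' hne t ht
    by_cases h1 : x = z
    · subst h1; exact absurd ((hEz _ hy).trans (hEz _ hy').symm) hne
    by_cases h2 : x = p'
    · subst h2
      by_cases h3 : y = z
      · subst h3; exact hEz t ht
      have hxy : D x y := ((hEp' y hy).resolve_right h3).1
      have hyp : y ≠ x := fun h => hA.irrefl x (hD.sub _ _ (h ▸ hxy))
      obtain ⟨ht, htz⟩ := hother y t h3 hyp ht
      exact ((hst y hxy).1 t ht).resolve_right htz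
    obtain ⟨hxy, hyz⟩ := hother x y h1 h2 hy
    obtain ⟨hxy', hyz'⟩ := hother x y' h1 h2 hy'
    have hyp : y ≠ p' := by
      intro h
      have h3 := ((hst x (h ▸ hs _ _ hxy)).1 y' hxy')
      omega
    obtain ⟨ht, -⟩ := hother y t hyz hyp ht
    exact (hD.star x y y' hxy hxy' hne).1 t ht
  have hpriv : ∀ x y y', E x y → E x y' → y ≠ y' → ∃ w, A y w ∧ ¬ Cov E w := by
    intro x y y' hy hy' hne
    simp only [hcov]
    by_cases h1 : x = z
    · subst h1; exact absurd ((hEz _ hy).trans (hEz _ hy').symm) hne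
    by_cases h2 : x = p'
    · subst h2
      by_cases h3 : y = z
      · subst h3; exact hzw
      exact (hst y ((hEp' y hy).resolve_right h3).1).2
    exact (hD.star x y y' (hother x y h1 h2 hy).1 (hother x y' h1 h2 hy').1 hne).2
  have hzn : z < n := hA.lt _ _ hzp
  have hpn : p < n := hA.lt _ _ (hD.sub _ _ hpz)
  have hpn' : p' < n := hA.lt' hzp
  have hEiff : ∀ u v, E u v ↔ (D u v ∧ ¬ SamePair u v z p) ∨ SamePair u v z p' := fun u v => Iff.rfl
  have hd1 : ∀ v, deg n E v + ind (v = z ∨ v = p) = deg n D v + ind (v = z ∨ v = p') := by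
    intro v
    have h1 : deg n E v + ∑ u ∈ Finset.range n, ind (SamePair v u z p) =
        deg n D v + ∑ u ∈ Finset.range n, ind (SamePair v u z p') := by
      unfold deg
      rw [← Finset.sum_add_distrib, ← Finset.sum_add_distrib]
      refine Finset.sum_congr rfl fun u _ => ?_
      by_cases h1 : SamePair v u z p
      · have hD1 : D v u := by
          rcases h1 with ⟨rfl, rfl⟩ | ⟨rfl, rfl⟩
          exacts [hs _ _ hpz, hpz]
        have h2 : ¬ SamePair v u z p' := by unfold SamePair at *; omega
        rw [ind_true h1, ind_true hD1, ind_false h2, ind_false]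
        rw [hEiff]; tauto
      · by_cases h2 : SamePair v u z p'
        · have hD1 : ¬ D v u := by
            rcases h2 with ⟨rfl, rfl⟩ | ⟨rfl, rfl⟩
            exacts [fun h => hDp'z (hs _ _ h), hDp'z]
          rw [ind_false h1, ind_false hD1, ind_true h2, ind_true]
          rw [hEiff]; tauto
        · rw [ind_false h1, ind_false h2]
          exact congrArg (· + 0) (ind_congr (by rw [hEiff]; tauto))
    have h2 : ∀ r, r < n → z ≠ r → ∑ u ∈ Finset.range n, ind (SamePair v u z r) =
        ind (v = z ∨ v = r) := by
      intro r hr hzr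
      by_cases hvz : v = z
      · rw [Finset.sum_eq_single_of_mem r (Finset.mem_range.2 hr)]
        · exact ind_congr (by simp [SamePair, hvz])
        · exact fun u _ hu => ind_false (by unfold SamePair; omega)
      by_cases hvr : v = r
      · rw [Finset.sum_eq_single_of_mem z (Finset.mem_range.2 hzn)]
        · exact ind_congr (by simp [SamePair, hvr])
        · exact fun u _ hu => ind_false (by unfold SamePair; omega)
      rw [ind_false (by omega)]
      exact Finset.sum_eq_zero fun u _ => ind_false (by unfold SamePair; omega)
    rw [h2 p hpn hpz'.symm, h2 p' hpn' hzp'] at h1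
    exact h1
  have hex : excess n E = excess n D := by
    -- The truncated subtraction in the excess is harmless: p has at least two edges in D and p' at
    -- least one.
    have h1 : excess n E + ∑ v ∈ Finset.range n, ind (v = p) =
        excess n D + ∑ v ∈ Finset.range n, ind (v = p') := by
      unfold excess
      rw [← Finset.sum_add_distrib, ← Finset.sum_add_distrib]
      refine Finset.sum_congr rfl fun v _ => ?_
      have h1 := hd1 v
      by_cases h2 : v = z
      · rw [ind_true (Or.inl h2), ind_true (Or.inl h2)] at h1
        rw [ind_false (by omega), ind_false (by omega)]
        omega
      by_cases h3 : v = p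
      · rw [ind_true (Or.inr h3), ind_false (by omega)] at h1
        rw [ind_true h3, ind_false (by omega)]
        have : 2 ≤ deg n D v := by
          rw [h3]; exact two_le_deg hzn (hA.lt' (hD.sub _ _ hpb)) hpz hpb hbz.symm
        omega
      by_cases h4 : v = p'
      · rw [ind_false (by omega), ind_true (Or.inr h4)] at h1
        rw [ind_true h4, ind_false (by omega)]
        have : 1 ≤ deg n D v := by
          obtain ⟨t, ht⟩ := hcp
          rw [h4]; exact one_le_deg (hA.lt' (hD.sub _ _ ht)) ht
        omega
      rw [ind_false (by omega), ind_false (by omega)] at h1 ⊢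
      omega
    have h2 : ∀ r, r < n → ∑ v ∈ Finset.range n, ind (v = r) = 1 := by
      intro r hr
      rw [Finset.sum_eq_single_of_mem r (Finset.mem_range.2 hr), ind_true rfl]
      exact fun u _ hu => ind_false hu
    rw [h2 p hpn, h2 p' hpn'] at h1
    omega
  have hexpos : ¬ excess n D = 0 := by
    have : 2 ≤ deg n D p := two_le_deg hzn (hA.lt' (hD.sub _ _ hpb)) hpz hpb hbz.symm
    have h1 := Finset.single_le_sum (f := fun v => deg n D v - 1) (fun i _ => Nat.zero_le _)
      (Finset.mem_range.2 hpn)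
    unfold excess
    omega
  have hw : weight n E < weight n D := by
    have h1 : weight n E + ∑ v ∈ Finset.range n, ind (v = z ∨ v = p) * (v + v) =
        weight n D + ∑ v ∈ Finset.range n, ind (v = z ∨ v = p') * (v + v) := by
      -- In a symmetric relation an edge counts each of its endpoints twice, which reduces the
      -- weight to the degrees compared in `hd1`.
      have key : ∀ F : ℕ → ℕ → Prop, (∀ u v, F u v → F v u) →
          weight n F = ∑ v ∈ Finset.range n, deg n F v * (v + v) := by
        intro F hF
        have e1 : weight n F = ∑ u ∈ Finset.range n, deg n F u * u +
            ∑ u ∈ Finset.range n, ∑ v ∈ Finset.range n, ind (F u v) * v := by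
          unfold weight deg
          rw [← Finset.sum_add_distrib]
          refine Finset.sum_congr rfl fun u _ => ?_
          rw [Finset.sum_mul, ← Finset.sum_add_distrib]
          exact Finset.sum_congr rfl fun v _ => by ring
        rw [e1, Finset.sum_comm, ← Finset.sum_add_distrib]
        refine Finset.sum_congr rfl fun u _ => ?_
        have e2 : ∑ x ∈ Finset.range n, ind (F x u) * u = deg n F u * u := by
          unfold deg
          rw [Finset.sum_mul]
          exact Finset.sum_congr rfl fun x _ => by rw [ind_congr ⟨hF x u, hF u x⟩]
        rw [e2]; ring
      rw [key E, key D hs, ← Finset.sum_add_distrib, ← Finset.sum_add_distrib]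
      · refine Finset.sum_congr rfl fun v _ => ?_
        rw [← Nat.add_mul, ← Nat.add_mul, hd1]
      · rintro u v (⟨h, h1⟩ | h)
        · refine Or.inl ⟨hs _ _ h, ?_⟩; unfold SamePair at *; omega
        · right; unfold SamePair at *; omega
    have h2 : ∀ r, r < n → z ≠ r →
        ∑ v ∈ Finset.range n, ind (v = z ∨ v = r) * (v + v) = (z + z) + (r + r) := by
      intro r hr hzr
      have e : ∀ v, ind (v = z ∨ v = r) * (v + v) =
          (if v = z then z + z else 0) + (if v = r then r + r else 0) := by
        intro v
        by_cases h1 : v = z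
        · subst h1; rw [ind_true (Or.inl rfl), if_pos rfl, if_neg hzr]; omega
        by_cases h2 : v = r
        · subst h2; rw [ind_true (Or.inr rfl), if_pos rfl, if_neg h1]; omega
        rw [ind_false (by tauto), if_neg h1, if_neg h2]; omega
      simp only [e]
      rw [Finset.sum_add_distrib, Finset.sum_ite_eq', Finset.sum_ite_eq',
        if_pos (Finset.mem_range.2 hzn), if_pos (Finset.mem_range.2 hr)]
    rw [h2 p hpn hpz'.symm, h2 p' hpn' hzp'] at h1
    omega
  refine hopt E ⟨?_, ?_, ?_, fun c b b' h h' hne => ⟨hstar c b b' h h' hne, hpriv c b b' h h' hne⟩⟩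
    ⟨[(z, p), (z, p')], by simp, ?_⟩ ?_
  · rintro u v (⟨h, h1⟩ | h)
    · refine Or.inl ⟨hs _ _ h, ?_⟩; unfold SamePair at *; omega
    · right; unfold SamePair at *; omega
  · rintro u v (⟨h, -⟩ | ⟨rfl, rfl⟩ | ⟨rfl, rfl⟩)
    exacts [hD.sub _ _ h, hzp, hA.symm _ _ hzp]
  · intro u v h
    rw [hcov, hcov]
    exact hD.dom u v h
  · intro u v h1 h2
    have := fun x y => not_samePair (x := x) (y := y) h1 h2
    simp only [hE]
    rw [eq_false (this z p (by simp)), eq_false (this z p' (by simp))]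
    simp
  · unfold rank
    rw [hex, if_neg hexpos, if_neg hexpos]
    omega

end

end EdgeDom

namespace EdgeDom

/-! ### Moving between maximal matchings -/

/-- `D` is a set of pairwise disjoint edges. -/
def IsMatching (D : ℕ → ℕ → Prop) : Prop := ∀ c b b', D c b → D c b' → b = b'

section
variable {n : ℕ} {A M D : ℕ → ℕ → Prop}

/-- Repairs domination at one vertex f by matching it with a free neighbour s. If there is none, or
f is covered, D itself works; then s := f is a dummy value, which is harmless because the pair fs is
only permitted in E, not required. -/
theorem exists_extend_matching (hA : IsGraph n A) (hs : ∀ u v, D u v → D v u)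
    (hsub : ∀ u v, D u v → A u v) (hm : IsMatching D) (f : ℕ) :
    ∃ (E : ℕ → ℕ → Prop) (s : ℕ), (∀ u v, E u v → E v u) ∧ (∀ u v, E u v → A u v) ∧
      IsMatching E ∧ (∀ u v, D u v → E u v) ∧ (∀ u v, E u v → D u v ∨ SamePair u v f s) ∧
      ∀ v, A f v → Cov E f ∨ Cov E v := by
  by_cases h : ∃ s, A f s ∧ ¬ Cov D f ∧ ¬ Cov D s
  · obtain ⟨s, hfs, hf, hcs⟩ := h
    have hne : f ≠ s := fun h => hA.irrefl s (h ▸ hfs)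
    refine ⟨fun u v => D u v ∨ SamePair u v f s, s, ?_, ?_, ?_, fun _ _ => Or.inl,
      fun _ _ => id, fun v _ => Or.inl ⟨s, Or.inr (Or.inl ⟨rfl, rfl⟩)⟩⟩
    · rintro u v (h | ⟨h, h'⟩ | ⟨h, h'⟩)
      exacts [Or.inl (hs _ _ h), Or.inr (Or.inr ⟨h', h⟩), Or.inr (Or.inl ⟨h', h⟩)]
    · rintro u v (h | ⟨rfl, rfl⟩ | ⟨rfl, rfl⟩)
      exacts [hsub _ _ h, hfs, hA.symm _ _ hfs]
    · rintro x b b' (h | h) (h' | h')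
      · exact hm x b b' h h'
      · rcases h' with ⟨rfl, rfl⟩ | ⟨rfl, rfl⟩
        exacts [absurd ⟨b, h⟩ hf, absurd ⟨b, h⟩ hcs]
      · rcases h with ⟨rfl, rfl⟩ | ⟨rfl, rfl⟩
        exacts [absurd ⟨b', h'⟩ hf, absurd ⟨b', h'⟩ hcs]
      · unfold SamePair at *; omega
  · refine ⟨D, f, hs, hsub, hm, fun _ _ => id, fun _ _ => Or.inl, fun v hv => ?_⟩
    by_contra hc
    rw [not_or] at hc
    exact h ⟨v, hv, hc.1, hc.2⟩

/-- For an unmatched x the value x' = x is a placeholder, so that the exchange below needs no case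
distinction. -/
theorem exists_partner (hm : IsMatching D) (x : ℕ) : ∃ x', ∀ t, D x t → t = x' := by
  by_cases h : ∃ t, D x t
  · obtain ⟨t, ht⟩ := h
    exact ⟨t, fun s hs => hm x s t hs ht⟩
  · exact ⟨x, fun t ht => absurd ⟨t, ht⟩ h⟩

theorem missing_lt {E : ℕ → ℕ → Prop} {x y : ℕ} (hx : x < n) (hy : y < n)
    (h : ∀ u v, M u v → ¬ E u v → ¬ D u v) (hM : M x y) (hD : ¬ D x y) (hE : E x y) :
    missing n M E < missing n M D := by
  have hle : ∀ u v, ind (M u v ∧ ¬ E u v) ≤ ind (M u v ∧ ¬ D u v) :=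
    fun u v => ind_mono fun huv => ⟨huv.1, h u v huv.1 huv.2⟩
  refine Finset.sum_lt_sum (fun u _ => Finset.sum_le_sum fun v _ => hle u v)
    ⟨x, Finset.mem_range.2 hx, Finset.sum_lt_sum (fun v _ => hle x v) ⟨y, Finset.mem_range.2 hy, ?_⟩⟩
  rw [ind_false (fun h => h.2 hE), ind_true ⟨hM, hD⟩]
  exact one_pos

/-- A maximal matching other than `M` is not locally optimal. -/
theorem eq_of_matching (hA : IsGraph n A) (hD : IsGood A D) (hm : IsMatching D)
    (hM : IsGood A M) (hMm : IsMatching M) (hopt : LocallyOptimal n A M D) : D = M := by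
  have hs := hD.symm
  by_cases hsub : ∀ u v, M u v → D u v
  · funext u v
    refine propext ⟨fun h => ?_, hsub u v⟩
    rcases hM.dom u v (hD.sub _ _ h) with ⟨t, ht⟩ | ⟨t, ht⟩
    · rwa [hm u v t h (hsub _ _ ht)]
    · have := hm v u t (hs _ _ h) (hsub _ _ ht)
      exact hM.symm _ _ (this ▸ ht)
  exfalso
  push Not at hsub
  obtain ⟨x, y, hxy, hnxy⟩ := hsub
  have hAxy := hM.sub _ _ hxy
  have hne : x ≠ y := fun h => hA.irrefl y (h ▸ hAxy)
  obtain ⟨x', hx'⟩ := exists_partner hm x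
  obtain ⟨y', hy'⟩ := exists_partner hm y
  -- Insert the edge xy of M and delete the edges of D at x and y. Only the old partners x' and y'
  -- can lose coverage, so one repair at each of them restores domination. With the two repairs at
  -- most five edges change.
  set D1 : ℕ → ℕ → Prop := fun u v =>
    (D u v ∧ u ≠ x ∧ u ≠ y ∧ v ≠ x ∧ v ≠ y) ∨ SamePair u v x y with hD1
  obtain ⟨D2, s, hs2, hsub2, hm2, h12, h21, hx2⟩ := exists_extend_matching (D := D1) hA
    (by
      rintro u v (⟨h, h'⟩ | ⟨h, h'⟩ | ⟨h, h'⟩)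
      exacts [Or.inl ⟨hs _ _ h, by tauto⟩, Or.inr (Or.inr ⟨h', h⟩), Or.inr (Or.inl ⟨h', h⟩)])
    (by
      rintro u v (⟨h, h'⟩ | ⟨rfl, rfl⟩ | ⟨rfl, rfl⟩)
      exacts [hD.sub _ _ h, hAxy, hA.symm _ _ hAxy])
    (by
      rintro u b b' (⟨h, h1⟩ | h1) (⟨h', h2⟩ | h2)
      · exact hm u b b' h h'
      all_goals unfold SamePair at *; omega) x'
  obtain ⟨E, s', hsE, hsubE, hmE, h2E, hE2, hyE⟩ := exists_extend_matching hA hs2 hsub2 hm2 y'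
  have hcov2 : ∀ v, Cov D2 v → Cov E v := fun v ⟨u, hu⟩ => ⟨u, h2E _ _ hu⟩
  have hcov1 : ∀ v, Cov D v → Cov E v ∨ v = x' ∨ v = y' := by
    rintro v ⟨u, hu⟩
    by_cases hux : u = x
    · subst hux; exact Or.inr (Or.inl (hx' v (hs _ _ hu)))
    by_cases huy : u = y
    · subst huy; exact Or.inr (Or.inr (hy' v (hs _ _ hu)))
    by_cases hvx : v = x
    · exact Or.inl ⟨y, h2E _ _ (h12 _ _ (Or.inr (Or.inl ⟨hvx, rfl⟩)))⟩
    by_cases hvy : v = y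
    · exact Or.inl ⟨x, h2E _ _ (h12 _ _ (Or.inr (Or.inr ⟨hvy, rfl⟩)))⟩
    exact Or.inl ⟨u, h2E _ _ (h12 _ _ (Or.inl ⟨hu, hvx, hvy, hux, huy⟩))⟩
  have hdomx : ∀ v, A x' v → Cov E x' ∨ Cov E v := fun v hv => (hx2 v hv).imp (hcov2 _) (hcov2 _)
  have hdom : ∀ u v, Cov D u → A u v → Cov E u ∨ Cov E v := by
    intro u v hu huv
    rcases hcov1 u hu with h | rfl | rfl
    exacts [Or.inl h, hdomx v huv, hyE v huv]
  have hEgood : IsGood A E := by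
    refine ⟨hsE, hsubE, fun u v huv => ?_, fun c b b' h h' hne => absurd (hmE c b b' h h') hne⟩
    rcases hD.dom u v huv with h | h
    · exact hdom u v h huv
    · exact (hdom v u h (hA.symm _ _ huv)).symm
  refine hopt E hEgood ⟨[(x, x'), (y, y'), (x, y), (x', s), (y', s')], by simp, ?_⟩ ?_
  · intro u v h1 h2
    have hp := fun a b => not_samePair (x := a) (y := b) h1 h2
    have p1 := hp x x' (by simp)
    have p2 := hp y y' (by simp)
    have p3 := hp x y (by simp)
    have p4 := hp x' s (by simp)
    have p5 := hp y' s' (by simp)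
    constructor
    · intro h
      refine h2E _ _ (h12 _ _ (Or.inl ⟨h, ?_, ?_, ?_, ?_⟩)) <;> rintro rfl
      · exact p1 (Or.inl ⟨rfl, hx' _ h⟩)
      · exact p2 (Or.inl ⟨rfl, hy' _ h⟩)
      · exact p1 (Or.inr ⟨hx' _ (hs _ _ h), rfl⟩)
      · exact p2 (Or.inr ⟨hy' _ (hs _ _ h), rfl⟩)
    · intro h
      rcases (h21 _ _ ((hE2 _ _ h).resolve_right p5)).resolve_right p4 with h | h
      exacts [h.1, absurd h p3]
  · unfold rank
    rw [if_pos (excess_eq_zero_of_matching hmE), if_pos (excess_eq_zero_of_matching hm)]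
    refine missing_lt (hA.lt _ _ hAxy) (hA.lt' hAxy) ?_ hxy hnxy
      (h2E _ _ (h12 _ _ (Or.inr (Or.inl ⟨rfl, rfl⟩))))
    intro u v hMuv hE hDuv
    -- No edge of M is lost: the only edge of M meeting x or y is xy, which is not in D.
    have hcon : ∀ {a b}, M a b → ¬ E a b → D a b → a ≠ x ∧ a ≠ y := by
      intro a b h1 _ h3
      constructor
      · rintro rfl
        exact hnxy (hMm a b y h1 hxy ▸ h3)
      · rintro rfl
        have := hMm a b x h1 (hM.symm _ _ hxy)
        exact hnxy (hs _ _ (this ▸ h3))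
    have g1 := hcon hMuv hE hDuv
    have g2 := hcon (hM.symm _ _ hMuv) (fun h => hE (hsE _ _ h)) (hs _ _ hDuv)
    exact hE (h2E _ _ (h12 _ _ (Or.inl ⟨hDuv, g1.1, g1.2, g2.1, g2.2⟩)))

end

/-! ### Flips -/

/-- The vertex `w` is the only uncovered vertex that can be a neighbour of `l`. -/
def Tight (A D : ℕ → ℕ → Prop) (w l : ℕ) : Prop := ∀ x, A l x → ¬ Cov D x → x = w

/-- The leaves that become superfluous when the leaf `a` is matched with the uncovered vertex `w`;
of every star, one leaf is kept. -/
def Dropped (A D : ℕ → ℕ → Prop) (w a l : ℕ) : Prop :=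
  l ≠ a ∧ Tight A D w l ∧
    ∃ p, D l p ∧ ∃ l', D p l' ∧ l' ≠ a ∧ l' ≠ l ∧ (¬ Tight A D w l' ∨ l' < l)

/-- Match the leaf `a` of the star with centre `c` with the uncovered vertex `w`. -/
def flip (A D : ℕ → ℕ → Prop) (w a c u v : ℕ) : Prop :=
  (D u v ∧ ¬ SamePair u v a c ∧ ¬ Dropped A D w a u ∧ ¬ Dropped A D w a v) ∨ SamePair u v a w

/-- The vertices that have to be covered when `w` is no longer covered. -/
def Freed (A E : ℕ → ℕ → Prop) (w z : ℕ) : Prop := A w z ∧ ¬ Cov E z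

/-- `E` without the edge `{a, w}`. -/
def Del (E : ℕ → ℕ → Prop) (w a u v : ℕ) : Prop := E u v ∧ ¬ SamePair u v a w

/-- The freed vertex `z` may become a leaf at `p`. -/
def CanAttach (A E : ℕ → ℕ → Prop) (w a z p : ℕ) : Prop :=
  A z p ∧ ((∃ q, Del E w a p q ∧ ∃ q', Del E w a p q' ∧ q ≠ q') ∨
    ∃ q, Del E w a p q ∧ (∀ x, Del E w a q x → x = p) ∧
      (∃ x, A q x ∧ (x = w ∨ ¬ Cov E x ∧ ¬ Freed A E w x)) ∧
      ((∀ y, Freed A E w y → ¬ A q y) ∨ ∀ y, Freed A E w y → A q y ∨ A p y → y = z))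

/-- The freed vertex `z` becomes a leaf at the first possible centre `p`. -/
def Attach (A E : ℕ → ℕ → Prop) (w a z p : ℕ) : Prop :=
  Freed A E w z ∧ CanAttach A E w a z p ∧ ∀ p', CanAttach A E w a z p' → ¬ p' < p

/-- The inverse of `flip`. -/
def unflip (A E : ℕ → ℕ → Prop) (w a c u v : ℕ) : Prop :=
  Del E w a u v ∨ SamePair u v a c ∨ Attach A E w a u v ∨ Attach A E w a v u

section
variable {n : ℕ} {A M D : ℕ → ℕ → Prop} {w a c b₀ : ℕ}

/-- The second leaf l' makes l a leaf of a star with several leaves; goodness gives l an uncovered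
neighbour, and tightness identifies it as w. -/
theorem Dropped.leaf (hD : IsGood A D) {l p : ℕ} (h : Dropped A D w a l) (hp : D l p) :
    (∀ x, D l x → x = p) ∧ A l w ∧ ∃ l', D p l' ∧ l' ≠ l ∧ l' ≠ a ∧
      (¬ Tight A D w l' ∨ l' < l) := by
  obtain ⟨-, ht, p', hp', l', hl', h1, h2, h3⟩ := h
  obtain ⟨hl, x, hx, hx'⟩ := hD.leaf (hD.symm _ _ hp') hl' h2
  have : p = p' := hl p hp
  subst this
  exact ⟨hl, ht x hx hx' ▸ hx, l', hl', h2, h1, h3⟩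

/-- A leaf that is not tight is never dropped. If all leaves other than a are tight, the smallest of
them stays; the comparison `l' < l` in `Dropped` serves this purpose. -/
theorem exists_kept (hD : IsGood A D) {p x y : ℕ} (hx : D p x) (hy : D p y) (hxy : x ≠ y) :
    ∃ l, D p l ∧ l ≠ a ∧ ¬ Dropped A D w a l := by
  classical
  by_cases h : ∃ l, D p l ∧ l ≠ a ∧ ¬ Tight A D w l
  · obtain ⟨l, h1, h2, h3⟩ := h
    exact ⟨l, h1, h2, fun h => h3 h.2.1⟩
  push Not at h
  have hex : ∃ l, D p l ∧ l ≠ a := by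
    by_cases hxa : x = a
    · exact ⟨y, hy, fun h => hxy (hxa.trans h.symm)⟩
    · exact ⟨x, hx, hxa⟩
  obtain ⟨h1, h2⟩ := Nat.find_spec hex
  refine ⟨Nat.find hex, h1, h2, fun hd => ?_⟩
  obtain ⟨-, -, l', hl', -, hla, hl''⟩ := hd.leaf hD (hD.symm _ _ h1)
  rcases hl'' with hl'' | hl''
  · exact hl'' (h l' hl' hla)
  · exact Nat.find_min hex hl'' ⟨hl', hla⟩

theorem not_dropped_of_two (hD : IsGood A D) {p x y : ℕ} (hx : D p x) (hy : D p y) (hxy : x ≠ y) :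
    ¬ Dropped A D w a p := fun h => by
  obtain ⟨hl, -⟩ := h.leaf hD hx
  exact hxy (hl y hy).symm

/-- Each star with several leaves keeps a leaf other than a by `exists_kept`, so centres stay
covered. Only the dropped leaves lose coverage, and only w gains it. -/
theorem cov_flip (hD : IsGood A D) (hca : D c a) (hcb : D c b₀) (hb : b₀ ≠ a)
    (hw : ¬ Cov D w) (v : ℕ) :
    Cov (flip A D w a c) v ↔ v = w ∨ (Cov D v ∧ ¬ Dropped A D w a v) := by
  obtain ⟨ha, -⟩ := hD.leaf hca hcb hb
  have hs := hD.symm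
  constructor
  · rintro ⟨u, ⟨h, -, h1, -⟩ | ⟨h, h'⟩ | ⟨h, h'⟩⟩
    · exact Or.inr ⟨⟨u, h⟩, h1⟩
    · exact Or.inr ⟨h ▸ ⟨c, hs _ _ hca⟩, fun h1 => h1.1 h⟩
    · exact Or.inl h
  · rintro (rfl | ⟨⟨u, hu⟩, hd⟩)
    · exact ⟨a, Or.inr (Or.inr ⟨rfl, rfl⟩)⟩
    by_cases hva : v = a
    · exact ⟨w, Or.inr (Or.inl ⟨hva, rfl⟩)⟩
    by_cases htwo : ∃ u', D v u' ∧ u ≠ u'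
    · obtain ⟨u', hu', hne⟩ := htwo
      obtain ⟨l, h1, h2, h3⟩ := exists_kept (w := w) (a := a) hD hu hu' hne
      exact ⟨l, Or.inl ⟨h1, by unfold SamePair; omega, hd, h3⟩⟩
    · push Not at htwo
      refine ⟨u, Or.inl ⟨hu, ?_, hd, ?_⟩⟩
      · rintro (⟨h, -⟩ | ⟨h, h'⟩)
        · exact hva h
        · subst h
          exact hb ((htwo b₀ hcb).symm.trans h')
      · intro hdu
        obtain ⟨-, -, l', hl', hne, -⟩ := hdu.leaf hD (hs _ _ hu)
        exact hne (htwo l' hl').symm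

/-- Domination could only fail at an edge between two dropped leaves, because the sole formerly
uncovered neighbour of a dropped leaf is w. By `adj_leaves` such leaves would be the only two of one
star, each dropped because the other is smaller. Two surviving leaves of one star cannot be tight,
so each still has an uncovered neighbour besides w. -/
theorem isGood_flip (hA : IsGraph n A) (hD : IsGood A D) (hopt : LocallyOptimal n A M D)
    (hca : D c a) (hcb : D c b₀) (hb : b₀ ≠ a) (haw : A a w) (hw : ¬ Cov D w) :
    IsGood A (flip A D w a c) := by
  obtain ⟨ha, -⟩ := hD.leaf hca hcb hb
  have hs := hD.symm
  have hcov := cov_flip hD hca hcb hb hw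
  have hd1 : ∀ u v, A u v → Cov D u → Cov (flip A D w a c) u ∨ Cov (flip A D w a c) v := by
    intro u v huv hu
    by_cases hdu : Dropped A D w a u
    · by_cases hv : Cov D v
      · refine Or.inr ((hcov v).2 (Or.inr ⟨hv, fun hdv => ?_⟩))
        obtain ⟨p, hp⟩ := hu
        obtain ⟨q, hq⟩ := hv
        obtain ⟨-, -, x, hx, hxu, hxa, hx'⟩ := hdu.leaf hD hp
        obtain ⟨-, -, y, hy, hyv, hya, hy'⟩ := hdv.leaf hD hq
        obtain ⟨rfl, hpx⟩ := adj_leaves hA hD hopt (hs _ _ hp) hx hxu (hs _ _ hq) hy hyv huv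
        have e1 : x = v := (hpx x hx).resolve_left hxu
        have e2 : y = u := (hpx y hy).resolve_right hyv
        subst e1 e2
        have := hx'.resolve_left (not_not.2 hdv.2.1)
        have := hy'.resolve_left (not_not.2 hdu.2.1)
        omega
      · exact Or.inr ((hcov v).2 (Or.inl (hdu.2.1 v huv hv)))
    · exact Or.inl ((hcov u).2 (Or.inr ⟨hu, hdu⟩))
  refine ⟨?_, ?_, ?_, ?_⟩
  · rintro u v (⟨h, h1, h2, h3⟩ | h)
    · exact Or.inl ⟨hs _ _ h, by unfold SamePair at *; omega, h3, h2⟩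
    · right; unfold SamePair at *; omega
  · rintro u v (⟨h, -⟩ | ⟨rfl, rfl⟩ | ⟨rfl, rfl⟩)
    exacts [hD.sub _ _ h, haw, hA.symm _ _ haw]
  · intro u v huv
    rcases hD.dom u v huv with h | h
    · exact hd1 u v huv h
    · exact (hd1 v u (hA.symm _ _ huv) h).symm
  · have haw' : a ≠ w := fun h => hA.irrefl w (h ▸ haw)
    have hEa : ∀ x, flip A D w a c a x → x = w := by
      rintro x (⟨h, h1, -⟩ | ⟨h, h'⟩ | ⟨h, h'⟩)
      · exact absurd (Or.inl ⟨rfl, ha x h⟩) h1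
      all_goals omega
    have hEw : ∀ x, flip A D w a c w x → x = a := by
      rintro x (⟨h, h1, -⟩ | ⟨h, h'⟩ | ⟨h, h'⟩)
      · exact absurd ⟨x, h⟩ hw
      all_goals omega
    have hother : ∀ v u, v ≠ a → v ≠ w → flip A D w a c v u →
        D v u ∧ u ≠ a ∧ u ≠ w ∧ ¬ Dropped A D w a u := by
      rintro v u h1 h2 (⟨h, h3, -, h4⟩ | ⟨h, h'⟩ | ⟨h, h'⟩)
      · refine ⟨h, ?_, ?_, h4⟩ <;> rintro rfl
        · exact h3 (Or.inr ⟨ha v (hs _ _ h), rfl⟩)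
        · exact hw ⟨v, hs _ _ h⟩
      all_goals omega
    intro x y y' hy hy' hne
    by_cases h1 : x = a
    · subst h1; exact absurd ((hEa _ hy).trans (hEa _ hy').symm) hne
    by_cases h2 : x = w
    · subst h2; exact absurd ((hEw _ hy).trans (hEw _ hy').symm) hne
    obtain ⟨hy, hya, hyw, hyd⟩ := hother x y h1 h2 hy
    obtain ⟨hy', hya', hyw', hyd'⟩ := hother x y' h1 h2 hy'
    obtain ⟨hl, -⟩ := hD.star x y y' hy hy' hne
    refine ⟨fun t ht => hl t (hother y t hya hyw ht).1, ?_⟩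
    have hnt : ¬ Tight A D w y := by
      intro ht
      have g1 : Tight A D w y' ∧ ¬ y' < y := by
        by_contra hcon
        exact hyd ⟨hya, ht, x, hs _ _ hy, y', hy', hya', hne.symm, by tauto⟩
      refine hyd' ⟨hya', g1.1, x, hs _ _ hy', y, hy, hya, hne, Or.inr ?_⟩
      have := g1.2
      omega
    unfold Tight at hnt
    push Not at hnt
    obtain ⟨t, h3, h4, h5⟩ := hnt
    refine ⟨t, h3, fun hc => ?_⟩
    rcases (hcov t).1 hc with h | h
    exacts [h5 h, h4 h.1]

theorem rank_flip_lt (hA : IsGraph n A) (hD : IsGood A D)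
    (hca : D c a) (hcb : D c b₀) (hb : b₀ ≠ a) (haw : A a w) (hw : ¬ Cov D w) :
    rank n M (flip A D w a c) < rank n M D := by
  obtain ⟨ha, -⟩ := hD.leaf hca hcb hb
  have hac : c ≠ a := fun h => hA.irrefl a (hD.sub _ _ (h ▸ hca))
  have hcw : c ≠ w := fun h => hw (h ▸ ⟨a, hca⟩)
  have haw' : a ≠ w := fun h => hA.irrefl w (h ▸ haw)
  refine rank_lt_of_excess_lt (excess_lt (c := c) (hA.lt _ _ (hD.sub _ _ hca)) ?_ ?_ ?_)
  · intro v
    by_cases h1 : v = a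
    · right
      have : ∀ x, flip A D w a c v x → x = w := by
        rintro x (⟨h, h1', -⟩ | ⟨h, h'⟩ | ⟨h, h'⟩)
        · exact absurd (Or.inl ⟨h1, ha x (h1 ▸ h)⟩) h1'
        all_goals omega
      exact fun u u' h h' => (this u h).trans (this u' h').symm
    by_cases h2 : v = w
    · right
      have : ∀ x, flip A D w a c v x → x = a := by
        rintro x (⟨h, -⟩ | ⟨h, h'⟩ | ⟨h, h'⟩)
        · exact absurd (h2 ▸ ⟨x, h⟩) hw
        all_goals omega
      exact fun u u' h h' => (this u h).trans (this u' h').symm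
    · left
      rintro u (⟨h, -⟩ | h)
      · exact h
      · unfold SamePair at h; omega
  · refine deg_lt (u := a) ?_ (hA.lt _ _ haw) hca ?_
    · rintro u (⟨h, -⟩ | h)
      · exact h
      · unfold SamePair at h; omega
    · rintro (⟨h, h1, -⟩ | h)
      · exact h1 (Or.inr ⟨rfl, rfl⟩)
      · unfold SamePair at h; omega
  · exact two_le_deg (hA.lt _ _ haw) (hA.lt' (hD.sub _ _ hcb)) hca hcb hb.symm

theorem del_flip (hD : IsGood A D) (hw : ¬ Cov D w) (u v : ℕ) :
    Del (flip A D w a c) w a u v ↔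
      D u v ∧ ¬ SamePair u v a c ∧ ¬ Dropped A D w a u ∧ ¬ Dropped A D w a v := by
  unfold Del flip
  constructor
  · rintro ⟨h | h, h'⟩
    exacts [h, absurd h h']
  · refine fun h => ⟨Or.inl h, ?_⟩
    rintro (⟨rfl, rfl⟩ | ⟨rfl, rfl⟩)
    exacts [hw ⟨u, hD.symm _ _ h.1⟩, hw ⟨v, h.1⟩]

/-- The dropped leaves can be read off from the new set and w alone. A neighbour of w was covered in
D because w was not, so it can be uncovered now only if it was dropped. -/
theorem freed_flip (hA : IsGraph n A) (hD : IsGood A D) (hca : D c a) (hcb : D c b₀) (hb : b₀ ≠ a)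
    (hw : ¬ Cov D w) (z : ℕ) : Freed A (flip A D w a c) w z ↔ Dropped A D w a z := by
  have hcov := cov_flip hD hca hcb hb hw
  constructor
  · rintro ⟨h1, h2⟩
    rw [hcov] at h2
    by_contra h3
    rcases hD.dom w z h1 with h | h
    · exact hw h
    · exact h2 (Or.inr ⟨h, h3⟩)
  · intro h
    obtain ⟨p, hp, -⟩ := h.2.2
    refine ⟨hA.symm _ _ (h.leaf hD hp).2.1, fun hc => ?_⟩
    rcases (hcov z).1 hc with rfl | h'
    exacts [hw ⟨p, hp⟩, h'.2 h]

/-- The old centre p keeps a leaf q. If it keeps two, the first alternative of `CanAttach` holds.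
Otherwise q still has a private neighbour that is w or neither covered nor freed. A freed neighbour
of q must by `adj_leaves` be z, with q and z the only leaves at p, and then `not_adj_centre` keeps
every other freed vertex away from p. The last clause of `CanAttach` records this dichotomy. -/
theorem canAttach_flip (hA : IsGraph n A) (hD : IsGood A D) (hopt : LocallyOptimal n A M D)
    (hca : D c a) (hcb : D c b₀) (hb : b₀ ≠ a) (hw : ¬ Cov D w) {z p : ℕ}
    (hz : Dropped A D w a z) (hzp : D z p) : CanAttach A (flip A D w a c) w a z p := by
  have hs := hD.symm
  have hcov := cov_flip hD hca hcb hb hw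
  have hfreed := freed_flip hA hD hca hcb hb hw
  obtain ⟨ha, -⟩ := hD.leaf hca hcb hb
  obtain ⟨hz1, -, l', hl', hlz, -⟩ := hz.leaf hD hzp
  obtain ⟨q, hq, hqa, hqd⟩ := exists_kept (w := w) (a := a) hD (hs _ _ hzp) hl' hlz.symm
  have hqz : q ≠ z := fun h => hqd (h ▸ hz)
  have hpa : p ≠ a := by
    rintro rfl
    exact hlz ((ha l' hl').trans (ha z (hs _ _ hzp)).symm)
  have hpd : ¬ Dropped A D w a p := not_dropped_of_two hD hl' (hs _ _ hzp) hlz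
  have hHq : Del (flip A D w a c) w a p q :=
    (del_flip hD hw p q).2 ⟨hq, by unfold SamePair; omega, hpd, hqd⟩
  refine ⟨hD.sub _ _ hzp, ?_⟩
  by_cases htwo : ∃ q', Del (flip A D w a c) w a p q' ∧ q ≠ q'
  · exact Or.inl ⟨q, hHq, htwo⟩
  right
  obtain ⟨hql, t, ht, ht'⟩ := hD.leaf hq (hs _ _ hzp) hqz.symm
  refine ⟨q, hHq, fun x hx => hql x ((del_flip hD hw _ _).1 hx).1, ⟨t, ht, ?_⟩, ?_⟩
  · by_cases htw : t = w
    · exact Or.inl htw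
    · right
      rw [hcov, hfreed]
      refine ⟨fun h => ?_, fun h => ?_⟩
      · rcases h with h | h
        exacts [htw h, ht' h.1]
      · obtain ⟨s, hs', -⟩ := h.2.2
        exact ht' ⟨s, hs'⟩
  simp only [hfreed]
  by_cases hconf : ∃ y, Dropped A D w a y ∧ A q y
  swap
  · push Not at hconf
    exact Or.inl hconf
  right
  have hadj : ∀ y, Dropped A D w a y → A q y → y = z ∧ ∀ x, D p x → x = q ∨ x = y := by
    intro y hy hqy
    obtain ⟨c', hc', -⟩ := hy.2.2
    obtain ⟨-, -, m, hm, hmy, -⟩ := hy.leaf hD hc'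
    obtain ⟨-, h⟩ := adj_leaves hA hD hopt hq (hs _ _ hzp) hqz.symm (hs _ _ hc') hm hmy hqy
    exact ⟨((h z (hs _ _ hzp)).resolve_left hqz.symm).symm, h⟩
  obtain ⟨y₀, hy₀, hqy₀⟩ := hconf
  obtain ⟨rfl, hp⟩ := hadj y₀ hy₀ hqy₀
  rintro y hy (hqy | hpy)
  · exact (hadj y hy hqy).1
  · by_contra hyz
    obtain ⟨c', hc', -⟩ := hy.2.2
    obtain ⟨-, -, m, hm, hmy, -⟩ := hy.leaf hD hc'
    exact not_adj_centre hA hD hopt hq (hs _ _ hzp) hqy₀ hp (hs _ _ hc') hm hmy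
      (fun h => hqd (h ▸ hy)) hyz hpy

/-- A smaller p' would contradict `not_reattach`, once the star seen at p' after the flip is known
to have been there in D. An edge at q hidden by the flip is either ac, excluded by `adj_leaves` or
because a has a single neighbour, or it leads to a dropped leaf, which the last clause of
`CanAttach` forces to be z; and z is tolerated by `not_reattach`. -/
theorem le_of_canAttach_flip (hA : IsGraph n A) (hD : IsGood A D) (hopt : LocallyOptimal n A M D)
    (hca : D c a) (hcb : D c b₀) (hb : b₀ ≠ a) (hw : ¬ Cov D w) {z p p' : ℕ}
    (hz : Dropped A D w a z) (hzp : D z p) (h : CanAttach A (flip A D w a c) w a z p') :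
    ¬ p' < p := by
  intro hlt
  have hs := hD.symm
  have hcov := cov_flip hD hca hcb hb hw
  have hfreed := freed_flip hA hD hca hcb hb hw
  obtain ⟨ha, -⟩ := hD.leaf hca hcb hb
  obtain ⟨hz1, -, l', hl', hlz, -⟩ := hz.leaf hD hzp
  obtain ⟨hAz, h⟩ := h
  have hbig : ∀ q q', D p' q → D p' q' → q ≠ q' → False := by
    intro q q' hq hq' hne
    refine not_reattach hA hD hopt (hs _ _ hzp) hl' hlz hAz ⟨q, hq⟩ (fun y hy => ?_) hlt
    have : ∃ y', D p' y' ∧ y ≠ y' := by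
      by_cases hyq : y = q
      · exact ⟨q', hq', fun h => hne (hyq.symm.trans h)⟩
      · exact ⟨q, hq, hyq⟩
    obtain ⟨y', hy', hyy⟩ := this
    obtain ⟨h1, h2⟩ := hD.star p' y y' hy hy' hyy
    exact ⟨fun x hx => Or.inl (h1 x hx), h2⟩
  rcases h with ⟨q, hq, q', hq', hne⟩ | ⟨q, hq, hqH, ⟨t, ht, ht'⟩, hconf⟩
  · exact hbig q q' ((del_flip hD hw _ _).1 hq).1 ((del_flip hD hw _ _).1 hq').1 hne
  obtain ⟨hpq, hpq1, hpd, hqd⟩ := (del_flip hD hw _ _).1 hq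
  have honly : ∀ y, D p' y → y = q := fun y hy => by
    by_contra hne
    exact hbig y q hy hpq hne
  refine not_reattach hA hD hopt (hs _ _ hzp) hl' hlz hAz ⟨q, hpq⟩ (fun y hy => ?_) hlt
  obtain rfl := honly y hy
  refine ⟨fun x hx => ?_, t, ht, ?_⟩
  · by_contra hne
    rw [not_or] at hne
    have hyd : ¬ Dropped A D w a y := not_dropped_of_two hD hx (hs _ _ hpq) hne.1
    by_cases hsame : SamePair y x a c
    · rcases hsame with ⟨rfl, rfl⟩ | ⟨rfl, rfl⟩
      · exact hne.1 ((ha x hx).trans (ha p' (hs _ _ hpq)).symm)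
      · obtain ⟨-, h⟩ := adj_leaves hA hD hopt (hs _ _ hpq) hx hne.1 (hs _ _ hzp) hl' hlz
          (hA.symm _ _ hAz)
        rcases h x hx with h | h
        exacts [hne.1 h, hne.2 h]
    by_cases hxd : Dropped A D w a x
    · rcases hconf with h | h
      · exact h x ((hfreed x).2 hxd) (hD.sub _ _ hx)
      · exact hne.2 (h x ((hfreed x).2 hxd) (Or.inl (hD.sub _ _ hx)))
    · exact hne.1 (hqH x ((del_flip hD hw _ _).2 ⟨hx, hsame, hyd, hxd⟩))
  · rcases ht' with rfl | ⟨h1, h2⟩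
    · exact hw
    · rw [hfreed] at h2
      rw [hcov] at h1
      exact fun h => h1 (Or.inr ⟨h, h2⟩)

/-- The old centre of a dropped leaf is admissible and no smaller one is, so `Attach` restores
exactly the lost edges. -/
theorem unflip_flip (hA : IsGraph n A) (hD : IsGood A D) (hopt : LocallyOptimal n A M D)
    (hca : D c a) (hcb : D c b₀) (hb : b₀ ≠ a) (hw : ¬ Cov D w) (u v : ℕ) :
    unflip A (flip A D w a c) w a c u v ↔ D u v := by
  have hs := hD.symm
  have hatt : ∀ z p, Attach A (flip A D w a c) w a z p ↔ Dropped A D w a z ∧ D z p := by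
    intro z p
    unfold Attach
    rw [freed_flip hA hD hca hcb hb hw]
    refine and_congr_right fun hz => ?_
    obtain ⟨p₀, hp₀, -⟩ := hz.2.2
    have h1 := canAttach_flip hA hD hopt hca hcb hb hw hz hp₀
    constructor
    · rintro ⟨h2, h3⟩
      have h4 := le_of_canAttach_flip hA hD hopt hca hcb hb hw hz hp₀ h2
      have h5 := h3 p₀ h1
      have : p = p₀ := by omega
      exact this ▸ hp₀
    · intro hp
      exact ⟨canAttach_flip hA hD hopt hca hcb hb hw hz hp, fun p' h =>
        le_of_canAttach_flip hA hD hopt hca hcb hb hw hz hp h⟩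
  unfold unflip
  rw [hatt, hatt, del_flip hD hw]
  constructor
  · rintro (h | (⟨rfl, rfl⟩ | ⟨rfl, rfl⟩) | h | h)
    exacts [h.1, hs _ _ hca, hca, h.2, hs _ _ h.2]
  · intro h
    have := hs _ _ h
    tauto

end

/-! ### Numbered moves -/

/-- The digit of `j` with number `k` in base `n`. -/
def digit (n j k : ℕ) : ℕ := j / n ^ k % n

/-- The edges changed by the local move with number `j`. -/
def Toggled (n j u v : ℕ) : Prop :=
  SamePair u v (digit n j 0) (digit n j 1) ∨ SamePair u v (digit n j 2) (digit n j 3) ∨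
  SamePair u v (digit n j 4) (digit n j 5) ∨ SamePair u v (digit n j 6) (digit n j 7) ∨
  SamePair u v (digit n j 8) (digit n j 9)

/-- The result of move number `j`, a flip if the first two digits agree and a local move
otherwise. -/
def fwd (n : ℕ) (A D : ℕ → ℕ → Prop) (j u v : ℕ) : Prop :=
  u < n ∧ v < n ∧
    ((digit n j 0 = digit n j 1 ∧ flip A D (digit n j 2) (digit n j 3) (digit n j 4) u v) ∨
      (¬ digit n j 0 = digit n j 1 ∧ ¬ (D u v ↔ Toggled n j u v)))

/-- The inverse of move number `j`. -/
def bwd (n : ℕ) (A E : ℕ → ℕ → Prop) (j u v : ℕ) : Prop :=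
  u < n ∧ v < n ∧
    ((digit n j 0 = digit n j 1 ∧ unflip A E (digit n j 2) (digit n j 3) (digit n j 4) u v) ∨
      (¬ digit n j 0 = digit n j 1 ∧ ¬ (E u v ↔ Toggled n j u v)))

/-- The move number `j` leads from `D` to a node of smaller rank and can be undone. -/
def GoodMove (n : ℕ) (A M D : ℕ → ℕ → Prop) (j : ℕ) : Prop :=
  IsGood A (fwd n A D j) ∧ rank n M (fwd n A D j) < rank n M D ∧
    ∀ u v, bwd n A (fwd n A D j) j u v ↔ D u v

theorem exists_digits {n : ℕ} (m : ℕ) (d : ℕ → ℕ) (hd : ∀ k, d k < n) :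
    ∃ j < n ^ m, ∀ k < m, digit n j k = d k := by
  induction m generalizing d with
  | zero => exact ⟨0, by simp, by simp⟩
  | succ m ih =>
    obtain ⟨j, hj, h⟩ := ih (fun k => d (k + 1)) (fun k => hd _)
    have hn : 0 < n := (Nat.zero_le _).trans_lt (hd 0)
    refine ⟨d 0 + n * j, ?_, ?_⟩
    · calc d 0 + n * j < n + n * j := by have := hd 0; omega
        _ = n * (j + 1) := by ring
        _ ≤ n * n ^ m := Nat.mul_le_mul le_rfl hj
        _ = n ^ (m + 1) := by ring
    · rintro (_ | k) hk
      · simp [digit, Nat.mod_eq_of_lt (hd 0)]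
      · rw [← h k (by omega)]
        unfold digit
        rw [pow_succ', ← Nat.div_div_eq_div_mul, Nat.add_mul_div_left _ _ hn,
          Nat.div_eq_of_lt (hd 0), zero_add]

section
variable {n : ℕ} {A M D : ℕ → ℕ → Prop}

/-- Toggling a fixed set of pairs is an involution, so a local move is undone by its own number. -/
theorem exists_goodMove_of_local (hA : IsGraph n A) (hD : IsGood A D) {E : ℕ → ℕ → Prop}
    (hE : IsGood A E) (hmove : LocalMove D E) (hrank : rank n M E < rank n M D) :
    ∃ j < n ^ 10, GoodMove n A M D j := by
  classical
  obtain ⟨L, hL, hLE⟩ := hmove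
  -- The list may contain pairs that do not change, and these must not be toggled. The remaining
  -- pairs are edges of the graph, and there is at least one because the rank changes.
  set L' := L.filter (fun p => ¬ (D p.1 p.2 ↔ E p.1 p.2)) with hL'
  have hlen : L'.length ≤ 5 := (List.length_filter_le _ _).trans hL
  have hmem : ∀ u v, ¬ (D u v ↔ E u v) ↔ ∃ p ∈ L', SamePair u v p.1 p.2 := by
    intro u v
    have hsym : (D u v ↔ E u v) ↔ (D v u ↔ E v u) := by
      rw [iff_iff_eq.1 ⟨hD.symm u v, hD.symm v u⟩, iff_iff_eq.1 ⟨hE.symm u v, hE.symm v u⟩]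
    constructor
    · intro h
      by_cases h1 : (u, v) ∈ L
      · exact ⟨(u, v), List.mem_filter.2 ⟨h1, by simpa using h⟩, Or.inl ⟨rfl, rfl⟩⟩
      by_cases h2 : (v, u) ∈ L
      · rw [hsym] at h
        exact ⟨(v, u), List.mem_filter.2 ⟨h2, by simpa using h⟩, Or.inr ⟨rfl, rfl⟩⟩
      exact absurd (hLE u v h1 h2) h
    · rintro ⟨⟨x, y⟩, hp, h⟩
      have h1 := (List.mem_filter.1 hp).2
      rcases h with ⟨rfl, rfl⟩ | ⟨rfl, rfl⟩
      · simpa using h1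
      · rw [hsym]; simpa using h1
  have hne : L' ≠ [] := by
    intro h0
    have : E = D := by
      funext u v
      by_contra hcon
      obtain ⟨p, hp, -⟩ := (hmem u v).1 (fun h => hcon (propext h.symm))
      rw [h0] at hp
      exact absurd hp (by simp)
    rw [this] at hrank
    exact lt_irrefl _ hrank
  have hA' : ∀ p ∈ L', A p.1 p.2 := by
    intro p hp
    have h1 := (List.mem_filter.1 hp).2
    by_cases h : D p.1 p.2
    · exact hD.sub _ _ h
    · refine hE.sub _ _ ?_
      by_contra h2
      simp [h, h2] at h1
  obtain ⟨p₀, R, hR⟩ := List.exists_cons_of_ne_nil hne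
  -- A list shorter than five is padded with `p₀`; repetitions do no harm, as `Toggled` is a
  -- disjunction.
  set e : ℕ → ℕ × ℕ := fun k => L'.getD k p₀ with he
  have hp₀ : p₀ ∈ L' := by rw [hR]; simp
  have hemem : ∀ k, e k ∈ L' := by
    intro k
    by_cases hk : k < L'.length
    · rw [he]; simp only [List.getD_eq_getElem _ _ hk]; exact List.getElem_mem hk
    · rw [he]; simp only [List.getD_eq_default _ _ (not_lt.1 hk)]; exact hp₀
  have hsurj : ∀ p ∈ L', ∃ k < 5, e k = p := by
    intro p hp
    obtain ⟨k, hk, hkp⟩ := List.getElem_of_mem hp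
    refine ⟨k, by omega, ?_⟩
    rw [he]; simp only [List.getD_eq_getElem _ _ hk]; exact hkp
  obtain ⟨j, hj, hdig⟩ := exists_digits (n := n) 10
    (fun k => if k % 2 = 0 then (e (k / 2)).1 else (e (k / 2)).2) (by
      intro k
      split
      · exact hA.lt _ _ (hA' _ (hemem _))
      · exact hA.lt' (hA' _ (hemem _)))
  have htog : ∀ u v, Toggled n j u v ↔ ¬ (D u v ↔ E u v) := by
    intro u v
    rw [hmem]
    unfold Toggled
    rw [hdig 0, hdig 1, hdig 2, hdig 3, hdig 4, hdig 5, hdig 6, hdig 7, hdig 8, hdig 9] <;>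
      try omega
    simp only [Nat.reduceMod, Nat.reduceDiv, if_true, one_ne_zero, if_false]
    constructor
    · rintro (h | h | h | h | h)
      exacts [⟨_, hemem 0, h⟩, ⟨_, hemem 1, h⟩, ⟨_, hemem 2, h⟩, ⟨_, hemem 3, h⟩, ⟨_, hemem 4, h⟩]
    · rintro ⟨p, hp, h⟩
      obtain ⟨k, hk, rfl⟩ := hsurj p hp
      interval_cases k <;> tauto
  -- The first pair is an edge, hence has distinct endpoints, so the number is not read as a flip.
  have h01 : ¬ digit n j 0 = digit n j 1 := by
    rw [hdig 0 (by omega), hdig 1 (by omega)]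
    simp only [Nat.reduceMod, Nat.reduceDiv, if_true, one_ne_zero, if_false]
    intro h
    have := hA' _ (hemem 0)
    rw [h] at this
    exact hA.irrefl _ this
  have hfwd : fwd n A D j = E := by
    funext u v
    refine propext ⟨?_, fun h => ⟨hA.lt _ _ (hE.sub _ _ h), hA.lt' (hE.sub _ _ h), Or.inr ⟨h01, ?_⟩⟩⟩
    · rintro ⟨-, -, h | h⟩
      · exact absurd h.1 h01
      · rw [htog] at h; tauto
    · rw [htog]; tauto
  refine ⟨j, hj, ?_⟩
  unfold GoodMove
  rw [hfwd]
  refine ⟨hE, hrank, fun u v => ⟨?_, fun h =>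
    ⟨hA.lt _ _ (hD.sub _ _ h), hA.lt' (hD.sub _ _ h), Or.inr ⟨h01, ?_⟩⟩⟩⟩
  · rintro ⟨-, -, h | h⟩
    · exact absurd h.1 h01
    · rw [htog] at h; tauto
  · rw [htog]; tauto

/-- Every minimal edge dominating set other than the root has a good move. -/
theorem exists_goodMove (hA : IsGraph n A) (hM : IsGood A M) (hMm : IsMatching M)
    (hD : IsGood A D) (hne : D ≠ M) : ∃ j < n ^ 10, GoodMove n A M D j := by
  by_cases hopt : LocallyOptimal n A M D
  swap
  · unfold LocallyOptimal at hopt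
    push Not at hopt
    obtain ⟨E, hE, hmove, hrank⟩ := hopt
    exact exists_goodMove_of_local hA hD hE hmove hrank
  by_cases hm : IsMatching D
  · exact absurd (eq_of_matching hA hD hm hM hMm hopt) hne
  unfold IsMatching at hm
  push Not at hm
  obtain ⟨c, a, b, hca, hcb, hab⟩ := hm
  obtain ⟨-, w, haw, hw⟩ := hD.star c a b hca hcb hab
  -- Digits 0 and 1 are both c, which marks a flip; digits 2, 3 and 4 are w, a and c, and the others
  -- are not used.
  obtain ⟨j, hj, hdig⟩ := exists_digits (n := n) 10
    (fun k => if k = 2 then w else if k = 3 then a else c) (by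
      intro k
      split
      · exact hA.lt' haw
      · split
        · exact hA.lt _ _ haw
        · exact hA.lt _ _ (hD.sub _ _ hca))
  have d0 := hdig 0 (by omega)
  have d1 := hdig 1 (by omega)
  have d2 := hdig 2 (by omega)
  have d3 := hdig 3 (by omega)
  have d4 := hdig 4 (by omega)
  norm_num at d0 d1 d2 d3 d4
  have hE := isGood_flip hA hD hopt hca hcb hab.symm haw hw
  have hfwd : fwd n A D j = flip A D w a c := by
    funext u v
    unfold fwd
    rw [d0, d1, d2, d3, d4]
    refine propext ⟨?_, fun h => ⟨hA.lt _ _ (hE.sub _ _ h), hA.lt' (hE.sub _ _ h),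
      Or.inl ⟨rfl, h⟩⟩⟩
    rintro ⟨-, -, h | h⟩
    exacts [h.2, absurd rfl h.1]
  refine ⟨j, hj, ?_⟩
  unfold GoodMove
  rw [hfwd]
  refine ⟨hE, rank_flip_lt hA hD hca hcb hab.symm haw hw, fun u v => ?_⟩
  unfold bwd
  rw [d0, d1, d2, d3, d4, unflip_flip hA hD hopt hca hcb hab.symm hw]
  constructor
  · rintro ⟨-, -, h | h⟩
    exacts [h.2, absurd rfl h.1]
  · exact fun h => ⟨hA.lt _ _ (hD.sub _ _ h), hA.lt' (hD.sub _ _ h), Or.inl ⟨rfl, h⟩⟩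

/-- The root has no good move. -/
theorem not_goodMove_root (hMm : IsMatching M) (j : ℕ) : ¬ GoodMove n A M M j := by
  rintro ⟨-, h, -⟩
  have : rank n M M = 0 := by
    unfold rank
    rw [if_pos (excess_eq_zero_of_matching hMm)]
    exact Finset.sum_eq_zero fun u _ => Finset.sum_eq_zero fun v _ => ind_false fun h => h.2 h.1
  omega

end

end EdgeDom

namespace RamWhile

open EdgeDom

/-! ### Execution of commands -/

/-- In `t` time units, the command `c` turns the memory `s` into `s'` and writes `o`. -/
def Exec (c : Cmd) (s s' : Store) (o : List (Option ℕ)) (t : ℕ) : Prop :=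
  ∀ k tape, step^[t] ⟨c :: k, s, tape⟩ = ⟨k, s', tape ++ o⟩

/-- Started on `s`, the command `c` takes at most `T` time units, writes `o`, and leaves a memory
that satisfies `Q`. -/
def Runs (c : Cmd) (s : Store) (o : List (Option ℕ)) (T : ℕ) (Q : Store → Prop) : Prop :=
  ∃ s' t, t ≤ T ∧ Exec c s s' o t ∧ Q s'

theorem Runs.mono {c : Cmd} {s : Store} {o : List (Option ℕ)} {T T' : ℕ} {Q Q' : Store → Prop}
    (h : Runs c s o T Q) (hT : T ≤ T') (hQ : ∀ s', Q s' → Q' s') : Runs c s o T' Q' := by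
  obtain ⟨s', t, ht, he, hq⟩ := h
  exact ⟨s', t, ht.trans hT, he, hQ s' hq⟩

theorem runs_skip {s : Store} {Q : Store → Prop} (hQ : Q s) : Runs .skip s [] 1 Q :=
  ⟨s, 1, le_rfl, fun k tape => by simp [step], hQ⟩

theorem runs_assign {s : Store} {a : ℕ} {i j e : Expr} {Q : Store → Prop}
    (hQ : Q (s.update (a, i.eval s, j.eval s) (e.eval s))) : Runs (.assign a i j e) s [] 1 Q :=
  ⟨_, 1, le_rfl, fun k tape => by simp [step], hQ⟩

theorem runs_write {s : Store} {e : Expr} {Q : Store → Prop} (hQ : Q s) :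
    Runs (.write e) s [some (e.eval s)] 1 Q :=
  ⟨s, 1, le_rfl, fun k tape => by simp [step], hQ⟩

theorem runs_emit {s : Store} {Q : Store → Prop} (hQ : Q s) : Runs .emit s [none] 1 Q :=
  ⟨s, 1, le_rfl, fun k tape => by simp [step], hQ⟩

theorem Runs.seq {c d : Cmd} {s : Store} {o₁ o₂ : List (Option ℕ)} {T₁ T₂ : ℕ}
    {Q₁ Q₂ : Store → Prop} (h₁ : Runs c s o₁ T₁ Q₁) (h₂ : ∀ s', Q₁ s' → Runs d s' o₂ T₂ Q₂) :
    Runs (.seq c d) s (o₁ ++ o₂) (T₁ + T₂ + 1) Q₂ := by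
  obtain ⟨s', t, ht, he, hq⟩ := h₁
  obtain ⟨s'', t', ht', he', hq'⟩ := h₂ s' hq
  refine ⟨s'', t' + t + 1, by omega, fun k tape => ?_, hq'⟩
  rw [Function.iterate_add_apply, Function.iterate_add_apply]
  have : step^[1] ⟨.seq c d :: k, s, tape⟩ = ⟨c :: d :: k, s, tape⟩ := by simp [step]
  rw [this, he, he', List.append_assoc]

/-- Sequential composition when only the second command writes. -/
theorem Runs.seq_nil {c d : Cmd} {s : Store} {o : List (Option ℕ)} {T₁ T₂ : ℕ}
    {Q₁ Q₂ : Store → Prop} (h₁ : Runs c s [] T₁ Q₁) (h₂ : ∀ s', Q₁ s' → Runs d s' o T₂ Q₂) :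
    Runs (.seq c d) s o (T₁ + T₂ + 1) Q₂ := by
  simpa using h₁.seq h₂

theorem runs_cond_true {c d : Cmd} {s : Store} {e : Expr} {o : List (Option ℕ)} {T : ℕ}
    {Q : Store → Prop} (he : e.eval s ≠ 0) (h : Runs c s o T Q) :
    Runs (.cond e c d) s o (T + 1) Q := by
  obtain ⟨s', t, ht, hx, hq⟩ := h
  refine ⟨s', t + 1, by omega, fun k tape => ?_, hq⟩
  rw [Function.iterate_add_apply, ← hx k tape]
  simp [step, he]

theorem runs_cond_false {c d : Cmd} {s : Store} {e : Expr} {o : List (Option ℕ)} {T : ℕ}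
    {Q : Store → Prop} (he : e.eval s = 0) (h : Runs d s o T Q) :
    Runs (.cond e c d) s o (T + 1) Q := by
  obtain ⟨s', t, ht, hx, hq⟩ := h
  refine ⟨s', t + 1, by omega, fun k tape => ?_, hq⟩
  rw [Function.iterate_add_apply, ← hx k tape]
  simp [step, he]

/-- A loop with an invariant that counts the rounds. -/
theorem runs_loop {e : Expr} {c : Cmd} {m T : ℕ} (I : ℕ → Store → Prop)
    (o : ℕ → List (Option ℕ)) (h : ∀ k < m, ∀ s, I k s → e.eval s ≠ 0 ∧ Runs c s (o k) T (I (k + 1)))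
    (hm : ∀ s, I m s → e.eval s = 0) {s : Store} (h₀ : I 0 s) :
    Runs (.loop e c) s ((List.range m).flatMap o) (m * (T + 1) + 1) (I m) := by
  have key : ∀ r k, k + r = m → ∀ s, I k s →
      Runs (.loop e c) s ((List.range' k r).flatMap o) (r * (T + 1) + 1) (I m) := by
    intro r
    induction r with
    | zero =>
      intro k hk s hs
      obtain rfl : k = m := by omega
      refine ⟨s, 1, by omega, fun k tape => ?_, hs⟩
      simp [step, hm s hs]
    | succ r ih =>
      intro k hk s hs
      obtain ⟨he, s', t, ht, hx, hq⟩ := h k (by omega) s hs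
      obtain ⟨s'', t', ht', hx', hq'⟩ := ih (k + 1) (by omega) s' hq
      refine ⟨s'', t' + t + 1, ?_, fun l tape => ?_, hq'⟩
      · rw [Nat.add_mul]; omega
      · rw [Function.iterate_add_apply, Function.iterate_add_apply]
        have : step^[1] ⟨.loop e c :: l, s, tape⟩ = ⟨c :: .loop e c :: l, s, tape⟩ := by
          simp [step, he]
        rw [this, hx, hx', List.append_assoc, List.range'_succ, List.flatMap_cons]
  rw [List.range_eq_range']
  exact key m 0 (by omega) s h₀

theorem flatMap_nil {α β : Type*} (l : List α) : l.flatMap (fun _ => ([] : List β)) = [] := by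
  simp

/-- A loop without output with an invariant that counts the rounds. -/
theorem runs_loop_nil {e : Expr} {c : Cmd} {m T : ℕ} (I : ℕ → Store → Prop)
    (h : ∀ k < m, ∀ s, I k s → e.eval s ≠ 0 ∧ Runs c s [] T (I (k + 1)))
    (hm : ∀ s, I m s → e.eval s = 0) {s : Store} (h₀ : I 0 s) :
    Runs (.loop e c) s [] (m * (T + 1) + 1) (I m) := by
  have := runs_loop I (fun _ => []) h hm h₀
  rwa [flatMap_nil] at this

/-! ### States and contexts -/

/-- The data the search works on: a graph, the current and the root edge set, and the number of
the current move. -/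
@[ext] structure St where
  n : ℕ
  adj : ℕ → ℕ → Prop
  cur : ℕ → ℕ → Prop
  root : ℕ → ℕ → Prop
  idx : ℕ
  adj_lt : ∀ u v, adj u v → u < n ∧ v < n
  cur_lt : ∀ u v, cur u v → u < n ∧ v < n
  root_lt : ∀ u v, root u v → u < n ∧ v < n

/-- The contents of the cells that represent a state. -/
noncomputable def St.cells (σ : St) (a i j : ℕ) : ℕ :=
  match a with
  | 0 => if i = 0 ∧ j = 0 then σ.n else 0
  | 1 => ind (σ.adj i j)
  | 2 => ind (σ.cur i j)
  | 3 => ind (σ.root i j)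
  | 4 => if i = 0 ∧ j = 0 then σ.idx else 0
  | _ => 0

/-- The arrays `0, …, 4` of `s` represent `σ`. -/
def Reads (s : Store) (σ : St) : Prop := ∀ a < 5, ∀ i j, s (a, i, j) = σ.cells a i j

/-- A type of states together with finitely many local variables. -/
class Ctx (Γ : Type) where
  depth : ℕ
  vars : Γ → ℕ → ℕ
  base : Γ → St

noncomputable instance : Ctx St := ⟨0, fun _ _ => 0, id⟩

/-- Variables are numbered from the outside in: a new variable gets the old depth as its number, so
earlier numbers remain valid. -/
instance {Γ : Type} [Ctx Γ] : Ctx (Γ × ℕ) :=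
  ⟨Ctx.depth Γ + 1, fun γ x => if x = Ctx.depth Γ then γ.2 else Ctx.vars γ.1 x,
    fun γ => Ctx.base γ.1⟩

/-- The memory `s` represents the context `γ`, the variable `x` being kept in register `loc x`, below
register `d`; all values are at most `B`. -/
structure Fits {Γ : Type} [Ctx Γ] (loc : ℕ → ℕ) (d B : ℕ) (γ : Γ) (s : Store) : Prop where
  loc_lt : ∀ x < Ctx.depth Γ, loc x < d
  reads : Reads s (Ctx.base γ)
  var : ∀ x < Ctx.depth Γ, s (10, loc x, 0) = Ctx.vars γ x
  var_le : ∀ x < Ctx.depth Γ, Ctx.vars γ x ≤ B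
  n_le : (Ctx.base γ).n ≤ B
  idx_le : (Ctx.base γ).idx ≤ B
  one_le : 1 ≤ B

/-- `s'` differs from `s` only in the registers `d, …, d + h - 1`. -/
def Frame (d h : ℕ) (s s' : Store) : Prop :=
  ∀ a i j, ¬ (a = 10 ∧ d ≤ i ∧ i < d + h ∧ j = 0) → s' (a, i, j) = s (a, i, j)

/-- `f` can be computed in polynomial time, with the result in register `d` and with registers from
`d` on as work space. -/
def Dfn {Γ : Type} [Ctx Γ] (f : Γ → ℕ) : Prop :=
  ∃ (c : (ℕ → ℕ) → ℕ → Cmd) (h : ℕ) (p : Polynomial ℕ), ∀ loc d B γ s, Fits loc d B γ s →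
    f γ ≤ p.eval B ∧
      Runs (c loc d) s [] (p.eval B) fun s' => s' (10, d, 0) = f γ ∧ Frame d h s s'

theorem eval_mono (p : Polynomial ℕ) {a b : ℕ} (h : a ≤ b) : p.eval a ≤ p.eval b := by
  rw [Polynomial.eval_eq_sum_range, Polynomial.eval_eq_sum_range]
  exact Finset.sum_le_sum fun i _ => Nat.mul_le_mul le_rfl (Nat.pow_le_pow_left h i)

/-- The expression that reads register `r`. -/
def reg (r : ℕ) : Expr := .cell 10 (.const r) (.const 0)

/-- The command that stores `e` in register `r`. -/
def setReg (r : ℕ) (e : Expr) : Cmd := .assign 10 (.const r) (.const 0) e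

@[simp] theorem eval_reg (s : Store) (r : ℕ) : (reg r).eval s = s (10, r, 0) := rfl

@[simp] theorem eval_const (s : Store) (k : ℕ) : (Expr.const k).eval s = k := rfl

theorem runs_setReg {s : Store} {r : ℕ} {e : Expr} {Q : Store → Prop}
    (hQ : Q (s.update (10, r, 0) (e.eval s))) : Runs (setReg r e) s [] 1 Q :=
  runs_assign hQ

theorem update_reg_self (s : Store) (r v : ℕ) : (s.update (10, r, 0) v) (10, r, 0) = v := by
  simp

theorem update_reg_ne (s : Store) {r a i j : ℕ} (v : ℕ) (h : ¬ (a = 10 ∧ i = r ∧ j = 0)) :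
    (s.update (10, r, 0) v) (a, i, j) = s (a, i, j) := by
  rw [Finsupp.coe_update, Function.update_of_ne]
  simpa using h

theorem Frame.refl (d h : ℕ) (s : Store) : Frame d h s s := fun _ _ _ _ => rfl

theorem Frame.trans {d h : ℕ} {s s' s'' : Store} (h₁ : Frame d h s s') (h₂ : Frame d h s' s'') :
    Frame d h s s'' := fun a i j hn => (h₂ a i j hn).trans (h₁ a i j hn)

theorem Frame.mono {d h d' h' : ℕ} {s s' : Store} (h₁ : Frame d h s s') (hd : d' ≤ d)
    (hh : d + h ≤ d' + h') : Frame d' h' s s' :=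
  fun a i j hn => h₁ a i j fun hc => hn ⟨hc.1, by omega, by omega, hc.2.2.2⟩

theorem frame_update {d h r : ℕ} (s : Store) (v : ℕ) (h₁ : d ≤ r) (h₂ : r < d + h) :
    Frame d h s (s.update (10, r, 0) v) :=
  fun a i j hn => update_reg_ne s v fun hc => hn ⟨hc.1, by omega, by omega, hc.2.2⟩

section
variable {Γ : Type} [Ctx Γ]

theorem Fits.frame {loc : ℕ → ℕ} {d d' h B : ℕ} {γ : Γ} {s s' : Store} (hf : Fits loc d B γ s)
    (hfr : Frame d h s s') (hd : d ≤ d') : Fits loc d' B γ s' := by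
  refine ⟨fun x hx => (hf.loc_lt x hx).trans_le hd, fun a ha i j => ?_, fun x hx => ?_, hf.var_le,
    hf.n_le, hf.idx_le, hf.one_le⟩
  · rw [hfr a i j (by omega), hf.reads a ha]
  · rw [hfr _ _ _ (by have := hf.loc_lt x hx; omega), hf.var x hx]

theorem Fits.extend {loc : ℕ → ℕ} {d d' B B' v : ℕ} {γ : Γ} {s : Store} (hf : Fits loc d B γ s)
    {r : ℕ} (hr : r < d') (hd : d ≤ d') (hv : s (10, r, 0) = v) (hB : B ≤ B') (hvB : v ≤ B') :
    Fits (Function.update loc (Ctx.depth Γ) r) d' B' (γ, v) s := by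
  have hdep : Ctx.depth (Γ × ℕ) = Ctx.depth Γ + 1 := rfl
  have hvar : ∀ x, Ctx.vars (γ, v) x = if x = Ctx.depth Γ then v else Ctx.vars γ x := fun x => rfl
  refine ⟨fun x hx => ?_, hf.reads, fun x hx => ?_, fun x hx => ?_, hf.n_le.trans hB,
    hf.idx_le.trans hB, hf.one_le.trans hB⟩
  · by_cases h : x = Ctx.depth Γ
    · rwa [h, Function.update_self]
    · rw [Function.update_of_ne h]
      have := hf.loc_lt x (by omega)
      omega
  · rw [hvar]
    by_cases h : x = Ctx.depth Γ
    · rw [h, Function.update_self, if_pos rfl, hv]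
    · rw [Function.update_of_ne h, if_neg h, hf.var x (by omega)]
  · rw [hvar]
    split
    · exact hvB
    · exact (hf.var_le x (by omega)).trans hB

theorem Dfn.congr {f g : Γ → ℕ} (hf : Dfn f) (h : ∀ γ, g γ = f γ) : Dfn g := by
  rwa [funext h]

theorem Dfn.const (k : ℕ) : Dfn (fun _ : Γ => k) := by
  refine ⟨fun _ d => setReg d (.const k), 1, Polynomial.C (k + 1), fun loc d B γ s hf => ⟨by simp, ?_⟩⟩
  refine (runs_setReg ?_).mono (by simp) fun _ h => h
  exact ⟨update_reg_self _ _ _, frame_update _ _ le_rfl (by omega)⟩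

theorem Dfn.snd : Dfn (fun γ : Γ × ℕ => γ.2) := by
  refine ⟨fun loc d => setReg d (reg (loc (Ctx.depth Γ))), 1, Polynomial.X + 1,
    fun loc d B γ s hf => ?_⟩
  have h1 : Ctx.vars γ (Ctx.depth Γ) = γ.2 := if_pos rfl
  have h2 : Ctx.depth Γ < Ctx.depth (Γ × ℕ) := Nat.lt_succ_self _
  constructor
  · have := hf.var_le _ h2
    rw [h1] at this
    simp; omega
  · refine (runs_setReg ?_).mono (by simp) fun _ h => h
    refine ⟨?_, frame_update _ _ le_rfl (by omega)⟩
    rw [update_reg_self, eval_reg, hf.var _ h2, h1]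

/-- A renaming of variables. -/
structure Ren {Γ Δ : Type} [Ctx Γ] [Ctx Δ] (π : Γ → Δ) : Prop where
  base : ∀ γ, Ctx.base (π γ) = Ctx.base γ
  var : ∀ x < Ctx.depth Δ, ∃ y < Ctx.depth Γ, ∀ γ, Ctx.vars (π γ) x = Ctx.vars γ y

theorem Ren.id : Ren (fun γ : Γ => γ) := ⟨fun _ => rfl, fun x hx => ⟨x, hx, fun _ => rfl⟩⟩

theorem Ren.fst {Δ : Type} [Ctx Δ] {π : Γ → Δ} (h : Ren π) : Ren (fun γ : Γ × ℕ => π γ.1) := by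
  refine ⟨fun γ => h.base γ.1, fun x hx => ?_⟩
  obtain ⟨y, hy, he⟩ := h.var x hx
  exact ⟨y, Nat.lt_succ_of_lt hy, fun γ => (he γ.1).trans (if_neg hy.ne).symm⟩

theorem Ren.prod {Δ : Type} [Ctx Δ] {π : Γ → Δ} (h : Ren π) :
    Ren (fun γ : Γ × ℕ => (π γ.1, γ.2)) := by
  refine ⟨fun γ => h.base γ.1, fun x hx => ?_⟩
  by_cases hxd : x = Ctx.depth Δ
  · exact ⟨Ctx.depth Γ, Nat.lt_succ_self _, fun γ => (if_pos hxd).trans (if_pos rfl).symm⟩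
  · obtain ⟨y, hy, he⟩ := h.var x (by have : x < Ctx.depth Δ + 1 := hx; omega)
    exact ⟨y, Nat.lt_succ_of_lt hy, fun γ =>
      (if_neg hxd).trans ((he γ.1).trans (if_neg hy.ne).symm)⟩

/-- A renaming costs no time: it is absorbed into the map `loc` from variables to registers. -/
theorem Dfn.ren {Δ : Type} [Ctx Δ] {f : Δ → ℕ} (hf : Dfn f) {π : Γ → Δ} (hπ : Ren π) :
    Dfn (fun γ => f (π γ)) := by
  obtain ⟨c, h, p, H⟩ := hf
  choose! y hy hyv using hπ.var
  refine ⟨fun loc d => c (fun x => loc (y x)) d, h, p, fun loc d B γ s hfit =>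
    H (fun x => loc (y x)) d B (π γ) s ⟨fun x hx => hfit.loc_lt _ (hy x hx), ?_, fun x hx => ?_,
      fun x hx => ?_, ?_, ?_, hfit.one_le⟩⟩
  · rw [hπ.base]; exact hfit.reads
  · rw [hyv x hx]; exact hfit.var _ (hy x hx)
  · rw [hyv x hx]; exact hfit.var_le _ (hy x hx)
  · rw [hπ.base]; exact hfit.n_le
  · rw [hπ.base]; exact hfit.idx_le

/-- Common scheme for the primitive operations, including access to the state: f goes to register d,
g to register d + 1, then one assignment. The hypothesis `hle` keeps the value polynomial in B. -/
theorem Dfn.binop {f g v : Γ → ℕ} (hf : Dfn f) (hg : Dfn g) (op : Expr → Expr → Expr)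
    (hop : ∀ γ s e₁ e₂, Reads s (Ctx.base γ) → e₁.eval s = f γ → e₂.eval s = g γ →
      (op e₁ e₂).eval s = v γ)
    (hle : ∀ γ, v γ ≤ f γ + g γ + (Ctx.base γ).n + (Ctx.base γ).idx + 1) : Dfn v := by
  obtain ⟨c₁, h₁, p₁, H₁⟩ := hf
  obtain ⟨c₂, h₂, p₂, H₂⟩ := hg
  refine ⟨fun loc d => .seq (c₁ loc d) (.seq (c₂ loc (d + 1))
    (setReg d (op (reg d) (reg (d + 1))))), h₁ + h₂ + 1,
    p₁ + p₂ + 2 * Polynomial.X + 4, fun loc d B γ s hfit => ?_⟩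
  obtain ⟨b₁, R₁⟩ := H₁ loc d B γ s hfit
  have b₂ := (H₂ loc d B γ s hfit).1
  have hn := hfit.n_le
  have hi := hfit.idx_le
  have hv := hle γ
  constructor
  · simp; omega
  refine (R₁.seq_nil fun s₁ hs₁ => (?_ : Runs _ s₁ [] (p₂.eval B + 1 + 1) _)).mono ?_ fun _ h => h
  · have fit₁ := hfit.frame (d' := d + 1) hs₁.2 (by omega)
    refine ((H₂ loc (d + 1) B γ s₁ fit₁).2).seq_nil fun s₂ hs₂ => runs_setReg ?_
    have fr : Frame d (h₁ + h₂ + 1) s s₂ := (hs₁.2.mono le_rfl (by omega)).trans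
      (hs₂.2.mono (by omega) (by omega))
    refine ⟨?_, fr.trans (frame_update _ _ le_rfl (by omega))⟩
    rw [update_reg_self]
    refine hop γ s₂ _ _ (hfit.frame fr le_rfl).reads ?_ hs₂.1
    rw [eval_reg, hs₂.2 _ _ _ (by omega), hs₁.1]
  · simp; omega

theorem Dfn.add {f g : Γ → ℕ} (hf : Dfn f) (hg : Dfn g) : Dfn (fun γ => f γ + g γ) :=
  hf.binop hg .add (fun γ s e₁ e₂ _ h₁ h₂ => by rw [Expr.eval, h₁, h₂]) fun γ => by omega

theorem Dfn.sub {f g : Γ → ℕ} (hf : Dfn f) (hg : Dfn g) : Dfn (fun γ => f γ - g γ) :=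
  hf.binop hg .sub (fun γ s e₁ e₂ _ h₁ h₂ => by rw [Expr.eval, h₁, h₂]) fun γ => by omega

theorem Dfn.lt {f g : Γ → ℕ} (hf : Dfn f) (hg : Dfn g) : Dfn (fun γ => ind (f γ < g γ)) :=
  hf.binop hg .lt (fun γ s e₁ e₂ _ h₁ h₂ => by rw [Expr.eval, h₁, h₂, ind]; congr)
    fun γ => by have := ind_le_one (f γ < g γ); omega

theorem Dfn.eq {f g : Γ → ℕ} (hf : Dfn f) (hg : Dfn g) : Dfn (fun γ => ind (f γ = g γ)) :=
  hf.binop hg .eq (fun γ s e₁ e₂ _ h₁ h₂ => by rw [Expr.eval, h₁, h₂, ind]; congr)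
    fun γ => by have := ind_le_one (f γ = g γ); omega

theorem St.cells_le (σ : St) (a i j : ℕ) : σ.cells a i j ≤ σ.n + σ.idx + 1 := by
  unfold St.cells
  split
  · split <;> omega
  · have := ind_le_one (σ.adj i j); omega
  · have := ind_le_one (σ.cur i j); omega
  · have := ind_le_one (σ.root i j); omega
  · split <;> omega
  · omega

theorem Dfn.cell {f g : Γ → ℕ} (hf : Dfn f) (hg : Dfn g) {a : ℕ} (ha : a < 5) :
    Dfn (fun γ => (Ctx.base γ).cells a (f γ) (g γ)) :=
  hf.binop hg (.cell a) (fun γ s e₁ e₂ hr h₁ h₂ => by rw [Expr.eval, h₁, h₂, hr a ha])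
    fun γ => by have := (Ctx.base γ).cells_le a (f γ) (g γ); omega

theorem Dfn.n : Dfn (fun γ : Γ => (Ctx.base γ).n) :=
  ((Dfn.const 0).cell (Dfn.const 0) (a := 0) (by omega)).congr fun γ => by simp [St.cells]

theorem Dfn.idx : Dfn (fun γ : Γ => (Ctx.base γ).idx) :=
  ((Dfn.const 0).cell (Dfn.const 0) (a := 4) (by omega)).congr fun γ => by simp [St.cells]

/-- Composition stays polynomial because `Dfn` bounds values as well as times: f runs with the bound
B + p₂(B) in place of B. -/
theorem Dfn.subst {f : Γ × ℕ → ℕ} {g : Γ → ℕ} (hf : Dfn f) (hg : Dfn g) :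
    Dfn (fun γ => f (γ, g γ)) := by
  obtain ⟨c₁, h₁, p₁, H₁⟩ := hf
  obtain ⟨c₂, h₂, p₂, H₂⟩ := hg
  refine ⟨fun loc d => .seq (c₂ loc d) (.seq (c₁ (Function.update loc (Ctx.depth Γ) d) (d + 1))
    (setReg d (reg (d + 1)))), h₁ + h₂ + 1, p₂ + p₁.comp (Polynomial.X + p₂) + 4,
    fun loc d B γ s hfit => ?_⟩
  obtain ⟨b₂, R₂⟩ := H₂ loc d B γ s hfit
  have key : ∀ s₁, s₁ (10, d, 0) = g γ ∧ Frame d h₂ s s₁ →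
      Fits (Function.update loc (Ctx.depth Γ) d) (d + 1) (B + p₂.eval B) (γ, g γ) s₁ :=
    fun s₁ hs₁ => (hfit.frame hs₁.2 le_rfl).extend (by omega) (by omega) hs₁.1 (by omega) (by omega)
  constructor
  · obtain ⟨s₁, t, -, -, hs₁⟩ := R₂
    have := (H₁ _ _ _ _ _ (key s₁ hs₁)).1
    simp; omega
  refine (R₂.seq_nil fun s₁ hs₁ =>
    (?_ : Runs _ s₁ [] (p₁.eval (B + p₂.eval B) + 1 + 1) _)).mono ?_ fun _ h => h
  · refine ((H₁ _ _ _ _ _ (key s₁ hs₁)).2).seq_nil fun s₂ hs₂ => runs_setReg ?_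
    have fr : Frame d (h₁ + h₂ + 1) s s₂ := (hs₁.2.mono le_rfl (by omega)).trans
      (hs₂.2.mono (by omega) (by omega))
    refine ⟨?_, fr.trans (frame_update _ _ le_rfl (by omega))⟩
    rw [update_reg_self, eval_reg, hs₂.1]
  · simp; omega

/-- The only source of loops in computed functions; quantifiers, products, quotients and minima are
derived from it. Registers d, d + 1 and d + 2 hold the range, the partial sum and the summation
variable, and f works from d + 3 on. -/
theorem Dfn.sum {f : Γ × ℕ → ℕ} {b : Γ → ℕ} (hf : Dfn f) (hb : Dfn b) :
    Dfn (fun γ => ∑ v ∈ Finset.range (b γ), f (γ, v)) := by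
  obtain ⟨c₁, h₁, p₁, H₁⟩ := hf
  obtain ⟨c₂, h₂, p₂, H₂⟩ := hb
  refine ⟨fun loc d => .seq (c₂ loc d) (.seq (setReg (d + 1) (.const 0))
    (.seq (setReg (d + 2) (.const 0)) (.seq (.loop (.lt (reg (d + 2)) (reg d))
      (.seq (c₁ (Function.update loc (Ctx.depth Γ) (d + 2)) (d + 3))
        (.seq (setReg (d + 1) (.add (reg (d + 1)) (reg (d + 3))))
          (setReg (d + 2) (.add (reg (d + 2)) (.const 1))))))
      (setReg d (reg (d + 1)))))), h₁ + h₂ + 3,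
    p₂ + p₂ * (p₁.comp (Polynomial.X + p₂) + 5) + 9,
    fun loc d B γ s hfit => ?_⟩
  obtain ⟨b₂, R₂⟩ := H₂ loc d B γ s hfit
  have fits : ∀ s₁ v, v < b γ → s₁ (10, d + 2, 0) = v → Frame d (h₁ + h₂ + 3) s s₁ →
      Fits (Function.update loc (Ctx.depth Γ) (d + 2)) (d + 3) (B + p₂.eval B) (γ, v) s₁ :=
    fun s₁ v hv h1 hfr =>
      (hfit.frame hfr le_rfl).extend (by omega) (by omega) h1 (by omega) (by omega)
  -- The bound on values requires some memory that fits; placing v by hand in register d + 2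
  -- provides one without running the program.
  have val : ∀ v < b γ, f (γ, v) ≤ p₁.eval (B + p₂.eval B) := by
    intro v hv
    have hfr : Frame d (h₁ + h₂ + 3) s (s.update (10, d + 2, 0) v) :=
      frame_update _ _ (by omega) (by omega)
    exact (H₁ _ _ _ _ _ (fits _ v hv (update_reg_self _ _ _) hfr)).1
  set T := p₁.eval (B + p₂.eval B) with hT
  constructor
  · calc ∑ v ∈ Finset.range (b γ), f (γ, v) ≤ (Finset.range (b γ)).card • T :=
          Finset.sum_le_card_nsmul _ _ _ fun v hv => val v (Finset.mem_range.1 hv)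
      _ = b γ * T := by simp
      _ ≤ p₂.eval B * (T + 5) := Nat.mul_le_mul b₂ (by omega)
      _ ≤ _ := by simp [hT]; omega
  set I : ℕ → Store → Prop := fun k s₁ => Frame d (h₁ + h₂ + 3) s s₁ ∧ s₁ (10, d, 0) = b γ ∧
    s₁ (10, d + 1, 0) = ∑ v ∈ Finset.range k, f (γ, v) ∧ s₁ (10, d + 2, 0) = k with hI
  have hbody : ∀ k < b γ, ∀ s₁, I k s₁ → (Expr.lt (reg (d + 2)) (reg d)).eval s₁ ≠ 0 ∧
      Runs (.seq (c₁ (Function.update loc (Ctx.depth Γ) (d + 2)) (d + 3))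
        (.seq (setReg (d + 1) (.add (reg (d + 1)) (reg (d + 3))))
          (setReg (d + 2) (.add (reg (d + 2)) (.const 1))))) s₁ [] (T + (1 + 1 + 1) + 1)
          (I (k + 1)) := by
    rintro k hk s₁ ⟨hfr, e0, e1, e2⟩
    refine ⟨by simp [Expr.eval, e0, e2, hk], ?_⟩
    refine ((H₁ _ _ _ _ _ (fits s₁ k hk e2 hfr)).2).seq_nil fun s₂ hs₂ =>
      (runs_setReg (Q := fun s₃ => s₃ = s₂.update (10, d + 1, 0)
        (s₂ (10, d + 1, 0) + s₂ (10, d + 3, 0))) rfl).seq_nil fun s₃ hs₃ => runs_setReg ?_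
    subst hs₃
    have fr2 : Frame d (h₁ + h₂ + 3) s s₂ := hfr.trans (hs₂.2.mono (by omega) (by omega))
    refine ⟨(fr2.trans (frame_update _ _ (by omega) (by omega))).trans
      (frame_update _ _ (by omega) (by omega)), ?_, ?_, ?_⟩
    · rw [update_reg_ne _ _ (by omega), update_reg_ne _ _ (by omega), hs₂.2 _ _ _ (by omega), e0]
    · rw [update_reg_ne _ _ (by omega), update_reg_self, hs₂.2 _ _ _ (by omega), e1, hs₂.1,
        Finset.sum_range_succ]
    · rw [update_reg_self, Expr.eval, eval_reg, update_reg_ne _ _ (by omega),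
        hs₂.2 _ _ _ (by omega), e2]
      rfl
  refine (R₂.seq_nil fun s₁ hs₁ => ((runs_setReg (Q := fun s₂ => s₂ = s₁.update (10, d + 1, 0) 0)
    rfl).seq_nil fun s₂ hs₂ => ((runs_setReg (Q := fun s₃ => s₃ = s₂.update (10, d + 2, 0) 0)
      rfl).seq_nil fun s₃ hs₃ => ((runs_loop_nil I hbody ?_ ?_).seq_nil fun s₄ hs₄ =>
        runs_setReg ?_)))).mono ?_ fun _ h => h
  · rintro s₅ ⟨-, e0, -, e2⟩
    simp [Expr.eval, e0, e2]
  · subst hs₃ hs₂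
    refine ⟨((hs₁.2.mono le_rfl (by omega)).trans (frame_update _ _ (by omega) (by omega))).trans
      (frame_update _ _ (by omega) (by omega)), ?_, ?_, update_reg_self _ _ _⟩
    · rw [update_reg_ne _ _ (by omega), update_reg_ne _ _ (by omega), hs₁.1]
    · rw [update_reg_ne _ _ (by omega), update_reg_self]; simp
  · refine ⟨?_, hs₄.1.trans (frame_update _ _ le_rfl (by omega))⟩
    rw [update_reg_self, eval_reg, hs₄.2.2.1]
  · have : b γ * (T + 5) ≤ p₂.eval B * (T + 5) := Nat.mul_le_mul b₂ le_rfl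
    have e : b γ * (T + (1 + 1 + 1) + 1 + 1) = b γ * (T + 5) := rfl
    rw [e]
    simp only [Polynomial.eval_add, Polynomial.eval_mul, Polynomial.eval_comp, Polynomial.eval_X,
      Polynomial.eval_ofNat, ← hT]
    omega

end

end RamWhile

namespace RamWhile

open EdgeDom

/-! ### Definable predicates and relations -/

/-- A predicate with polynomial-time computable indicator. -/
def DfnP {Γ : Type} [Ctx Γ] (P : Γ → Prop) : Prop := Dfn (fun γ => ind (P γ))

/-- A relation with polynomial-time computable indicator. -/
def DfnR {Γ : Type} [Ctx Γ] (C : Γ → ℕ → ℕ → Prop) : Prop :=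
  DfnP (fun γ : (Γ × ℕ) × ℕ => C γ.1.1 γ.1.2 γ.2)

/-- A relation on the vertices. -/
def Supp {Γ : Type} [Ctx Γ] (C : Γ → ℕ → ℕ → Prop) : Prop :=
  ∀ γ u v, C γ u v → u < (Ctx.base γ).n ∧ v < (Ctx.base γ).n

section
variable {Γ : Type} [Ctx Γ]

theorem ren1 : Ren (fun γ : Γ × ℕ => γ.1) := Ren.id.fst
theorem ren2 : Ren (fun γ : (Γ × ℕ) × ℕ => γ.1.1) := ren1.fst
theorem ren3 : Ren (fun γ : ((Γ × ℕ) × ℕ) × ℕ => γ.1.1.1) := ren2.fst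
theorem ren4 : Ren (fun γ : (((Γ × ℕ) × ℕ) × ℕ) × ℕ => γ.1.1.1.1) := ren3.fst
theorem dvar0 : Dfn (fun γ : Γ × ℕ => γ.2) := Dfn.snd
theorem dvar1 : Dfn (fun γ : (Γ × ℕ) × ℕ => γ.1.2) := dvar0.ren ren1
theorem dvar2 : Dfn (fun γ : ((Γ × ℕ) × ℕ) × ℕ => γ.1.1.2) := dvar1.ren ren1
theorem dvar3 : Dfn (fun γ : (((Γ × ℕ) × ℕ) × ℕ) × ℕ => γ.1.1.1.2) := dvar2.ren ren1

theorem Dfn.sum' {f : Γ → ℕ → ℕ} {b : Γ → ℕ} (hb : Dfn b)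
    (hf : Dfn (fun γ : Γ × ℕ => f γ.1 γ.2)) : Dfn (fun γ => ∑ v ∈ Finset.range (b γ), f γ v) :=
  hf.sum hb

/-- Multiplication is not a machine operation; a product is a sum of equal terms. -/
theorem Dfn.mul {f g : Γ → ℕ} (hf : Dfn f) (hg : Dfn g) : Dfn (fun γ => f γ * g γ) :=
  (Dfn.sum' (f := fun γ _ => g γ) hf (hg.ren ren1)).congr fun γ => by simp

theorem DfnP.congr {P Q : Γ → Prop} (hP : DfnP P) (h : ∀ γ, Q γ ↔ P γ) : DfnP Q :=
  Dfn.congr hP fun γ => ind_congr (h γ)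

theorem DfnP.and {P Q : Γ → Prop} (hP : DfnP P) (hQ : DfnP Q) : DfnP (fun γ => P γ ∧ Q γ) :=
  ((Dfn.add hP hQ).sub (Dfn.const 1)).congr fun γ => by
    by_cases h₁ : P γ <;> by_cases h₂ : Q γ <;> simp [ind, h₁, h₂]

theorem DfnP.not {P : Γ → Prop} (hP : DfnP P) : DfnP (fun γ => ¬ P γ) :=
  ((Dfn.const 1).sub hP).congr fun γ => by by_cases h₁ : P γ <;> simp [ind, h₁]

theorem DfnP.or {P Q : Γ → Prop} (hP : DfnP P) (hQ : DfnP Q) : DfnP (fun γ => P γ ∨ Q γ) :=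
  (hP.not.and hQ.not).not.congr fun γ => by tauto

theorem DfnP.imp {P Q : Γ → Prop} (hP : DfnP P) (hQ : DfnP Q) : DfnP (fun γ => P γ → Q γ) :=
  (hP.not.or hQ).congr fun γ => by tauto

theorem DfnP.iff {P Q : Γ → Prop} (hP : DfnP P) (hQ : DfnP Q) : DfnP (fun γ => P γ ↔ Q γ) :=
  ((hP.imp hQ).and (hQ.imp hP)).congr fun γ => by tauto

theorem DfnP.lt {f g : Γ → ℕ} (hf : Dfn f) (hg : Dfn g) : DfnP (fun γ => f γ < g γ) := Dfn.lt hf hg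

theorem DfnP.eq {f g : Γ → ℕ} (hf : Dfn f) (hg : Dfn g) : DfnP (fun γ => f γ = g γ) := Dfn.eq hf hg

open Classical in
theorem Dfn.ite {P : Γ → Prop} {f g : Γ → ℕ} (hP : DfnP P) (hf : Dfn f) (hg : Dfn g) :
    Dfn (fun γ => if P γ then f γ else g γ) :=
  ((Dfn.mul hP hf).add (Dfn.mul hP.not hg)).congr fun γ => by
    by_cases h₁ : P γ <;> simp [ind, h₁]

theorem DfnP.ex_lt {P : Γ → ℕ → Prop} {b : Γ → ℕ} (hb : Dfn b)
    (hP : DfnP (fun γ : Γ × ℕ => P γ.1 γ.2)) : DfnP (fun γ => ∃ v, v < b γ ∧ P γ v) := by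
  refine (DfnP.lt (Dfn.const 0) (Dfn.sum' (f := fun γ v => ind (P γ v)) hb hP)).congr fun γ => ?_
  rw [Nat.pos_iff_ne_zero, Ne, Finset.sum_eq_zero_iff]
  push Not
  refine exists_congr fun v => and_congr (by simp) ?_
  by_cases h : P γ v <;> simp [ind, h]

theorem DfnP.ex {P : Γ → ℕ → Prop} (hP : DfnP (fun γ : Γ × ℕ => P γ.1 γ.2))
    (hb : ∀ γ v, P γ v → v < (Ctx.base γ).n) : DfnP (fun γ => ∃ v, P γ v) :=
  (DfnP.ex_lt Dfn.n hP).congr fun γ => exists_congr fun v => ⟨fun h => ⟨hb γ v h, h⟩, fun h => h.2⟩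

theorem DfnP.all {P Q : Γ → ℕ → Prop} (hP : DfnP (fun γ : Γ × ℕ => P γ.1 γ.2))
    (hQ : DfnP (fun γ : Γ × ℕ => Q γ.1 γ.2)) (hb : ∀ γ v, P γ v → v < (Ctx.base γ).n) :
    DfnP (fun γ => ∀ v, P γ v → Q γ v) :=
  (DfnP.not (DfnP.ex (P := fun γ v => P γ v ∧ ¬ Q γ v) (hP.and hQ.not)
    fun γ v h => hb γ v h.1)).congr fun γ => by push Not; rfl

theorem DfnR.app {C : Γ → ℕ → ℕ → Prop} (hC : DfnR C) {x y : Γ → ℕ} (hx : Dfn x) (hy : Dfn y) :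
    DfnP (fun γ => C γ (x γ) (y γ)) :=
  Dfn.subst (Dfn.subst hC (hy.ren ren1)) hx

theorem DfnR.ren {Δ : Type} [Ctx Δ] {C : Δ → ℕ → ℕ → Prop} (hC : DfnR C) {π : Γ → Δ} (hπ : Ren π) :
    DfnR (fun γ => C (π γ)) :=
  Dfn.ren hC hπ.prod.prod

theorem DfnR.ex {C : Γ → ℕ → ℕ → Prop} (hC : DfnR C) (hC' : Supp C) {x : Γ → ℕ} (hx : Dfn x)
    {Q : Γ → ℕ → Prop} (hQ : DfnP (fun γ : Γ × ℕ => Q γ.1 γ.2)) :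
    DfnP (fun γ => ∃ v, C γ (x γ) v ∧ Q γ v) :=
  DfnP.ex (P := fun γ v => C γ (x γ) v ∧ Q γ v)
    (((hC.ren ren1).app (hx.ren ren1) dvar0).and hQ) fun _ _ h => (hC' _ _ _ h.1).2

theorem DfnR.all {C : Γ → ℕ → ℕ → Prop} (hC : DfnR C) (hC' : Supp C) {x : Γ → ℕ} (hx : Dfn x)
    {Q : Γ → ℕ → Prop} (hQ : DfnP (fun γ : Γ × ℕ => Q γ.1 γ.2)) :
    DfnP (fun γ => ∀ v, C γ (x γ) v → Q γ v) :=
  DfnP.all (P := fun γ v => C γ (x γ) v) ((hC.ren ren1).app (hx.ren ren1) dvar0) hQ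
    fun _ _ h => (hC' _ _ _ h).2

theorem DfnR.all₂ {C : Γ → ℕ → ℕ → Prop} (hC : DfnR C) (hC' : Supp C)
    {Q : Γ → ℕ → ℕ → Prop} (hQ : DfnR Q) : DfnP (fun γ => ∀ u v, C γ u v → Q γ u v) := by
  refine (DfnP.not (DfnP.ex (P := fun γ u => ∃ v, C γ u v ∧ ¬ Q γ u v)
    ((hC.ren ren1).ex (fun γ => hC' γ.1) dvar0 (DfnP.not hQ)) ?_)).congr fun γ => ?_
  · rintro γ u ⟨v, h, -⟩
    exact (hC' _ _ _ h).1
  · push Not; rfl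

theorem DfnR.ext {C C' : Γ → ℕ → ℕ → Prop} (hC : DfnR C) (hs : Supp C) (hC' : DfnR C')
    (hs' : Supp C') : DfnP (fun γ => ∀ u v, C γ u v ↔ C' γ u v) :=
  ((hC.all₂ hs hC').and (hC'.all₂ hs' hC)).congr fun γ => by
    simp only [iff_iff_implies_and_implies, forall_and]

theorem Supp.ren {Δ : Type} [Ctx Δ] {C : Δ → ℕ → ℕ → Prop} (hC : Supp C) {π : Γ → Δ} (hπ : Ren π) :
    Supp (fun γ => C (π γ)) := fun γ u v h => by
  have := hC _ _ _ h
  rwa [hπ.base] at this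

theorem dfnR_adj : DfnR (fun γ : Γ => (Ctx.base γ).adj) :=
  dvar1.cell dvar0 (a := 1) (by omega)

theorem dfnR_cur : DfnR (fun γ : Γ => (Ctx.base γ).cur) :=
  dvar1.cell dvar0 (a := 2) (by omega)

theorem dfnR_root : DfnR (fun γ : Γ => (Ctx.base γ).root) :=
  dvar1.cell dvar0 (a := 3) (by omega)

theorem DfnR.cov {C : Γ → ℕ → ℕ → Prop} (hC : DfnR C) (hC' : Supp C) {x : Γ → ℕ} (hx : Dfn x) :
    DfnP (fun γ => Cov (C γ) (x γ)) :=
  DfnP.ex (P := fun γ v => C γ (x γ) v) ((hC.ren ren1).app (hx.ren ren1) dvar0)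
    fun _ _ h => (hC' _ _ _ h).2

theorem dfnP_samePair {x y u v : Γ → ℕ} (hx : Dfn x) (hy : Dfn y) (hu : Dfn u) (hv : Dfn v) :
    DfnP (fun γ => SamePair (u γ) (v γ) (x γ) (y γ)) :=
  ((DfnP.eq hu hx).and (DfnP.eq hv hy)).or ((DfnP.eq hu hy).and (DfnP.eq hv hx))

variable {A D M : Γ → ℕ → ℕ → Prop} {w a c : Γ → ℕ}

theorem dfnP_isGood (hA : DfnR A) (hA' : Supp A) (hD : DfnR D) (hD' : Supp D) :
    DfnP (fun γ => IsGood (A γ) (D γ)) := by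
  have h1 : DfnP (fun γ => ∀ u v, D γ u v → D γ v u) :=
    hD.all₂ hD' (Q := fun γ u v => D γ v u) ((hD.ren ren2).app dvar0 dvar1)
  have h2 : DfnP (fun γ => ∀ u v, D γ u v → A γ u v) := hD.all₂ hD' hA
  have h3 : DfnP (fun γ => ∀ u v, A γ u v → Cov (D γ) u ∨ Cov (D γ) v) :=
    hA.all₂ hA' (Q := fun γ u v => Cov (D γ) u ∨ Cov (D γ) v)
      (((hD.ren ren2).cov (hD'.ren ren2) dvar1).or ((hD.ren ren2).cov (hD'.ren ren2) dvar0))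
  -- The quantifiers are reordered so that each one runs over the neighbours of a vertex and is thus
  -- bounded by n.
  have h4 : DfnP (fun γ => ∀ c b, D γ c b → ∀ b', D γ c b' → b ≠ b' →
      (∀ x, D γ b x → x = c) ∧ ∃ w, A γ b w ∧ ¬ Cov (D γ) w) := by
    refine hD.all₂ hD' (Q := fun γ c b => ∀ b', D γ c b' → b ≠ b' →
      (∀ x, D γ b x → x = c) ∧ ∃ w, A γ b w ∧ ¬ Cov (D γ) w) ?_
    refine (hD.ren ren2).all (hD'.ren ren2) dvar1 (DfnP.imp (DfnP.eq dvar1 dvar0).not (DfnP.and ?_ ?_))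
    · exact (hD.ren ren3).all (hD'.ren ren3) dvar1 (DfnP.eq dvar0 dvar3)
    · exact (hA.ren ren3).ex (hA'.ren ren3) dvar1 ((hD.ren ren4).cov (hD'.ren ren4) dvar0).not
  refine (h1.and (h2.and (h3.and h4))).congr fun γ => ⟨fun h => ⟨h.symm, h.sub, h.dom,
    fun c b hb b' hb' hne => h.star c b b' hb hb' hne⟩, fun h => ⟨h.1, h.2.1, h.2.2.1,
    fun c b b' hb hb' hne => h.2.2.2 c b hb b' hb' hne⟩⟩

theorem dfn_deg (hD : DfnR D) {x : Γ → ℕ} (hx : Dfn x) :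
    Dfn (fun γ => deg (Ctx.base γ).n (D γ) (x γ)) :=
  Dfn.sum' Dfn.n ((hD.ren ren1).app (hx.ren ren1) dvar0)

theorem dfn_rank (hD : DfnR D) (hM : DfnR M) :
    Dfn (fun γ => rank (Ctx.base γ).n (M γ) (D γ)) := by
  have hex : Dfn (fun γ => excess (Ctx.base γ).n (D γ)) :=
    Dfn.sum' Dfn.n ((dfn_deg (hD.ren ren1) dvar0).sub (Dfn.const 1))
  have hw : Dfn (fun γ => weight (Ctx.base γ).n (D γ)) :=
    Dfn.sum' Dfn.n (Dfn.sum' Dfn.n (Dfn.mul hD (dvar1.add dvar0)))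
  have hm : Dfn (fun γ => missing (Ctx.base γ).n (M γ) (D γ)) :=
    Dfn.sum' Dfn.n (Dfn.sum' Dfn.n (DfnP.and hM (DfnP.not hD)))
  refine Dfn.congr (Dfn.ite (DfnP.eq hex (Dfn.const 0)) hm ((Dfn.mul ((Dfn.mul Dfn.n (Dfn.mul Dfn.n
    (Dfn.n.add Dfn.n))).add (Dfn.const 1)) hex).add hw)) fun γ => ?_
  unfold rank
  congr

/-! ### Definability of the moves -/

theorem dfnP_tight (hA : DfnR A) (hA' : Supp A) (hD : DfnR D) (hD' : Supp D) (hw : Dfn w)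
    {l : Γ → ℕ} (hl : Dfn l) : DfnP (fun γ => Tight (A γ) (D γ) (w γ) (l γ)) :=
  hA.all hA' hl (Q := fun γ x => ¬ Cov (D γ) x → x = w γ)
    (DfnP.imp ((hD.ren ren1).cov (hD'.ren ren1) dvar0).not (DfnP.eq dvar0 (hw.ren ren1)))

theorem dfnP_dropped (hA : DfnR A) (hA' : Supp A) (hD : DfnR D) (hD' : Supp D) (hw : Dfn w)
    (ha : Dfn a) {l : Γ → ℕ} (hl : Dfn l) :
    DfnP (fun γ => Dropped (A γ) (D γ) (w γ) (a γ) (l γ)) := by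
  refine (DfnP.eq hl ha).not.and ((dfnP_tight hA hA' hD hD' hw hl).and ?_)
  refine hD.ex hD' hl (Q := fun γ p => ∃ l', D γ p l' ∧ l' ≠ a γ ∧ l' ≠ l γ ∧
    (¬ Tight (A γ) (D γ) (w γ) l' ∨ l' < l γ)) ?_
  refine (hD.ren ren1).ex (hD'.ren ren1) dvar0 ?_
  exact (DfnP.eq dvar0 (ha.ren ren2)).not.and ((DfnP.eq dvar0 (hl.ren ren2)).not.and
    ((dfnP_tight (hA.ren ren2) (hA'.ren ren2) (hD.ren ren2) (hD'.ren ren2) (hw.ren ren2)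
      dvar0).not.or (DfnP.lt dvar0 (hl.ren ren2))))

theorem dfnR_flip (hA : DfnR A) (hA' : Supp A) (hD : DfnR D) (hD' : Supp D) (hw : Dfn w)
    (ha : Dfn a) (hc : Dfn c) : DfnR (fun γ => EdgeDom.flip (A γ) (D γ) (w γ) (a γ) (c γ)) :=
  (DfnP.and hD ((dfnP_samePair (ha.ren ren2) (hc.ren ren2) dvar1 dvar0).not.and
    ((dfnP_dropped (hA.ren ren2) (hA'.ren ren2) (hD.ren ren2) (hD'.ren ren2) (hw.ren ren2)
      (ha.ren ren2) dvar1).not.and (dfnP_dropped (hA.ren ren2) (hA'.ren ren2) (hD.ren ren2)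
      (hD'.ren ren2) (hw.ren ren2) (ha.ren ren2) dvar0).not))).or
    (dfnP_samePair (ha.ren ren2) (hw.ren ren2) dvar1 dvar0)

theorem dfnP_freed (hA : DfnR A) (hD : DfnR D) (hD' : Supp D) (hw : Dfn w)
    {z : Γ → ℕ} (hz : Dfn z) : DfnP (fun γ => Freed (A γ) (D γ) (w γ) (z γ)) :=
  (hA.app hw hz).and (hD.cov hD' hz).not

theorem dfnP_all_freed (hA : DfnR A) (hA' : Supp A) (hD : DfnR D) (hD' : Supp D) (hw : Dfn w)
    {Q : Γ → ℕ → Prop} (hQ : DfnP (fun γ : Γ × ℕ => Q γ.1 γ.2)) :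
    DfnP (fun γ => ∀ z, Freed (A γ) (D γ) (w γ) z → Q γ z) :=
  DfnP.all (dfnP_freed (hA.ren ren1) (hD.ren ren1) (hD'.ren ren1) (hw.ren ren1) dvar0) hQ
    fun _ _ h => (hA' _ _ _ h.1).2

theorem dfnR_del (hD : DfnR D) (hw : Dfn w) (ha : Dfn a) :
    DfnR (fun γ => Del (D γ) (w γ) (a γ)) :=
  DfnP.and hD (dfnP_samePair (ha.ren ren2) (hw.ren ren2) dvar1 dvar0).not

theorem supp_del (hD' : Supp D) : Supp (fun γ => Del (D γ) (w γ) (a γ)) :=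
  fun γ u v h => hD' γ u v h.1

theorem dfnP_canAttach (hA : DfnR A) (hA' : Supp A) (hD : DfnR D) (hD' : Supp D) (hw : Dfn w)
    (ha : Dfn a) {z p : Γ → ℕ} (hz : Dfn z) (hp : Dfn p) :
    DfnP (fun γ => CanAttach (A γ) (D γ) (w γ) (a γ) (z γ) (p γ)) := by
  have hH := dfnR_del hD hw ha
  have hH' := supp_del (w := w) (a := a) hD'
  refine (hA.app hz hp).and (DfnP.or ?_ ?_)
  · refine hH.ex hH' hp (Q := fun γ q => ∃ q', Del (D γ) (w γ) (a γ) (p γ) q' ∧ q ≠ q') ?_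
    exact (hH.ren ren1).ex (hH'.ren ren1) (hp.ren ren1) (DfnP.eq dvar1 dvar0).not
  · refine hH.ex hH' hp (Q := fun γ q => (∀ x, Del (D γ) (w γ) (a γ) q x → x = p γ) ∧
      (∃ x, A γ q x ∧ (x = w γ ∨ ¬ Cov (D γ) x ∧ ¬ Freed (A γ) (D γ) (w γ) x)) ∧
      ((∀ y, Freed (A γ) (D γ) (w γ) y → ¬ A γ q y) ∨
        ∀ y, Freed (A γ) (D γ) (w γ) y → A γ q y ∨ A γ (p γ) y → y = z γ)) ?_
    refine DfnP.and ?_ (DfnP.and ?_ (DfnP.or ?_ ?_))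
    · exact (hH.ren ren1).all (hH'.ren ren1) dvar0 (DfnP.eq dvar0 (hp.ren ren2))
    · exact (hA.ren ren1).ex (hA'.ren ren1) dvar0 ((DfnP.eq dvar0 (hw.ren ren2)).or
        (((hD.ren ren2).cov (hD'.ren ren2) dvar0).not.and
          (dfnP_freed (hA.ren ren2) (hD.ren ren2) (hD'.ren ren2) (hw.ren ren2) dvar0).not))
    · exact dfnP_all_freed (hA.ren ren1) (hA'.ren ren1) (hD.ren ren1) (hD'.ren ren1) (hw.ren ren1)
        ((hA.ren ren2).app dvar1 dvar0).not
    · exact dfnP_all_freed (hA.ren ren1) (hA'.ren ren1) (hD.ren ren1) (hD'.ren ren1) (hw.ren ren1)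
        (DfnP.imp (((hA.ren ren2).app dvar1 dvar0).or ((hA.ren ren2).app (hp.ren ren2) dvar0))
          (DfnP.eq dvar0 (hz.ren ren2)))

theorem dfnP_attach (hA : DfnR A) (hA' : Supp A) (hD : DfnR D) (hD' : Supp D) (hw : Dfn w)
    (ha : Dfn a) {z p : Γ → ℕ} (hz : Dfn z) (hp : Dfn p) :
    DfnP (fun γ => Attach (A γ) (D γ) (w γ) (a γ) (z γ) (p γ)) := by
  refine (dfnP_freed hA hD hD' hw hz).and ((dfnP_canAttach hA hA' hD hD' hw ha hz hp).and ?_)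
  exact DfnP.all (dfnP_canAttach (hA.ren ren1) (hA'.ren ren1) (hD.ren ren1) (hD'.ren ren1)
    (hw.ren ren1) (ha.ren ren1) (hz.ren ren1) dvar0) (DfnP.lt dvar0 (hp.ren ren1)).not
    fun _ _ h => (hA' _ _ _ h.1).2

theorem dfnR_unflip (hA : DfnR A) (hA' : Supp A) (hD : DfnR D) (hD' : Supp D) (hw : Dfn w)
    (ha : Dfn a) (hc : Dfn c) : DfnR (fun γ => unflip (A γ) (D γ) (w γ) (a γ) (c γ)) :=
  DfnP.or (dfnR_del hD hw ha) ((dfnP_samePair (ha.ren ren2) (hc.ren ren2) dvar1 dvar0).or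
    ((dfnP_attach (hA.ren ren2) (hA'.ren ren2) (hD.ren ren2) (hD'.ren ren2) (hw.ren ren2)
      (ha.ren ren2) dvar1 dvar0).or (dfnP_attach (hA.ren ren2) (hA'.ren ren2) (hD.ren ren2)
      (hD'.ren ren2) (hw.ren ren2) (ha.ren ren2) dvar0 dvar1)))

/-! ### Powers, quotients and digits; definability of the numbered moves. -/

theorem Dfn.pow {f : Γ → ℕ} (hf : Dfn f) (k : ℕ) : Dfn (fun γ => f γ ^ k) := by
  induction k with
  | zero => exact (Dfn.const 1).congr fun γ => by simp
  | succ k ih => exact (Dfn.mul ih hf).congr fun γ => pow_succ _ _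

/-- For g > 0 the quotient is the number of q < f with (q + 1) g ≤ f; division by 0 gives 0 and is
treated separately. -/
theorem Dfn.div {f g : Γ → ℕ} (hf : Dfn f) (hg : Dfn g) : Dfn (fun γ => f γ / g γ) := by
  classical
  refine Dfn.congr (Dfn.ite (DfnP.eq hg (Dfn.const 0)) (Dfn.const 0) (Dfn.sum' hf
    (f := fun γ q => ind (¬ f γ < (q + 1) * g γ)) (DfnP.not (DfnP.lt (hf.ren ren1)
      (Dfn.mul (dvar0.add (Dfn.const 1)) (hg.ren ren1)))))) fun γ => ?_
  split
  · rename_i h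
    rw [h, Nat.div_zero]
  · rename_i h
    have hpos : 0 < g γ := Nat.pos_of_ne_zero h
    have e : ∀ q, ind (¬ f γ < (q + 1) * g γ) = if q < f γ / g γ then 1 else 0 := by
      intro q
      have : ¬ f γ < (q + 1) * g γ ↔ q < f γ / g γ := by
        rw [not_lt, Nat.lt_iff_add_one_le, Nat.le_div_iff_mul_le hpos]
      rw [ind_congr this]
      unfold ind
      congr
    simp only [e]
    rw [← Finset.sum_filter]
    have hf : Finset.filter (fun q => q < f γ / g γ) (Finset.range (f γ)) =
        Finset.range (f γ / g γ) := by
      ext q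
      have := Nat.div_le_self (f γ) (g γ)
      simp only [Finset.mem_filter, Finset.mem_range]
      omega
    rw [hf]
    simp

theorem Dfn.digit {j : Γ → ℕ} (hj : Dfn j) (k : ℕ) :
    Dfn (fun γ => EdgeDom.digit (Ctx.base γ).n (j γ) k) := by
  have h := hj.div (Dfn.pow Dfn.n k)
  refine Dfn.congr (h.sub (Dfn.mul Dfn.n (h.div Dfn.n))) fun γ => ?_
  unfold EdgeDom.digit
  exact Nat.mod_eq_sub_mul_div ..

theorem dfnR_toggled {j : Γ → ℕ} (hj : Dfn j) :
    DfnR (fun γ => Toggled (Ctx.base γ).n (j γ)) := by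
  have h : ∀ k l, DfnP (fun γ : (Γ × ℕ) × ℕ => SamePair γ.1.2 γ.2
      (EdgeDom.digit (Ctx.base γ.1.1).n (j γ.1.1) k)
      (EdgeDom.digit (Ctx.base γ.1.1).n (j γ.1.1) l)) :=
    fun k l => dfnP_samePair ((hj.digit k).ren ren2) ((hj.digit l).ren ren2) dvar1 dvar0
  exact (h 0 1).or ((h 2 3).or ((h 4 5).or ((h 6 7).or (h 8 9))))

theorem dfnR_fwd (hA : DfnR A) (hA' : Supp A) (hD : DfnR D) (hD' : Supp D) {j : Γ → ℕ}
    (hj : Dfn j) : DfnR (fun γ => fwd (Ctx.base γ).n (A γ) (D γ) (j γ)) := by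
  have he : DfnP (fun γ => EdgeDom.digit (Ctx.base γ).n (j γ) 0 =
    EdgeDom.digit (Ctx.base γ).n (j γ) 1) := DfnP.eq (hj.digit 0) (hj.digit 1)
  have he' := Dfn.ren he (ren2 (Γ := Γ))
  exact (DfnP.lt dvar1 Dfn.n).and ((DfnP.lt dvar0 Dfn.n).and ((DfnP.and he'
    (dfnR_flip hA hA' hD hD' (hj.digit 2) (hj.digit 3) (hj.digit 4))).or
    (DfnP.and (DfnP.not he') (DfnP.not (DfnP.iff hD (dfnR_toggled hj))))))

theorem dfnR_bwd (hA : DfnR A) (hA' : Supp A) (hD : DfnR D) (hD' : Supp D) {j : Γ → ℕ}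
    (hj : Dfn j) : DfnR (fun γ => bwd (Ctx.base γ).n (A γ) (D γ) (j γ)) := by
  have he : DfnP (fun γ => EdgeDom.digit (Ctx.base γ).n (j γ) 0 =
    EdgeDom.digit (Ctx.base γ).n (j γ) 1) := DfnP.eq (hj.digit 0) (hj.digit 1)
  have he' := Dfn.ren he (ren2 (Γ := Γ))
  exact (DfnP.lt dvar1 Dfn.n).and ((DfnP.lt dvar0 Dfn.n).and ((DfnP.and he'
    (dfnR_unflip hA hA' hD hD' (hj.digit 2) (hj.digit 3) (hj.digit 4))).or
    (DfnP.and (DfnP.not he') (DfnP.not (DfnP.iff hD (dfnR_toggled hj))))))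

theorem supp_fwd {j : Γ → ℕ} : Supp (fun γ => fwd (Ctx.base γ).n (A γ) (D γ) (j γ)) :=
  fun _ _ _ h => ⟨h.1, h.2.1⟩

theorem supp_bwd {j : Γ → ℕ} : Supp (fun γ => bwd (Ctx.base γ).n (A γ) (D γ) (j γ)) :=
  fun _ _ _ h => ⟨h.1, h.2.1⟩

theorem dfnP_goodMove (hA : DfnR A) (hA' : Supp A) (hM : DfnR M) (hD : DfnR D) (hD' : Supp D)
    {j : Γ → ℕ} (hj : Dfn j) : DfnP (fun γ => GoodMove (Ctx.base γ).n (A γ) (M γ) (D γ) (j γ)) := by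
  have hE := dfnR_fwd hA hA' hD hD' hj
  have hE' := supp_fwd (A := A) (D := D) (j := j)
  exact (dfnP_isGood hA hA' hE hE').and ((DfnP.lt (dfn_rank hE hM) (dfn_rank hD hM)).and
    ((dfnR_bwd hA hA' hE hE' hj).ext supp_bwd hD hD'))

end

/-! ### The search step -/

/-- The number of moves. -/
def numMoves (n : ℕ) : ℕ := n ^ 10

/-- The number of the first good move of `X`, or `numMoves n` if there is none. -/
noncomputable def firstMove (n : ℕ) (A M X : ℕ → ℕ → Prop) : ℕ :=
  ∑ j ∈ Finset.range (numMoves n), ind (¬ ∃ k, k < j + 1 ∧ GoodMove n A M X k)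

namespace St

/-- The edge set inspected in the next step: the result of undoing move number `idx`, or the current
edge set if all moves have been tried. -/
def look (σ : St) (u v : ℕ) : Prop :=
  (σ.idx < numMoves σ.n ∧ bwd σ.n σ.adj σ.cur σ.idx u v) ∨
    (¬ σ.idx < numMoves σ.n ∧ σ.cur u v)

/-- The first good move of the inspected edge set. -/
noncomputable def move (σ : St) : ℕ := firstMove σ.n σ.adj σ.root σ.look

/-- The inspected edge set is a child of the current one. -/
def IsChild (σ : St) : Prop :=
  σ.idx < numMoves σ.n ∧ IsGood σ.adj σ.look ∧ σ.move = σ.idx ∧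
    ∀ u v, fwd σ.n σ.adj σ.look σ.move u v ↔ σ.cur u v

/-- The next current edge set. -/
def newCur (σ : St) (u v : ℕ) : Prop :=
  (σ.IsChild ∧ σ.look u v) ∨ (¬ σ.IsChild ∧ σ.idx < numMoves σ.n ∧ σ.cur u v) ∨
    (¬ σ.IsChild ∧ ¬ σ.idx < numMoves σ.n ∧ fwd σ.n σ.adj σ.look σ.move u v)

open Classical in
/-- The next move number. -/
noncomputable def newIdx (σ : St) : ℕ :=
  if σ.IsChild then 0 else if σ.idx < numMoves σ.n then σ.idx + 1 else σ.move + 1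

/-- The search is over. -/
def IsLast (σ : St) : Prop := ¬ σ.idx < numMoves σ.n ∧ ¬ σ.move < numMoves σ.n

theorem look_lt (σ : St) (u v : ℕ) (h : σ.look u v) : u < σ.n ∧ v < σ.n := by
  rcases h with ⟨-, h⟩ | ⟨-, h⟩
  exacts [⟨h.1, h.2.1⟩, σ.cur_lt u v h]

theorem newCur_lt (σ : St) (u v : ℕ) (h : σ.newCur u v) : u < σ.n ∧ v < σ.n := by
  rcases h with ⟨-, h⟩ | ⟨-, -, h⟩ | ⟨-, -, h⟩
  exacts [σ.look_lt u v h, σ.cur_lt u v h, ⟨h.1, h.2.1⟩]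

/-- The search step. -/
noncomputable def next (σ : St) : St :=
  { σ with cur := σ.newCur, idx := σ.newIdx, cur_lt := σ.newCur_lt }

theorem dfn_numMoves : Dfn (fun σ : St => numMoves σ.n) := Dfn.pow (Γ := St) Dfn.n 10

theorem dfnP_idx_lt : DfnP (fun σ : St => σ.idx < numMoves σ.n) :=
  DfnP.lt (Dfn.idx (Γ := St)) dfn_numMoves

theorem supp_adj : Supp (fun σ : St => σ.adj) := fun σ u v h => σ.adj_lt u v h

theorem supp_cur : Supp (fun σ : St => σ.cur) := fun σ u v h => σ.cur_lt u v h

theorem supp_look : Supp (fun σ : St => σ.look) := fun σ u v h => σ.look_lt u v h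

theorem dfnR_look : DfnR (fun σ : St => σ.look) := by
  have h : DfnP (fun γ : (St × ℕ) × ℕ => γ.1.1.idx < numMoves γ.1.1.n) := Dfn.ren dfnP_idx_lt ren2
  exact (h.and (dfnR_bwd (Γ := St) dfnR_adj supp_adj dfnR_cur supp_cur Dfn.idx)).or
    (h.not.and (dfnR_cur (Γ := St)))

theorem dfn_move : Dfn (fun σ : St => σ.move) := by
  refine Dfn.sum' dfn_numMoves (DfnP.not (DfnP.ex_lt (dvar0.add (Dfn.const 1)) ?_))
  exact dfnP_goodMove (Γ := (St × ℕ) × ℕ) dfnR_adj (supp_adj.ren ren2) dfnR_root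
    (dfnR_look.ren ren2) (supp_look.ren ren2) dvar0

theorem dfnR_up : DfnR (fun σ : St => fwd σ.n σ.adj σ.look σ.move) :=
  dfnR_fwd (Γ := St) dfnR_adj supp_adj dfnR_look supp_look dfn_move

theorem dfnP_isChild : DfnP (fun σ : St => σ.IsChild) :=
  dfnP_idx_lt.and ((dfnP_isGood (Γ := St) dfnR_adj supp_adj dfnR_look supp_look).and
    ((DfnP.eq dfn_move (Dfn.idx (Γ := St))).and
      (dfnR_up.ext supp_fwd (dfnR_cur (Γ := St)) supp_cur)))

theorem dfnR_newCur : DfnR (fun σ : St => σ.newCur) := by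
  have h1 : DfnP (fun γ : (St × ℕ) × ℕ => γ.1.1.IsChild) := Dfn.ren dfnP_isChild ren2
  have h2 : DfnP (fun γ : (St × ℕ) × ℕ => γ.1.1.idx < numMoves γ.1.1.n) := Dfn.ren dfnP_idx_lt ren2
  exact (h1.and dfnR_look).or ((h1.not.and (h2.and (dfnR_cur (Γ := St)))).or
    (h1.not.and (h2.not.and dfnR_up)))

theorem dfn_newIdx : Dfn (fun σ : St => σ.newIdx) := by
  refine (Dfn.ite dfnP_isChild (Dfn.const 0) (Dfn.ite dfnP_idx_lt
    ((Dfn.idx (Γ := St)).add (Dfn.const 1)) (dfn_move.add (Dfn.const 1)))).congr fun σ => ?_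
  unfold newIdx
  congr

theorem dfnP_isLast : DfnP (fun σ : St => σ.IsLast) :=
  dfnP_idx_lt.not.and (DfnP.lt dfn_move dfn_numMoves).not

end St

end RamWhile

namespace RamWhile

open EdgeDom

/-! ### The walk of the search -/

section
variable {n : ℕ} {A M X : ℕ → ℕ → Prop}

/-- The sum in `firstMove` counts the j such that no good move has number at most j, that is, the
numbers before the first good move. This expresses a minimum by a bounded sum. -/
theorem firstMove_cases (n : ℕ) (A M X : ℕ → ℕ → Prop) :
    (firstMove n A M X < numMoves n ∧ GoodMove n A M X (firstMove n A M X)) ∨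
      (firstMove n A M X = numMoves n ∧ ∀ j < numMoves n, ¬ GoodMove n A M X j) := by
  classical
  by_cases h : ∃ j, j < numMoves n ∧ GoodMove n A M X j
  · left
    obtain ⟨h1, h2⟩ := Nat.find_spec h
    have h3 : ∀ k < Nat.find h, ¬ GoodMove n A M X k := fun k hk hg =>
      Nat.find_min h hk ⟨hk.trans h1, hg⟩
    have : firstMove n A M X = Nat.find h := by
      have e : ∀ j, ind (¬ ∃ k, k < j + 1 ∧ GoodMove n A M X k) =
          if j < Nat.find h then 1 else 0 := by
        intro j
        split
        · rename_i hj
          refine ind_true ?_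
          rintro ⟨k, hk, hg⟩
          exact h3 k (by omega) hg
        · rename_i hj
          exact ind_false fun hn => hn ⟨Nat.find h, by omega, h2⟩
      unfold firstMove
      simp only [e]
      rw [← Finset.sum_filter]
      have hf : Finset.filter (fun q => q < Nat.find h) (Finset.range (numMoves n)) =
          Finset.range (Nat.find h) := by
        ext q
        rw [Finset.mem_filter, Finset.mem_range, Finset.mem_range]
        omega
      rw [hf]
      simp
    rw [this]
    exact ⟨h1, h2⟩
  · right
    push Not at h
    refine ⟨?_, h⟩
    unfold firstMove
    rw [Finset.sum_congr rfl (g := fun _ => 1)]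
    · simp
    · intro j hj
      refine ind_true ?_
      rintro ⟨k, hk, hg⟩
      have := Finset.mem_range.1 hj
      exact h k (by omega) hg

end

namespace St

/-- The invariant of the search. -/
structure Valid (σ : St) : Prop where
  graph : IsGraph σ.n σ.adj
  root : IsGood σ.adj σ.root
  matching : IsMatching σ.root
  cur : IsGood σ.adj σ.cur
  idx_le : σ.idx ≤ numMoves σ.n

variable {σ : St}

theorem next_of_child (h : σ.IsChild) : σ.next.cur = σ.look ∧ σ.next.idx = 0 := by
  refine ⟨?_, if_pos h⟩
  funext u v
  exact propext ⟨fun h' => by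
    rcases h' with h' | h' | h'
    exacts [h'.2, absurd h h'.1, absurd h h'.1], fun h' => Or.inl ⟨h, h'⟩⟩

theorem next_of_lt (h : ¬ σ.IsChild) (hi : σ.idx < numMoves σ.n) :
    σ.next.cur = σ.cur ∧ σ.next.idx = σ.idx + 1 := by
  constructor
  · funext u v
    exact propext ⟨fun h' => by
      rcases h' with h' | h' | h'
      exacts [absurd h'.1 h, h'.2.2, absurd hi h'.2.1], fun h' => Or.inr (Or.inl ⟨h, hi, h'⟩)⟩
  · exact (if_neg h).trans (if_pos hi)

theorem look_of_not_lt (hi : ¬ σ.idx < numMoves σ.n) : σ.look = σ.cur := by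
  funext u v
  exact propext ⟨fun h' => by
    rcases h' with h' | h'
    exacts [absurd h'.1 hi, h'.2], fun h' => Or.inr ⟨hi, h'⟩⟩

theorem look_of_lt (hi : σ.idx < numMoves σ.n) : σ.look = bwd σ.n σ.adj σ.cur σ.idx := by
  funext u v
  exact propext ⟨fun h' => by
    rcases h' with h' | h'
    exacts [h'.2, absurd hi h'.1], fun h' => Or.inl ⟨hi, h'⟩⟩

theorem next_of_not_lt (hi : ¬ σ.idx < numMoves σ.n) :
    σ.next.cur = fwd σ.n σ.adj σ.cur σ.move ∧ σ.next.idx = σ.move + 1 := by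
  have h : ¬ σ.IsChild := fun h => hi h.1
  constructor
  · rw [← look_of_not_lt hi]
    funext u v
    exact propext ⟨fun h' => by
      rcases h' with h' | h' | h'
      exacts [absurd h'.1 h, absurd h'.2.1 hi, h'.2.2], fun h' => Or.inr (Or.inr ⟨h, hi, h'⟩)⟩
  · exact (if_neg h).trans (if_neg hi)

theorem move_cases (σ : St) : (σ.move < numMoves σ.n ∧ GoodMove σ.n σ.adj σ.root σ.look σ.move) ∨
    (σ.move = numMoves σ.n ∧ ∀ j < numMoves σ.n, ¬ GoodMove σ.n σ.adj σ.root σ.look j) :=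
  firstMove_cases ..

theorem Valid.next (hv : σ.Valid) (hl : ¬ σ.IsLast) : σ.next.Valid := by
  have key : IsGood σ.adj σ.next.cur ∧ σ.next.idx ≤ numMoves σ.n := by
    by_cases hc : σ.IsChild
    · rw [(next_of_child hc).1, (next_of_child hc).2]
      exact ⟨hc.2.1, Nat.zero_le _⟩
    by_cases hi : σ.idx < numMoves σ.n
    · rw [(next_of_lt hc hi).1, (next_of_lt hc hi).2]
      exact ⟨hv.cur, hi⟩
    · rw [(next_of_not_lt hi).1, (next_of_not_lt hi).2, ← look_of_not_lt hi]
      rcases σ.move_cases with h | h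
      · exact ⟨h.2.1, h.1⟩
      · exact absurd ⟨hi, by omega⟩ hl
  exact ⟨hv.graph, hv.root, hv.matching, key.1, key.2⟩

/-! ### The potential of the search. -/

/-- The number of steps without output that are still possible. -/
noncomputable def potential (σ : St) : ℕ :=
  (numMoves σ.n + 2) * EdgeDom.rank σ.n σ.root σ.cur + (numMoves σ.n + 1 - σ.idx)

/-- Such a step raises the move number or goes to the parent. In the second case the rank term falls
by at least `numMoves` + 2, which outweighs the at most `numMoves` regained by the smaller move
number. -/
theorem potential_next_lt (hl : ¬ σ.IsLast) (hc : ¬ σ.IsChild) :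
    σ.next.potential < σ.potential := by
  have e1 : σ.next.n = σ.n := rfl
  have e2 : σ.next.root = σ.root := rfl
  unfold potential
  rw [e1, e2]
  by_cases hi : σ.idx < numMoves σ.n
  · rw [(next_of_lt hc hi).1, (next_of_lt hc hi).2]
    omega
  · rw [(next_of_not_lt hi).1, (next_of_not_lt hi).2, ← look_of_not_lt hi]
    rcases σ.move_cases with h | h
    · have h1 := Nat.mul_le_mul (le_refl (numMoves σ.n + 2)) (Nat.succ_le_of_lt h.2.2.1)
      rw [Nat.succ_eq_add_one, Nat.mul_add, Nat.mul_one] at h1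
      omega
    · exact absurd ⟨hi, by omega⟩ hl

/-- A bound for the potential. -/
def gapBound (n : ℕ) : ℕ := (numMoves n + 2) * rankBound n + (numMoves n + 1)

theorem potential_le (σ : St) : σ.potential ≤ gapBound σ.n :=
  Nat.add_le_add (Nat.mul_le_mul le_rfl (rank_le _ _ _)) (Nat.sub_le _ _)

/-- The states of the search. -/
noncomputable def walk (σ : St) (k : ℕ) : St := St.next^[k] σ

theorem walk_succ (σ : St) (k : ℕ) : σ.walk (k + 1) = (σ.walk k).next :=
  Function.iterate_succ_apply' ..

theorem walk_add (σ : St) (k l : ℕ) : σ.walk (k + l) = (σ.walk l).walk k :=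
  Function.iterate_add_apply ..

theorem walk_const (σ : St) (k : ℕ) :
    (σ.walk k).n = σ.n ∧ (σ.walk k).adj = σ.adj ∧ (σ.walk k).root = σ.root := by
  induction k with
  | zero => exact ⟨rfl, rfl, rfl⟩
  | succ k ih => rw [walk_succ]; exact ih

theorem Valid.walk (hv : σ.Valid) {k : ℕ} (h : ∀ j < k, ¬ (σ.walk j).IsLast) :
    (σ.walk k).Valid := by
  induction k with
  | zero => exact hv
  | succ k ih =>
    rw [walk_succ]
    exact (ih fun j hj => h j (by omega)).next (h k (by omega))

/-! ### Which nodes the search reaches. -/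

/-- The search reaches the edge set `D` with move number `i`. -/
def Visits (σ : St) (D : ℕ → ℕ → Prop) (i : ℕ) : Prop :=
  ∃ k, (∀ j < k, ¬ (σ.walk j).IsLast) ∧ (σ.walk k).cur = D ∧ (σ.walk k).idx = i

theorem visits_step {k : ℕ} (h : ∀ j < k, ¬ (σ.walk j).IsLast) (hl : ¬ (σ.walk k).IsLast)
    {D : ℕ → ℕ → Prop} {i : ℕ} (hn : (σ.walk k).next.cur = D ∧ (σ.walk k).next.idx = i) :
    σ.Visits D i := by
  refine ⟨k + 1, fun j hj => ?_, ?_⟩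
  · rcases Nat.lt_succ_iff_lt_or_eq.1 hj with hj | rfl
    exacts [h j hj, hl]
  · rwa [walk_succ]

/-- Every excursion into a child comes back with the next move number. The induction goes downward
on the rank, since children have larger rank; for r = 0 the rank of D is maximal and there is no
child. -/
theorem visits_all (r : ℕ) : ∀ D, rankBound σ.n ≤ r + EdgeDom.rank σ.n σ.root D →
    σ.Visits D 0 → ∀ i ≤ numMoves σ.n, σ.Visits D i := by
  induction r with
  | zero =>
    intro D hr h0 i
    induction i with
    | zero => exact fun _ => h0
    | succ i ih =>
      intro hi
      obtain ⟨k, hk, rfl, hki⟩ := ih (by omega)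
      obtain ⟨e1, e2, e3⟩ := σ.walk_const k
      have hlt : (σ.walk k).idx < numMoves (σ.walk k).n := by rw [e1]; omega
      have hl : ¬ (σ.walk k).IsLast := fun h => h.1 hlt
      by_cases hc : (σ.walk k).IsChild
      · exfalso
        rcases (σ.walk k).move_cases with h | h
        · have hr' := h.2.2.1
          have hr2 := rank_le σ.n σ.root (σ.walk k).look
          rw [show fwd (σ.walk k).n (σ.walk k).adj (σ.walk k).look (σ.walk k).move =
            (σ.walk k).cur from funext fun u => funext fun v => propext (hc.2.2.2 u v), e1, e3] at hr'
          omega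
        · have := hc.2.2.1
          omega
      · have := next_of_lt hc hlt
        rw [hki] at this
        exact visits_step hk hl this
  | succ r ihr =>
    intro D hr h0 i
    induction i with
    | zero => exact fun _ => h0
    | succ i ih =>
      intro hi
      obtain ⟨k, hk, rfl, hki⟩ := ih (by omega)
      obtain ⟨e1, e2, e3⟩ := σ.walk_const k
      have hlt : (σ.walk k).idx < numMoves (σ.walk k).n := by rw [e1]; omega
      have hl : ¬ (σ.walk k).IsLast := fun h => h.1 hlt
      by_cases hc : (σ.walk k).IsChild
      · have hfwd : fwd (σ.walk k).n (σ.walk k).adj (σ.walk k).look (σ.walk k).move =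
            (σ.walk k).cur := funext fun u => funext fun v => propext (hc.2.2.2 u v)
        have hmv : (σ.walk k).move < numMoves σ.n := by rw [hc.2.2.1, hki]; omega
        have hgood : GoodMove (σ.walk k).n (σ.walk k).adj (σ.walk k).root (σ.walk k).look
            (σ.walk k).move := by
          rcases (σ.walk k).move_cases with h | h
          · exact h.2
          · rw [h.1, e1] at hmv; omega
        have hr' := hgood.2.1
        rw [hfwd, e1, e3] at hr'
        obtain ⟨m, hm, hmc, hmi⟩ := ihr (σ.walk k).look (by omega)
          (visits_step hk hl (next_of_child hc)) (numMoves σ.n) le_rfl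
        obtain ⟨f1, f2, f3⟩ := σ.walk_const m
        have hnl : ¬ (σ.walk m).idx < numMoves (σ.walk m).n := by rw [f1]; omega
        -- The first good move depends on the child alone, so on leaving it the search recomputes
        -- the number under which the child was entered.
        have hmm : (σ.walk m).move = (σ.walk k).move := by
          unfold move
          rw [look_of_not_lt hnl, hmc, f1, f2, f3, e1, e2, e3]
        have hml : ¬ (σ.walk m).IsLast := fun h => h.2 (by rw [hmm, f1]; exact hmv)
        refine visits_step hm hml ?_
        have := next_of_not_lt hnl
        rw [hmm, f1, f2, hmc, hc.2.2.1, hki] at this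
        rw [e1, e2, hc.2.2.1, hki] at hfwd
        rwa [hfwd] at this
      · have := next_of_lt hc hlt
        rw [hki] at this
        exact visits_step hk hl this

/-- Induction on the rank: the parent is reached, by `visits_all` the first good move j of D is
tried there, and undoing j yields D, which passes the child test. -/
theorem visits_good (hv : σ.Valid) (hcur : σ.cur = σ.root) (hidx : σ.idx = 0) (r : ℕ) :
    ∀ D, EdgeDom.rank σ.n σ.root D < r → IsGood σ.adj D → σ.Visits D 0 := by
  induction r with
  | zero => exact fun D h => absurd h (Nat.not_lt_zero _)
  | succ r ih =>
    intro D hr hD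
    by_cases hroot : D = σ.root
    · exact ⟨0, by simp, hroot ▸ hcur, hidx⟩
    have hmove : firstMove σ.n σ.adj σ.root D < numMoves σ.n ∧
        GoodMove σ.n σ.adj σ.root D (firstMove σ.n σ.adj σ.root D) := by
      rcases firstMove_cases σ.n σ.adj σ.root D with h | h
      · exact h
      · obtain ⟨j, hj, hg⟩ := exists_goodMove hv.graph hv.root hv.matching hD hroot
        exact absurd hg (h.2 j hj)
    set j := firstMove σ.n σ.adj σ.root D with hj
    obtain ⟨hlt, hgood⟩ := hmove
    obtain ⟨k, hk, hkc, hki⟩ := visits_all (rankBound σ.n) _ (by omega)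
      (ih (fwd σ.n σ.adj D j) (by have := hgood.2.1; omega) hgood.1) j hlt.le
    obtain ⟨e1, e2, e3⟩ := σ.walk_const k
    have hlt' : (σ.walk k).idx < numMoves (σ.walk k).n := by rw [e1, hki]; exact hlt
    have hlook : (σ.walk k).look = D := by
      rw [look_of_lt hlt', e1, e2, hkc, hki]
      exact funext fun u => funext fun v => propext (hgood.2.2 u v)
    have hm : (σ.walk k).move = j := by
      unfold move
      rw [hlook, e1, e2, e3]
    have hc : (σ.walk k).IsChild := by
      refine ⟨hlt', by rwa [hlook, e2], by rw [hm, hki], fun u v => ?_⟩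
      rw [hm, hlook, e1, e2, hkc]
    have := next_of_child hc
    rw [hlook] at this
    exact visits_step hk (fun h => h.1 hlt') this

/-- By `visits_all` the search is at some time at the root with all moves tried, and the root has no
good move to leave by. -/
theorem exists_last (hv : σ.Valid) (hcur : σ.cur = σ.root) (hidx : σ.idx = 0) :
    ∃ K, (∀ j < K, ¬ (σ.walk j).IsLast) ∧ (σ.walk K).IsLast := by
  obtain ⟨k, hk, hkc, hki⟩ := visits_all (rankBound σ.n) σ.root (by omega)
    ⟨0, by simp, hcur, hidx⟩ (numMoves σ.n) le_rfl
  obtain ⟨e1, e2, e3⟩ := σ.walk_const k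
  refine ⟨k, hk, by rw [hki, e1]; omega, ?_⟩
  rcases (σ.walk k).move_cases with h | h
  · have hn : ¬ (σ.walk k).idx < numMoves (σ.walk k).n := by rw [hki, e1]; omega
    have := h.2
    rw [look_of_not_lt hn, e3, hkc] at this
    exact absurd this (not_goodMove_root hv.matching _)
  · omega

/-! ### The list of the edge sets found. -/

open Classical in
/-- The edge sets found in the first `k` steps. -/
noncomputable def found (σ : St) (k : ℕ) : List (ℕ → ℕ → Prop) :=
  (List.range k).flatMap fun j => if (σ.walk j).IsChild then [(σ.walk j).look] else []

theorem mem_found {k : ℕ} {D : ℕ → ℕ → Prop} :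
    D ∈ σ.found k ↔ ∃ j < k, (σ.walk j).IsChild ∧ (σ.walk j).look = D := by
  unfold found
  rw [List.mem_flatMap]
  refine exists_congr fun j => and_congr (by simp) ?_
  split <;> simp_all [eq_comm]

/-- If one set were found in steps j < l, the states after these steps would coincide, both having
that set as current one and move number 0. The last state would then also be reached l - j steps
before step K. -/
theorem nodup_found {K : ℕ} (hK : ∀ j < K, ¬ (σ.walk j).IsLast)
    (hlast : (σ.walk K).IsLast) : (σ.found K).Nodup := by
  classical
  unfold found
  rw [List.nodup_flatMap]
  refine ⟨fun j _ => by split <;> simp, ?_⟩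
  refine List.Pairwise.imp_of_mem ?_ (List.pairwise_lt_range (n := K))
  intro j l hj hl hjl
  rw [List.mem_range] at hj hl
  simp only [Function.onFun]
  split
  swap
  · simp
  split
  swap
  · simp
  rename_i h1 h2
  simp only [List.disjoint_singleton]
  intro h
  rw [List.mem_singleton] at h
  have hnext : σ.walk (j + 1) = σ.walk (l + 1) := by
    have c1 := σ.walk_const (j + 1)
    have c2 := σ.walk_const (l + 1)
    have n1 := next_of_child h1
    have n2 := next_of_child h2
    rw [← walk_succ] at n1 n2
    ext1
    · rw [c1.1, c2.1]
    · rw [c1.2.1, c2.2.1]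
    · rw [n1.1, n2.1, h]
    · rw [c1.2.2, c2.2.2]
    · rw [n1.2, n2.2]
  have e1 : σ.walk (K - (l + 1) + (j + 1)) = σ.walk K := by
    rw [walk_add, hnext, ← walk_add, Nat.sub_add_cancel hl]
  exact hK _ (by omega) (e1 ▸ hlast)

/-- Only a child step sets the move number to 0, so arriving with number 0 at a positive time is a
discovery. The root is never found, because a child has a good move and the root has none. -/
theorem mem_found_iff (hv : σ.Valid) (hcur : σ.cur = σ.root) (hidx : σ.idx = 0) {K : ℕ}
    (hlast : (σ.walk K).IsLast) (D : ℕ → ℕ → Prop) :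
    D ∈ σ.found K ↔ IsGood σ.adj D ∧ D ≠ σ.root := by
  rw [mem_found]
  constructor
  · rintro ⟨j, hj, hc, rfl⟩
    obtain ⟨e1, e2, e3⟩ := σ.walk_const j
    refine ⟨e2 ▸ hc.2.1, fun h => ?_⟩
    rcases (σ.walk j).move_cases with h' | h'
    · have := h'.2
      rw [h, e3] at this
      exact not_goodMove_root hv.matching _ this
    · have := hc.1
      have := hc.2.2.1
      omega
  · rintro ⟨hD, hne⟩
    obtain ⟨k, hk, hkc, hki⟩ := visits_good hv hcur hidx _ D (Nat.lt_succ_self _) hD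
    have hkK : k ≤ K := by
      by_contra h
      exact hk K (by omega) hlast
    cases k with
    | zero => exact absurd (hkc.symm.trans hcur) hne
    | succ k =>
      rw [walk_succ] at hkc hki
      have hc : (σ.walk k).IsChild := by
        by_contra hc
        by_cases hi : (σ.walk k).idx < numMoves (σ.walk k).n
        · rw [(next_of_lt hc hi).2] at hki; omega
        · rw [(next_of_not_lt hi).2] at hki; omega
      exact ⟨k, by omega, hc, by rw [← (next_of_child hc).1, hkc]⟩

/-- Within the gap bound, the search finds a new edge set or ends. -/
theorem exists_child {k K : ℕ} (hK : ∀ j < K, ¬ (σ.walk j).IsLast)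
    (hk : k + (gapBound σ.n + 1) ≤ K) :
    ∃ j, k ≤ j ∧ j < k + (gapBound σ.n + 1) ∧ (σ.walk j).IsChild := by
  by_contra hcon
  push Not at hcon
  have key : ∀ m ≤ gapBound σ.n + 1, (σ.walk (k + m)).potential + m ≤ gapBound σ.n := by
    intro m
    induction m with
    | zero =>
      intro _
      have := (σ.walk k).potential_le
      rwa [(σ.walk_const k).1] at this
    | succ m ih =>
      intro hm
      have h1 := ih (by omega)
      have h2 := potential_next_lt (hK _ (by omega)) (hcon (k + m) (by omega) (by omega))
      rw [← walk_succ] at h2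
      have : k + (m + 1) = k + m + 1 := rfl
      rw [this]
      omega
  have := key (gapBound σ.n + 1) le_rfl
  omega

end St

end RamWhile

namespace RamWhile

/-! ### Growth of the memory -/

/-- The size of an expression. -/
def Expr.sz : Expr → ℕ
  | const k => k + 1
  | cell a i j => a + i.sz + j.sz + 1
  | add e f => e.sz + f.sz + 1
  | sub e f => e.sz + f.sz + 1
  | lt e f => e.sz + f.sz + 1
  | eq e f => e.sz + f.sz + 1

/-- The size of a command. -/
def Cmd.sz : Cmd → ℕ
  | skip => 1
  | assign a i j e => a + i.sz + j.sz + e.sz + 1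
  | write e => e.sz + 1
  | emit => 1
  | seq c d => c.sz + d.sz + 1
  | cond e c d => e.sz + c.sz + d.sz + 1
  | loop e c => e.sz + c.sz + 1

/-- At most `m` cells are in use, with addresses and contents below `2 ^ b`. -/
def Small (b m : ℕ) (s : Store) : Prop :=
  (∀ p, s p ≠ 0 → p.1 < 2 ^ b ∧ p.2.1 < 2 ^ b ∧ p.2.2 < 2 ^ b ∧ s p < 2 ^ b) ∧ s.support.card ≤ m

theorem Small.lt {b m : ℕ} {s : Store} (h : Small b m s) (p : ℕ × ℕ × ℕ) : s p < 2 ^ b := by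
  by_cases hp : s p = 0
  · rw [hp]; positivity
  · exact (h.1 p hp).2.2.2

theorem Small.mono {b b' m m' : ℕ} {s : Store} (h : Small b m s) (hb : b ≤ b') (hm : m ≤ m') :
    Small b' m' s := by
  have h2 : 2 ^ b ≤ 2 ^ b' := Nat.pow_le_pow_right (by omega) hb
  refine ⟨fun p hp => ?_, h.2.trans hm⟩
  obtain ⟨h1, h3, h4, h5⟩ := h.1 p hp
  exact ⟨h1.trans_le h2, h3.trans_le h2, h4.trans_le h2, h5.trans_le h2⟩

/-- Without multiplication each operation adds at most one bit to the longer operand, so the growth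
is bounded by the size of the program text. -/
theorem Small.eval_lt {b m : ℕ} {s : Store} (h : Small b m s) (e : Expr) :
    e.eval s < 2 ^ (b + e.sz) := by
  have hmono : ∀ {x y : ℕ}, x ≤ y → 2 ^ x ≤ 2 ^ y := fun h => Nat.pow_le_pow_right (by omega) h
  have hone : ∀ x : ℕ, 1 < 2 ^ (x + 1) := fun x => by
    have := Nat.one_le_two_pow (n := x)
    rw [pow_succ]; omega
  induction e with
  | const k =>
    have h1 : k < 2 ^ k := Nat.lt_two_pow_self
    exact h1.trans_le (hmono (by simp only [Expr.sz]; omega))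
  | cell a i j _ _ => exact (h.lt _).trans_le (hmono (by simp only [Expr.sz]; omega))
  | add e f he hf =>
    have h1 := hmono (x := b + e.sz) (y := b + e.sz + f.sz) (by omega)
    have h2 := hmono (x := b + f.sz) (y := b + e.sz + f.sz) (by omega)
    have h3 : 2 ^ (b + (e.sz + f.sz + 1)) = 2 ^ (b + e.sz + f.sz) * 2 := by
      rw [← pow_succ]; ring_nf
    simp only [Expr.sz, Expr.eval, h3]
    omega
  | sub e f he hf =>
    have h1 := hmono (x := b + e.sz) (y := b + (e.sz + f.sz + 1)) (by omega)
    simp only [Expr.sz, Expr.eval]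
    omega
  | lt e f _ _ =>
    have := hone (b + (e.sz + f.sz))
    simp only [Expr.sz, Expr.eval]
    rw [← add_assoc]
    split <;> omega
  | eq e f _ _ =>
    have := hone (b + (e.sz + f.sz))
    simp only [Expr.sz, Expr.eval]
    rw [← add_assoc]
    split <;> omega

theorem Small.update {b b' m : ℕ} {s : Store} (h : Small b m s) (hb : b ≤ b') {a i j v : ℕ}
    (ha : a < 2 ^ b') (hi : i < 2 ^ b') (hj : j < 2 ^ b') (hv : v < 2 ^ b') :
    Small b' (m + 1) (s.update (a, i, j) v) := by
  classical
  constructor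
  · intro p hp
    rw [Finsupp.coe_update] at hp ⊢
    by_cases hpe : p = (a, i, j)
    · subst hpe
      rw [Function.update_self]
      exact ⟨ha, hi, hj, hv⟩
    · rw [Function.update_of_ne hpe] at hp ⊢
      exact (h.mono hb le_rfl).1 p hp
  · have : (s.update (a, i, j) v).support ⊆ insert (a, i, j) s.support := by
      intro p hp
      rw [Finsupp.mem_support_iff, Finsupp.coe_update] at hp
      rw [Finset.mem_insert, Finsupp.mem_support_iff]
      by_cases hpe : p = (a, i, j)
      · exact Or.inl hpe
      · rw [Function.update_of_ne hpe] at hp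
        exact Or.inr hp
    calc _ ≤ _ := Finset.card_le_card this
      _ ≤ s.support.card + 1 := Finset.card_insert_le _ _
      _ ≤ m + 1 := Nat.add_le_add_right h.2 1

theorem small_step {C b m : ℕ} {x : Config} (hC : ∀ c ∈ x.todo, c.sz ≤ C) (h : Small b m x.store) :
    (∀ c ∈ (step x).todo, c.sz ≤ C) ∧ Small (b + C) (m + 1) (step x).store := by
  obtain ⟨todo, s, tape⟩ := x
  have h' : Small (b + C) (m + 1) s := h.mono (by omega) (by omega)
  cases todo with
  | nil => exact ⟨by simp [step], h'⟩
  | cons c k =>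
    have hc : c.sz ≤ C := hC c (by simp)
    have hk : ∀ d ∈ k, d.sz ≤ C := fun d hd => hC d (by simp [hd])
    cases c with
    | skip => exact ⟨hk, h'⟩
    | assign a i j e =>
      refine ⟨hk, ?_⟩
      simp only [Cmd.sz] at hc
      have hmono : ∀ {x y : ℕ}, x ≤ y → 2 ^ x ≤ 2 ^ y := fun h => Nat.pow_le_pow_right (by omega) h
      refine Small.update h (by omega) ?_ ((h.eval_lt i).trans_le (hmono (by omega)))
        ((h.eval_lt j).trans_le (hmono (by omega))) ((h.eval_lt e).trans_le (hmono (by omega)))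
      exact (Nat.lt_two_pow_self (n := a)).trans_le (hmono (by omega))
    | write e => exact ⟨hk, h'⟩
    | emit => exact ⟨hk, h'⟩
    | seq c d =>
      simp only [Cmd.sz] at hc
      refine ⟨fun e he => ?_, h'⟩
      simp only [step, List.mem_cons] at he
      rcases he with rfl | rfl | he
      exacts [by omega, by omega, hk e he]
    | cond e c d =>
      simp only [Cmd.sz] at hc
      refine ⟨fun f hf => ?_, h'⟩
      simp only [step, List.mem_cons] at hf
      rcases hf with rfl | hf
      · split <;> omega
      · exact hk f hf
    | loop e c =>
      simp only [step]
      refine ⟨fun f hf => ?_, h'⟩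
      split at hf
      · simp only [List.mem_cons] at hf
        rcases hf with rfl | rfl | hf
        exacts [by simp only [Cmd.sz] at hc; omega, hc, hk f hf]
      · exact hk f hf

/-- Linear growth per time unit: a memory bound at checkpoints that are polynomially close in time
yields one at every moment. -/
theorem small_iterate {C b m : ℕ} {x : Config} (hC : ∀ c ∈ x.todo, c.sz ≤ C)
    (h : Small b m x.store) (t : ℕ) :
    (∀ c ∈ (step^[t] x).todo, c.sz ≤ C) ∧ Small (b + t * C) (m + t) (step^[t] x).store := by
  induction t with
  | zero => exact ⟨hC, by simpa using h⟩
  | succ t ih =>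
    rw [Function.iterate_succ_apply']
    have := small_step ih.1 ih.2
    exact ⟨this.1, this.2.mono (by rw [Nat.add_mul]; omega) (by omega)⟩

theorem space_le {b m : ℕ} {x : Config} (h : Small b m x.store) : x.space ≤ m * (4 * b) := by
  unfold Config.space Finsupp.sum
  calc _ ≤ x.store.support.card • (4 * b) := by
        refine Finset.sum_le_card_nsmul _ _ _ fun p hp => ?_
        obtain ⟨h1, h2, h3, h4⟩ := h.1 p (Finsupp.mem_support_iff.1 hp)
        have := Nat.size_le.2 h1
        have := Nat.size_le.2 h2
        have := Nat.size_le.2 h3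
        have := Nat.size_le.2 h4
        show p.1.size + p.2.1.size + p.2.2.size + (x.store p).size ≤ 4 * b
        omega
    _ ≤ m * (4 * b) := by rw [smul_eq_mul]; exact Nat.mul_le_mul h.2 le_rfl

/-! ### Enumeration in segments -/

theorem numOutputs_le_step (x : Config) : x.numOutputs ≤ (step x).numOutputs := by
  obtain ⟨todo, s, tape⟩ := x
  unfold Config.numOutputs
  cases todo with
  | nil => simp [step]
  | cons c k => cases c <;> simp [step]

theorem numOutputs_le_iterate (x : Config) (t : ℕ) : x.numOutputs ≤ (step^[t] x).numOutputs := by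
  induction t with
  | zero => exact le_rfl
  | succ t ih => rw [Function.iterate_succ_apply']; exact ih.trans (numOutputs_le_step _)

theorem iterate_of_halted {x : Config} (h : x.Halted) (t : ℕ) : step^[t] x = x := by
  induction t with
  | zero => rfl
  | succ t ih =>
    rw [Function.iterate_succ_apply', ih]
    unfold Config.Halted at h
    unfold step
    rw [h]

theorem run_add (c : Cmd) (s : Store) (t t' : ℕ) : run c s (t + t') = step^[t'] (run c s t) := by
  unfold run
  rw [Nat.add_comm, Function.iterate_add_apply]

theorem count_words (ws : List (List ℕ)) :
    (ws.flatMap (fun w => w.map some ++ [none])).count none = ws.length := by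
  induction ws with
  | nil => rfl
  | cons w ws ih =>
    have : (w.map some).count none = 0 := List.count_eq_zero.2 (by simp)
    rw [List.flatMap_cons, List.count_append, List.count_append, ih, this]
    simp
    omega

/-- The checkpoint x k is reached at time θ k. From a checkpoint with at least j outputs, output
number j, or termination, comes within G segments (`hbound`). Output number j is completed less than
T before or exactly at some checkpoint, and from there the next event takes at most T G; this gives
the delay T (G + 1). -/
theorem enumerates_of_segments {c : Cmd} {s : Store} {ws : List (List ℕ)} {T G S K : ℕ}
    (x : ℕ → Config) (hx₀ : x 0 = ⟨[c], s, []⟩)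
    (hstep : ∀ k < K, ∃ t ≤ T, step^[t] (x k) = x (k + 1)) (hhalt : (x K).Halted)
    (htape : (x K).tape = ws.flatMap (fun w => w.map some ++ [none]))
    (hgap : ∀ k, k + G ≤ K → (x k).numOutputs < (x (k + G)).numOutputs)
    (hspace : ∀ k ≤ K, ∀ t ≤ T, (step^[t] (x k)).space ≤ S) :
    Enumerates c s ws (T * G) (T * (G + 1)) S := by
  classical
  choose! t ht htx using hstep
  set θ : ℕ → ℕ := fun k => ∑ i ∈ Finset.range k, t i with hθ
  have hθs : ∀ k, θ (k + 1) = θ k + t k := fun k => Finset.sum_range_succ _ _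
  have hrun : ∀ k ≤ K, run c s (θ k) = x k := by
    intro k
    induction k with
    | zero => intro _; rw [hx₀]; rfl
    | succ k ih =>
      intro hk
      rw [hθs, run_add, ih (by omega), htx k (by omega)]
  have hθd : ∀ k d, k + d ≤ K → θ (k + d) ≤ θ k + T * d := by
    intro k d
    induction d with
    | zero => intro _; simp
    | succ d ih =>
      intro hd
      have h1 := ih (by omega)
      have h2 := ht (k + d) (by omega)
      rw [← add_assoc, hθs, Nat.mul_add]
      omega
  have hmono : ∀ t t', t ≤ t' → (run c s t).numOutputs ≤ (run c s t').numOutputs := by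
    intro t t' h
    obtain ⟨d, rfl⟩ := Nat.exists_eq_add_of_le h
    rw [run_add]
    exact numOutputs_le_iterate _ _
  have hlen : (x K).numOutputs = ws.length := by
    unfold Config.numOutputs
    rw [htape, count_words]
  have hle : ∀ k ≤ K, (x k).numOutputs ≤ ws.length := by
    intro k hk
    have : θ k ≤ θ K := Finset.sum_le_sum_of_subset (Finset.range_mono hk)
    rw [← hlen, ← hrun k hk, ← hrun K le_rfl]
    exact hmono _ _ this
  have hx0 : (x 0).numOutputs = 0 := by rw [hx₀]; rfl
  have hexh : ∃ t, (run c s t).Halted := ⟨θ K, by rw [hrun K le_rfl]; exact hhalt⟩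
  have hexo : ∀ j, j < ws.length → ∃ t, j < (run c s t).numOutputs := fun j hj =>
    ⟨θ K, by rw [hrun K le_rfl, hlen]; exact hj⟩
  have hafter : ∀ t t', t ≤ t' → (run c s t).Halted → run c s t' = run c s t := by
    intro t t' h hh
    obtain ⟨d, rfl⟩ := Nat.exists_eq_add_of_le h
    rw [run_add, iterate_of_halted hh]
  set τ : ℕ → ℕ := fun j => if h : j < ws.length then Nat.find (hexo j h) else Nat.find hexh with hτ
  have hτo : ∀ j, j < ws.length → ∀ t, j < (run c s t).numOutputs ↔ τ j ≤ t := by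
    intro j hj t
    simp only [hτ, dif_pos hj]
    refine ⟨fun h => Nat.find_min' _ h, fun h => ?_⟩
    exact (Nat.find_spec (hexo j hj)).trans_le (hmono _ _ h)
  have hτh : ∀ t, (run c s t).Halted ↔ τ ws.length ≤ t := by
    intro t
    simp only [hτ, dif_neg (lt_irrefl _)]
    refine ⟨fun h => Nat.find_min' _ h, fun h => ?_⟩
    rw [hafter _ _ h (Nat.find_spec hexh)]
    exact Nat.find_spec hexh
  have hbound : ∀ j k, j ≤ ws.length → k ≤ K → j ≤ (x k).numOutputs →
      τ j ≤ θ k + T * G := by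
    intro j k hj hk hjk
    by_cases hkG : k + G ≤ K
    · have h1 := hgap k hkG
      have h2 := hle _ hkG
      have h3 : τ j ≤ θ (k + G) := by
        rw [← hτo j (by omega), hrun _ hkG]
        omega
      exact h3.trans (hθd k G hkG)
    · have h3 : τ j ≤ θ K := by
        rcases hj.lt_or_eq with hj | rfl
        · rw [← hτo j hj, hrun _ le_rfl, hlen]
          exact hj
        · rw [← hτh, hrun _ le_rfl]
          exact hhalt
      obtain ⟨d, rfl⟩ := Nat.exists_eq_add_of_le hk
      have h4 := hθd k d le_rfl
      have h5 : T * d ≤ T * G := Nat.mul_le_mul le_rfl (by omega)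
      omega
  refine ⟨τ, hτo, hτh, ?_, ?_, ?_, ?_⟩
  · have h1 := (hτh (τ ws.length)).2 le_rfl
    have h2 : τ ws.length ≤ θ K := (hτh _).1 (by rw [hrun K le_rfl]; exact hhalt)
    rw [← hafter _ _ h2 h1, hrun K le_rfl, htape]
  · have := hbound 0 0 (Nat.zero_le _) (Nat.zero_le _) (Nat.zero_le _)
    simpa [hθ] using this
  · intro j hj
    have hex : ∃ k, k ≤ K ∧ τ j ≤ θ k :=
      ⟨K, le_rfl, by rw [← hτo j hj, hrun K le_rfl, hlen]; exact hj⟩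
    obtain ⟨h1, h2⟩ := Nat.find_spec hex
    rcases hfe : Nat.find hex with _ | m
    · rw [hfe] at h2
      rw [← hτo j hj, hrun 0 (Nat.zero_le _), hx0] at h2
      exact absurd h2 (Nat.not_lt_zero _)
    · have h3 : ¬ (m ≤ K ∧ τ j ≤ θ m) := Nat.find_min hex (by omega)
      rw [hfe] at h1 h2
      have h4 := hθs m
      have h5 := ht m (by omega)
      have h6 : θ m < τ j := by
        by_contra h
        exact h3 ⟨by omega, by omega⟩
      have h7 := hbound (j + 1) (m + 1) hj h1 (by
        rw [← hτo j hj, hrun _ h1] at h2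
        exact h2)
      rw [Nat.mul_add]
      omega
  · intro t'
    by_cases h : θ K ≤ t'
    · rw [hafter _ _ h (by rw [hrun K le_rfl]; exact hhalt), hrun K le_rfl]
      exact hspace K le_rfl 0 (Nat.zero_le _)
    · have hex : ∃ k, k ≤ K ∧ t' < θ k := ⟨K, le_rfl, by omega⟩
      obtain ⟨h1, h2⟩ := Nat.find_spec hex
      rcases hfe : Nat.find hex with _ | m
      · rw [hfe] at h2
        exact absurd h2 (by simp [hθ])
      · have h3 : ¬ (m ≤ K ∧ t' < θ m) := Nat.find_min hex (by omega)
        rw [hfe] at h1 h2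
        have h4 := hθs m
        have h5 := ht m (by omega)
        have h6 : θ m ≤ t' := by
          by_contra h
          exact h3 ⟨by omega, by omega⟩
        obtain ⟨d, rfl⟩ := Nat.exists_eq_add_of_le h6
        rw [run_add, hrun m (by omega)]
        exact hspace m (by omega) d (by omega)

theorem Enumerates.mono {c : Cmd} {s : Store} {ws : List (List ℕ)} {p p' d d' r r' : ℕ}
    (h : Enumerates c s ws p d r) (hp : p ≤ p') (hd : d ≤ d') (hr : r ≤ r') :
    Enumerates c s ws p' d' r' := by
  obtain ⟨τ, h1, h2, h3, h4, h5, h6⟩ := h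
  exact ⟨τ, h1, h2, h3, h4.trans hp, fun j hj => (h5 j hj).trans (Nat.add_le_add_left hd _),
    fun t => (h6 t).trans hr⟩

end RamWhile

namespace RamWhile

/-! ### Enumeration by a loop -/

/-- The checkpoints are the start, the m + 1 evaluations of the loop test, and the halted
configuration, so there are m + 2 segments. The memory has to be small only at the tests; the growth
within a segment is added afterwards. -/
theorem enumerates_loop {setup body : Cmd} {e : Expr} {s₀ : Store} (I : ℕ → Store → Prop)
    {m T b M G : ℕ} {w : List (Option ℕ)} {o : ℕ → List (Option ℕ)} {ws : List (List ℕ)}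
    (hsetup : Runs setup s₀ w T (I 0))
    (hbody : ∀ k < m, ∀ s, I k s → e.eval s ≠ 0 ∧ Runs body s (o k) T (I (k + 1)))
    (hm : ∀ s, I m s → e.eval s = 0) (hs₀ : Small b M s₀)
    (hI : ∀ k ≤ m, ∀ s, I k s → Small b M s)
    (htape : w ++ (List.range m).flatMap o = ws.flatMap (fun w => w.map some ++ [none]))
    (hw : none ∈ w) (hgap : ∀ k, k + G ≤ m → ∃ j, k ≤ j ∧ j < k + G ∧ none ∈ o j) :
    Enumerates (.seq setup (.loop e body)) s₀ ws ((T + 1) * (G + 2)) ((T + 1) * (G + 2 + 1))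
      ((M + (T + 1)) * (4 * (b + (T + 1) * (Cmd.seq setup (.loop e body)).sz))) := by
  obtain ⟨s₁, t₀, ht₀, hx₀, hs₁⟩ := hsetup
  have hex : ∀ k s, ∃ s' : Store, k < m → I k s → ∃ t ≤ T, Exec body s s' (o k) t ∧ I (k + 1) s' := by
    intro k s
    by_cases h : k < m ∧ I k s
    · obtain ⟨s', t, ht, hx, hq⟩ := (hbody k h.1 s h.2).2
      exact ⟨s', fun _ _ => ⟨t, ht, hx, hq⟩⟩
    · exact ⟨s, fun h1 h2 => absurd ⟨h1, h2⟩ h⟩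
  choose f hf using hex
  set S : ℕ → Store := fun k => Nat.rec s₁ f k with hS
  have hSI : ∀ k ≤ m, I k (S k) := by
    intro k
    induction k with
    | zero => exact fun _ => hs₁
    | succ k ih =>
      intro hk
      obtain ⟨t, -, -, hq⟩ := hf k (S k) (by omega) (ih (by omega))
      exact hq
  set tp : ℕ → List (Option ℕ) := fun k => w ++ (List.range k).flatMap o with htp
  have htps : ∀ k, tp (k + 1) = tp k ++ o k := fun k => by
    simp [htp, List.range_succ]
  set x : ℕ → Config := fun k => match k with
    | 0 => ⟨[.seq setup (.loop e body)], s₀, []⟩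
    | k + 1 => if k ≤ m then ⟨[.loop e body], S k, tp k⟩ else ⟨[], S m, tp m⟩ with hx
  have hx1 : ∀ k ≤ m, x (k + 1) = ⟨[.loop e body], S k, tp k⟩ := fun k hk => by
    simp only [hx, if_pos hk]
  have hx2 : x (m + 2) = ⟨[], S m, tp m⟩ := by
    simp only [hx, if_neg (by omega : ¬ m + 1 ≤ m)]
  have hstep : ∀ k < m + 2, ∃ t ≤ T + 1, step^[t] (x k) = x (k + 1) := by
    intro k hk
    cases k with
    | zero =>
      refine ⟨t₀ + 1, by omega, ?_⟩
      rw [hx1 0 (Nat.zero_le _), Function.iterate_add_apply]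
      have : step^[1] (x 0) = ⟨[setup, .loop e body], s₀, []⟩ := by simp [hx, step]
      rw [this, hx₀]
      simp [htp, hS]
    | succ k =>
      rw [hx1 k (by omega)]
      by_cases hkm : k = m
      · subst hkm
        refine ⟨1, by omega, ?_⟩
        rw [hx2]
        simp [step, hm _ (hSI k le_rfl)]
      · obtain ⟨t, ht, hex, hq⟩ := hf k (S k) (by omega) (hSI k (by omega))
        have he := (hbody k (by omega) _ (hSI k (by omega))).1
        refine ⟨t + 1, by omega, ?_⟩
        rw [hx1 (k + 1) (by omega), Function.iterate_add_apply]
        have : step^[1] ⟨[.loop e body], S k, tp k⟩ = ⟨[body, .loop e body], S k, tp k⟩ := by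
          simp [step, he]
        rw [this, hex, htps]
  have hmono : ∀ k d, k + d ≤ m + 2 → (x k).numOutputs ≤ (x (k + d)).numOutputs := by
    intro k d
    induction d with
    | zero => exact fun _ => le_rfl
    | succ d ih =>
      intro hd
      refine (ih (by omega)).trans ?_
      obtain ⟨t, -, ht⟩ := hstep (k + d) (by omega)
      rw [← add_assoc, ← ht]
      exact numOutputs_le_iterate _ _
  have hpos : ∀ l : List (Option ℕ), none ∈ l → 0 < l.count none := fun l h => List.count_pos_iff.2 h
  refine enumerates_of_segments (K := m + 2) x rfl hstep (by rw [hx2]; rfl)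
    (by rw [hx2]; exact htape) (fun k hk => ?_) (fun k hk t ht => ?_)
  · cases k with
    | zero =>
      refine lt_of_lt_of_le ?_ (hmono 1 (G + 1) (by omega) |>.trans_eq
        (by rw [show 1 + (G + 1) = 0 + (G + 2) by omega]))
      rw [hx1 0 (Nat.zero_le _)]
      simpa [hx, Config.numOutputs, htp] using hw
    | succ k =>
      obtain ⟨j, hj1, hj2, hj3⟩ := hgap k (by omega)
      have h1 := hmono (k + 1) (j - k) (by omega)
      have h2 := hmono (j + 1 + 1) (k + (G + 2) - (j + 1)) (by omega)
      rw [show k + 1 + (j - k) = j + 1 by omega] at h1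
      rw [show j + 1 + 1 + (k + (G + 2) - (j + 1)) = k + 1 + (G + 2) by omega] at h2
      refine lt_of_le_of_lt h1 (lt_of_lt_of_le ?_ h2)
      rw [hx1 j (by omega), hx1 (j + 1) (by omega)]
      simp only [Config.numOutputs, htps, List.count_append]
      have := hpos _ hj3
      omega
  · have hsm : (∀ c ∈ (x k).todo, c.sz ≤ (Cmd.seq setup (.loop e body)).sz) ∧
        Small b M (x k).store := by
      cases k with
      | zero => exact ⟨by simp [hx], hs₀⟩
      | succ k =>
        by_cases hkm : k ≤ m
        · rw [hx1 k hkm]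
          refine ⟨?_, hI k hkm _ (hSI k hkm)⟩
          simp only [List.mem_singleton, forall_eq, Cmd.sz]
          omega
        · obtain rfl : k = m + 1 := by omega
          rw [hx2]
          exact ⟨by simp, hI m le_rfl _ (hSI m le_rfl)⟩
    have := (small_iterate hsm.1 hsm.2 t).2
    refine space_le (this.mono (b' := b + (T + 1) * _) (m' := M + (T + 1)) ?_ (by omega))
    exact Nat.add_le_add_left (Nat.mul_le_mul ht le_rfl) _

/-! ### Loops over pairs of vertices -/

/-- Run `c` for all values `0, …, n - 1` of register `r`, where `n` is in cell `(0, 0, 0)`. -/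
def forN (r : ℕ) (c : Cmd) : Cmd :=
  .seq (setReg r (.const 0)) (.loop (.lt (reg r) (.cell 0 (.const 0) (.const 0)))
    (.seq c (setReg r (.add (reg r) (.const 1)))))

theorem runs_forN {r n T : ℕ} {c : Cmd} (I : ℕ → Store → Prop) (o : ℕ → List (Option ℕ))
    (hn : ∀ k s, I k s → s (0, 0, 0) = n)
    (hI : ∀ k s v, I k s → I k (s.update (10, r, 0) v))
    (h : ∀ k < n, ∀ s, I k s → s (10, r, 0) = k →
      Runs c s (o k) T (fun s' => I (k + 1) s' ∧ s' (10, r, 0) = k)) {s : Store} (h₀ : I 0 s) :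
    Runs (forN r c) s ((List.range n).flatMap o) (n * (T + 3) + 3) (I n) := by
  refine ((runs_setReg (Q := fun s' => I 0 s' ∧ s' (10, r, 0) = 0)
    ⟨hI _ _ _ h₀, update_reg_self _ _ _⟩).seq_nil fun s' hs' =>
    (runs_loop (m := n) (T := T + 1 + 1) (fun k s => I k s ∧ s (10, r, 0) = k) o ?_ ?_ hs').mono
      le_rfl fun _ h => h.1).mono ?_ fun _ h => h
  · rintro k hk s₁ ⟨h1, h2⟩
    refine ⟨by simp [Expr.eval, hn k s₁ h1, h2, hk], ?_⟩
    have := (h k hk s₁ h1 h2).seq (o₂ := []) (T₂ := 1)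
      (Q₂ := fun s => I (k + 1) s ∧ s (10, r, 0) = k + 1)
      (d := setReg r (.add (reg r) (.const 1))) fun s₂ hs₂ => runs_setReg
        ⟨hI _ _ _ hs₂.1, by rw [update_reg_self]; simp [Expr.eval, hs₂.2]⟩
    simpa using this
  · rintro s₁ ⟨h1, h2⟩
    simp [Expr.eval, hn n s₁ h1, h2]
  · rw [show T + 1 + 1 + 1 = T + 3 from rfl]
    omega

/-- The memories `s` and `s'` agree outside the registers `0, …, h - 1`. -/
abbrev Agree (h : ℕ) (s s' : Store) : Prop := Frame 0 h s s'

theorem Agree.reads {h : ℕ} {s s' : Store} {σ : St} (hs : Agree h s s') (hr : Reads s σ) :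
    Reads s' σ := fun a ha i j => by rw [hs a i j (by omega), hr a ha]

/-- Run `c` for all pairs of values `0, …, n - 1` of the registers `0` and `1`. -/
def grid (c : Cmd) : Cmd := forN 0 (forN 1 c)

/-- The invariant I u v belongs to position (u, v) of a row by row scan; `hrow` identifies the end
of a row with the start of the next. -/
theorem runs_grid {n T h : ℕ} {c : Cmd} {s : Store} (I : ℕ → ℕ → Store → Prop)
    (o : ℕ → ℕ → List (Option ℕ)) (hn : ∀ u v s, I u v s → s (0, 0, 0) = n) (hh : 2 ≤ h)
    (hI : ∀ u v s s', I u v s → Agree h s s' → I u v s')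
    (hrow : ∀ u s, I u n s → I (u + 1) 0 s)
    (hc : ∀ u < n, ∀ v < n, ∀ s, I u v s → s (10, 0, 0) = u → s (10, 1, 0) = v →
      Runs c s (o u v) T (fun s' => I u (v + 1) s' ∧ s' (10, 0, 0) = u ∧ s' (10, 1, 0) = v))
    (h₀ : I 0 0 s) :
    Runs (grid c) s ((List.range n).flatMap fun u => (List.range n).flatMap (o u))
      (n * (n * (T + 3) + 6) + 3) (I n 0) := by
  have hup : ∀ u v s r w, r < 2 → I u v s → I u v (s.update (10, r, 0) w) := fun u v s r w hr hs =>
    hI u v s _ hs (frame_update _ _ (Nat.zero_le _) (by omega))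
  refine (runs_forN (T := n * (T + 3) + 3) (fun u s => I u 0 s) _ (fun u s hs => hn u 0 s hs)
    (fun u s w hs => hup u 0 s 0 w (by omega) hs) (fun u hu s₁ hs₁ hr => ?_) h₀).mono
    le_rfl fun _ h => h
  refine (runs_forN (T := T) (fun v s => I u v s ∧ s (10, 0, 0) = u) (o u)
    (fun v s hs => hn u v s hs.1) (fun v s w hs => ⟨hup u v s 1 w (by omega) hs.1, ?_⟩)
    (fun v hv s₂ hs₂ hr₂ => ?_) ⟨hs₁, hr⟩).mono le_rfl fun s' hs' => ⟨hrow u s' hs'.1, hs'.2⟩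
  · rw [update_reg_ne _ _ (by omega), hs.2]
  · exact (hc u hu v hv s₂ hs₂.1 hs₂.2 hr₂).mono le_rfl fun s' hs' => ⟨⟨hs'.1, hs'.2.1⟩, hs'.2.2⟩

open Classical in
/-- A command that stores `g u v` in the cells `(b, u, v)`. -/
theorem runs_grid_assign {n T h b : ℕ} {c : Cmd} {e : Expr} {s : Store} (g : ℕ → ℕ → ℕ)
    (hn : s (0, 0, 0) = n) (hb : b ≠ 0) (hb' : b ≠ 10) (hh : 2 ≤ h)
    (hc : ∀ u < n, ∀ v < n, ∀ s₁ : Store, s₁ (10, 0, 0) = u → s₁ (10, 1, 0) = v →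
      (∀ a i j, a ≠ b → ¬ (a = 10 ∧ 0 ≤ i ∧ i < 0 + h ∧ j = 0) → s₁ (a, i, j) = s (a, i, j)) →
      Runs c s₁ [] T (fun s₂ => e.eval s₂ = g u v ∧ Frame 2 (h - 2) s₁ s₂)) :
    Runs (grid (.seq c (.assign b (reg 0) (reg 1) e))) s [] (n * (n * (T + 5) + 6) + 3)
      (fun s' => ∀ a i j, ¬ (a = 10 ∧ 0 ≤ i ∧ i < 0 + h ∧ j = 0) →
        s' (a, i, j) = if a = b ∧ i < n ∧ j < n then g i j else s (a, i, j)) := by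
  have := runs_grid (n := n) (T := T + 1 + 1) (h := h) (s := s)
    (c := .seq c (.assign b (reg 0) (reg 1) e))
    -- Exactly the cells lexicographically before (u, v) already hold their new values.
    (fun u v s' => ∀ a i j, ¬ (a = 10 ∧ 0 ≤ i ∧ i < 0 + h ∧ j = 0) →
      s' (a, i, j) = if a = b ∧ i < n ∧ j < n ∧ (i < u ∨ (i = u ∧ j < v)) then g i j
        else s (a, i, j)) (fun _ _ => [])
    (fun u v s' hs' => by rw [hs' 0 0 0 (by omega), if_neg (by omega), hn]) hh
    (fun u v s' s'' hs' hag a i j hne => by rw [hag a i j hne, hs' a i j hne])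
    (fun u s' hs' a i j hne => by
      rw [hs' a i j hne]
      congr 1
      simp only [eq_iff_iff]
      constructor <;> (intro hx; omega)) ?_ ?_
  · simp only [flatMap_nil] at this
    refine this.mono le_rfl fun s' hs' a i j hne => ?_
    rw [hs' a i j hne]
    congr 1
    simp only [eq_iff_iff]
    constructor <;> (intro hx; omega)
  · intro u hu v hv s₁ hs₁ h0 h1
    refine (hc u hu v hv s₁ h0 h1 fun a i j hab hne => by
      rw [hs₁ a i j hne, if_neg (by tauto)]).seq_nil fun s₂ hs₂ => runs_assign ?_
    have e0 : s₂ (10, 0, 0) = u := by rw [hs₂.2 _ _ _ (by omega), h0]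
    have e1 : s₂ (10, 1, 0) = v := by rw [hs₂.2 _ _ _ (by omega), h1]
    simp only [eval_reg, e0, e1, hs₂.1]
    refine ⟨fun a i j hne => ?_, ?_, ?_⟩
    · rw [Finsupp.coe_update]
      by_cases hx : a = b ∧ i = u ∧ j = v
      · obtain ⟨rfl, rfl, rfl⟩ := hx
        rw [Function.update_self, if_pos ⟨rfl, hu, hv, by omega⟩]
      · rw [Function.update_of_ne (by simpa using hx), hs₂.2 a i j (by omega), hs₁ a i j hne]
        congr 1
        simp only [eq_iff_iff]
        constructor <;> (intro hx; omega)
    · rw [Finsupp.coe_update, Function.update_of_ne (by simp; omega), e0]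
    · rw [Finsupp.coe_update, Function.update_of_ne (by simp; omega), e1]
  · intro a i j hne
    rw [if_neg (by omega)]

end RamWhile

namespace RamWhile

open EdgeDom

/-! ### Building blocks of the program -/

/-- A bound for the numbers in array `6`. -/
def auxBound (n : ℕ) : ℕ := n * n + numMoves n + 2

/-- The memory `s` represents `σ`; besides, only an array of bits, three auxiliary numbers and the
registers `0, …, h - 1` are in use. -/
def Tidy (h : ℕ) (σ : St) (s : Store) : Prop :=
  Reads s σ ∧ ∀ a i j, 5 ≤ a → s (a, i, j) ≠ 0 →
    (a = 5 ∧ i < σ.n ∧ j < σ.n ∧ s (a, i, j) ≤ 1) ∨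
      (a = 6 ∧ i < 3 ∧ j = 0 ∧ s (a, i, j) ≤ auxBound σ.n) ∨ (a = 10 ∧ i < h ∧ j = 0)

theorem Tidy.agree {h h' : ℕ} {σ : St} {s s' : Store} (hs : Tidy h σ s) (hag : Agree h' s s')
    (hh : h' ≤ h) : Tidy h σ s' := by
  refine ⟨hag.reads hs.1, fun a i j ha hne => ?_⟩
  by_cases hr : a = 10 ∧ 0 ≤ i ∧ i < 0 + h' ∧ j = 0
  · exact Or.inr (Or.inr ⟨hr.1, by omega, hr.2.2.2⟩)
  · rw [hag a i j hr] at hne ⊢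
    exact hs.2 a i j ha hne

theorem Tidy.mono {h h' : ℕ} {σ : St} {s : Store} (hs : Tidy h σ s) (hh : h ≤ h') :
    Tidy h' σ s := by
  refine ⟨hs.1, fun a i j ha hne => ?_⟩
  rcases hs.2 a i j ha hne with h1 | h1 | h1
  exacts [Or.inl h1, Or.inr (Or.inl h1), Or.inr (Or.inr ⟨h1.1, by omega, h1.2.2⟩)]

/-- Clear the registers `0, …, h - 1`. -/
def clean : ℕ → Cmd
  | 0 => .skip
  | h + 1 => .seq (clean h) (setReg h (.const 0))

theorem runs_clean (h : ℕ) (s : Store) : Runs (clean h) s [] (2 * h + 1)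
    (fun s' => Agree h s s' ∧ ∀ i < h, s' (10, i, 0) = 0) := by
  induction h with
  | zero => exact runs_skip ⟨Frame.refl _ _ _, fun i hi => absurd hi (Nat.not_lt_zero _)⟩
  | succ h ih =>
    refine (ih.seq_nil fun s' hs' => runs_setReg ⟨?_, fun i hi => ?_⟩).mono (by omega) fun _ h => h
    · exact (hs'.1.mono le_rfl (by omega)).trans (frame_update _ _ (Nat.zero_le _) (by omega))
    · by_cases hih : i = h
      · rw [hih, update_reg_self]; rfl
      · rw [update_reg_ne _ _ (by omega), hs'.2 i (by omega)]

theorem Tidy.clean {h : ℕ} {σ : St} {s s' : Store} (hs : Tidy h σ s) (hag : Agree h s s')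
    (hz : ∀ i < h, s' (10, i, 0) = 0) : Tidy 0 σ s' := by
  have := hs.agree hag le_rfl
  refine ⟨this.1, fun a i j ha hne => ?_⟩
  rcases this.2 a i j ha hne with h1 | h1 | h1
  · exact Or.inl h1
  · exact Or.inr (Or.inl h1)
  · obtain ⟨rfl, hi, rfl⟩ := h1
    exact absurd (hz i hi) hne

open Classical in
/-- The word for a set of edges of a graph on the vertices `0, …, n - 1`. -/
noncomputable def encodeRel (n : ℕ) (D : ℕ → ℕ → Prop) : List ℕ :=
  (List.range n).flatMap fun u => (List.range n).flatMap fun v =>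
    if u < v ∧ D u v then [u, v] else []

/-- Output the current edge set. -/
def printCur : Cmd :=
  .seq (grid (.cond (.lt (.const 1) (.add (.lt (reg 0) (reg 1)) (.cell 2 (reg 0) (reg 1))))
    (.seq (.write (reg 0)) (.write (reg 1))) .skip)) .emit

theorem runs_printCur {σ : St} {s : Store} (hs : Reads s σ) :
    Runs printCur s ((encodeRel σ.n σ.cur).map some ++ [none]) (σ.n * (σ.n * 7 + 6) + 5)
      (Agree 2 s) := by
  classical
  have key := runs_grid (n := σ.n) (T := 4) (h := 2) (s := s)
    (c := .cond (.lt (.const 1) (.add (.lt (reg 0) (reg 1)) (.cell 2 (reg 0) (reg 1))))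
      (.seq (.write (reg 0)) (.write (reg 1))) .skip) (fun _ _ s' => Agree 2 s s')
    (fun u v => if u < v ∧ σ.cur u v then [some u, some v] else [])
    (fun u v s' hs' => by
      rw [hs'.reads hs 0 (by omega)]
      simp [St.cells]) le_rfl (fun u v s' s'' h1 h2 => h1.trans h2) (fun u s' hs' => hs') ?_
    (Frame.refl _ _ _)
  · have := key.seq (d := .emit) (o₂ := [none]) (T₂ := 1) (Q₂ := Agree 2 s) fun s' hs' =>
      runs_emit hs'
    have e : (encodeRel σ.n σ.cur).map some = (List.range σ.n).flatMap fun u =>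
        (List.range σ.n).flatMap fun v =>
          if u < v ∧ σ.cur u v then [some u, some v] else [] := by
      unfold encodeRel
      simp only [List.map_flatMap]
      congr! 4
      split <;> rfl
    rw [e]
    exact this.mono le_rfl fun _ h => h
  · intro u hu v hv s' hs' h0 h1
    have hcell : s' (2, u, v) = ind (σ.cur u v) := hs'.reads hs 2 (by omega) u v
    -- The conjunction of two bits is tested by comparing their sum with 1.
    have he : (Expr.lt (.const 1) (.add (.lt (reg 0) (reg 1)) (.cell 2 (reg 0) (reg 1)))).eval s' =
        if u < v ∧ σ.cur u v then 1 else 0 := by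
      simp only [Expr.eval, eval_reg, h0, h1, hcell, ind]
      by_cases h2 : u < v <;> by_cases h3 : σ.cur u v <;> simp [h2, h3]
    by_cases hc : u < v ∧ σ.cur u v
    · rw [if_pos hc] at he ⊢
      refine runs_cond_true (by rw [he]; omega) ?_
      have := (runs_write (s := s') (e := reg 0) (Q := fun s => s = s') rfl).seq
        (d := .write (reg 1)) (o₂ := [some v]) (T₂ := 1)
        (Q₂ := fun s₁ => Agree 2 s s₁ ∧ s₁ (10, 0, 0) = u ∧ s₁ (10, 1, 0) = v) (by
          intro s₂ hs₂
          rw [hs₂]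
          have := runs_write (s := s') (e := reg 1)
            (Q := fun s₁ => Agree 2 s s₁ ∧ s₁ (10, 0, 0) = u ∧ s₁ (10, 1, 0) = v) ⟨hs', h0, h1⟩
          rwa [eval_reg, h1] at this)
      rwa [eval_reg, h0] at this
    · rw [if_neg hc] at he ⊢
      exact (runs_cond_false he (runs_skip ⟨hs', h0, h1⟩)).mono (by omega) fun _ h => h

/-- Compute a number with `c` and store it in cell `(6, k, 0)`. -/
def setAux (k : ℕ) (c : Cmd) : Cmd := .seq c (.assign 6 (.const k) (.const 0) (reg 0))

open Classical in
theorem runs_setAux {T h h' v k : ℕ} {c : Cmd} {s : Store} (hh : h ≤ h')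
    (hc : Runs c s [] T (fun s' => s' (10, 0, 0) = v ∧ Frame 0 h s s')) :
    Runs (setAux k c) s [] (T + 2) (fun s' => ∀ a i j, ¬ (a = 10 ∧ 0 ≤ i ∧ i < 0 + h' ∧ j = 0) →
      s' (a, i, j) = if a = 6 ∧ i = k ∧ j = 0 then v else s (a, i, j)) := by
  refine hc.seq_nil fun s₁ hs₁ => runs_assign fun a i j hne => ?_
  rw [Finsupp.coe_update]
  by_cases hx : a = 6 ∧ i = k ∧ j = 0
  · obtain ⟨rfl, rfl, rfl⟩ := hx
    rw [if_pos ⟨rfl, rfl, rfl⟩]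
    simp [hs₁.1]
  · rw [if_neg hx, Function.update_of_ne (by simpa using hx), hs₁.2 a i j (by omega)]

open Classical in
/-- A command that replaces the relation in array `b` by `C`, sets the move number to `f` and
stores the truth values of `P` and `Q` in cells `(6, 1, 0)` and `(6, 2, 0)`. -/
theorem exists_transition {C : St → ℕ → ℕ → Prop} {f : St → ℕ} {P Q : St → Prop} (hC : DfnR C)
    (hf : Dfn f) (hP : DfnP P) (hQ : DfnP Q) {b : ℕ} (hb : b = 2 ∨ b = 3) :
    ∃ (c : Cmd) (h : ℕ) (p : Polynomial ℕ), ∀ H ≥ h, ∀ (σ σ' : St) (B : ℕ) (s : Store),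
      σ.n ≤ B → σ.idx ≤ B → 1 ≤ B → Tidy H σ s → f σ ≤ auxBound σ.n →
      σ'.n = σ.n →
      (∀ a i j, a < 5 → σ'.cells a i j = if a = 4 ∧ i = 0 ∧ j = 0 then f σ else
        if a = b ∧ i < σ.n ∧ j < σ.n then ind (C σ i j) else
          if a = b then 0 else σ.cells a i j) →
      Runs c s [] (p.eval B) (fun s' => Tidy H σ' s' ∧ s' (6, 1, 0) = ind (P σ) ∧
        s' (6, 2, 0) = ind (Q σ)) := by
  obtain ⟨cC, hC, pC, HC⟩ := hC
  obtain ⟨cf, hf, pf, Hf⟩ := hf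
  obtain ⟨cP, hP, pP, HP⟩ := hP
  obtain ⟨cQ, hQ, pQ, HQ⟩ := hQ
  -- The two variables of C live in the loop registers 0 and 1 of the grid.
  set loc : ℕ → ℕ := Function.update (Function.update id (Ctx.depth St) 0) (Ctx.depth (St × ℕ)) 1
    with hloc
  -- All new values depend on the old state. They are therefore first collected in the scratch
  -- arrays 5 and 6, and the state is overwritten only at the end.
  refine ⟨.seq (grid (.seq (cC loc 2) (.assign 5 (reg 0) (reg 1) (reg 2))))
    (.seq (setAux 0 (cf id 0)) (.seq (setAux 1 (cP id 0)) (.seq (setAux 2 (cQ id 0))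
      (.seq (grid (.seq .skip (.assign b (reg 0) (reg 1) (.cell 5 (reg 0) (reg 1)))))
        (.assign 4 (.const 0) (.const 0) (.cell 6 (.const 0) (.const 0))))))),
    hC + hf + hP + hQ + 3,
    (Polynomial.X * (Polynomial.X * (pC + 5) + 6) + 3) + (pf + 2) + (pP + 2) + (pQ + 2) +
      (Polynomial.X * (Polynomial.X * 6 + 6) + 3) + 6,
    fun H hH σ σ' B s hn hi h1 hs hfb hn' hσ' => ?_⟩
  have hbase : ∀ s₁, Reads s₁ σ → Fits id 0 B σ s₁ := fun s₁ hr =>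
    ⟨fun x hx => absurd hx (Nat.not_lt_zero _), hr, fun x hx => absurd hx (Nat.not_lt_zero _),
      fun x hx => absurd hx (Nat.not_lt_zero _), hn, hi, h1⟩
  have hs0 : s (0, 0, 0) = σ.n := by rw [hs.1 0 (by omega)]; simp [St.cells]
  have r1 := runs_grid_assign (n := σ.n) (T := pC.eval B) (h := H) (b := 5) (c := cC loc 2)
    (e := reg 2) (s := s) (fun u v => ind (C σ u v)) hs0 (by omega) (by omega) (by omega) (by
      intro u hu v hv s₁ h0 h1' hag
      have hr : Reads s₁ σ := fun a ha i j => by rw [hag a i j (by omega) (by omega), hs.1 a ha]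
      have fit := ((hbase s₁ hr).extend (r := 0) (d' := 1) (by omega) (by omega) h0 le_rfl
        (by omega)).extend (r := 1) (d' := 2) (by omega) (by omega) h1' le_rfl (by omega)
      refine (HC loc 2 B ((σ, u), v) s₁ fit).2.mono le_rfl fun s₂ hs₂ => ⟨hs₂.1, ?_⟩
      exact hs₂.2.mono le_rfl (by omega))
  refine (r1.seq_nil fun s₁ hs₁ => ?_).mono (T := (σ.n * (σ.n * (pC.eval B + 5) + 6) + 3) +
    ((pf.eval B + 2) + ((pP.eval B + 2) + ((pQ.eval B + 2) +
      ((σ.n * (σ.n * 6 + 6) + 3) + 1 + 1) + 1) + 1) + 1) + 1) ?_ fun _ h => h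
  swap
  · have h2 : σ.n * (σ.n * (pC.eval B + 5) + 6) ≤ B * (B * (pC.eval B + 5) + 6) :=
      Nat.mul_le_mul hn (Nat.add_le_add_right (Nat.mul_le_mul hn le_rfl) _)
    have h3 : σ.n * (σ.n * 6 + 6) ≤ B * (B * 6 + 6) :=
      Nat.mul_le_mul hn (Nat.add_le_add_right (Nat.mul_le_mul hn le_rfl) _)
    simp only [Polynomial.eval_add, Polynomial.eval_mul, Polynomial.eval_X, Polynomial.eval_ofNat]
    omega
  have rd1 : Reads s₁ σ := fun a ha i j => by
    rw [hs₁ a i j (by omega), if_neg (by omega), hs.1 a ha]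
  refine (runs_setAux (k := 0) (h' := H) (by omega) (Hf id 0 B σ s₁ (hbase _ rd1)).2).seq_nil
    fun s₂ hs₂ => ?_
  have rd2 : Reads s₂ σ := fun a ha i j => by
    rw [hs₂ a i j (by omega), if_neg (by omega), rd1 a ha]
  refine (runs_setAux (k := 1) (h' := H) (by omega) (HP id 0 B σ s₂ (hbase _ rd2)).2).seq_nil
    fun s₃ hs₃ => ?_
  have rd3 : Reads s₃ σ := fun a ha i j => by
    rw [hs₃ a i j (by omega), if_neg (by omega), rd2 a ha]
  refine (runs_setAux (k := 2) (h' := H) (by omega) (HQ id 0 B σ s₃ (hbase _ rd3)).2).seq_nil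
    fun s₄ hs₄ => ?_
  have rd4 : Reads s₄ σ := fun a ha i j => by
    rw [hs₄ a i j (by omega), if_neg (by omega), rd3 a ha]
  have hs40 : s₄ (0, 0, 0) = σ.n := by rw [rd4 0 (by omega)]; simp [St.cells]
  have val4 : ∀ a i j, ¬ (a = 10 ∧ 0 ≤ i ∧ i < 0 + H ∧ j = 0) → s₄ (a, i, j) =
      if a = 6 ∧ i = 2 ∧ j = 0 then ind (Q σ) else if a = 6 ∧ i = 1 ∧ j = 0 then ind (P σ) else
        if a = 6 ∧ i = 0 ∧ j = 0 then f σ else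
          if a = 5 ∧ i < σ.n ∧ j < σ.n then ind (C σ i j) else s (a, i, j) := by
    intro a i j hne
    rw [hs₄ a i j hne, hs₃ a i j hne, hs₂ a i j hne, hs₁ a i j hne]
  have r5 := runs_grid_assign (n := σ.n) (T := 1) (h := H) (b := b) (c := .skip)
    (e := .cell 5 (reg 0) (reg 1)) (s := s₄) (fun u v => ind (C σ u v)) hs40 (by omega) (by omega)
    (by omega) (by
      intro u hu v hv s₅ h0 h1' hag
      refine runs_skip ⟨?_, Frame.refl _ _ _⟩
      simp only [Expr.eval, eval_reg, h0, h1']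
      rw [hag 5 u v (by omega) (by omega), val4 5 u v (by omega), if_neg (by omega),
        if_neg (by omega), if_neg (by omega), if_pos ⟨rfl, hu, hv⟩])
  refine r5.seq_nil fun s₅ hs₅ => runs_assign ?_
  have h6 : s₅ (6, 0, 0) = f σ := by
    rw [hs₅ _ _ _ (by omega), if_neg (by omega), val4 _ _ _ (by omega), if_neg (by omega),
      if_neg (by omega), if_pos ⟨rfl, rfl, rfl⟩]
  have val : ∀ a i j, ¬ (a = 10 ∧ 0 ≤ i ∧ i < 0 + H ∧ j = 0) →
      (s₅.update (4, 0, 0) (f σ)) (a, i, j) =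
      if a = 4 ∧ i = 0 ∧ j = 0 then f σ else
      if a = b ∧ i < σ.n ∧ j < σ.n then ind (C σ i j) else
      if a = 6 ∧ i = 2 ∧ j = 0 then ind (Q σ) else if a = 6 ∧ i = 1 ∧ j = 0 then ind (P σ) else
        if a = 6 ∧ i = 0 ∧ j = 0 then f σ else
          if a = 5 ∧ i < σ.n ∧ j < σ.n then ind (C σ i j) else s (a, i, j) := by
    intro a i j hne
    rw [Finsupp.coe_update]
    by_cases hx : a = 4 ∧ i = 0 ∧ j = 0
    · obtain ⟨rfl, rfl, rfl⟩ := hx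
      simp
    · rw [if_neg hx, Function.update_of_ne (by simpa using hx), hs₅ a i j hne, val4 a i j hne]
  simp only [Expr.eval, h6]
  refine ⟨⟨fun a ha i j => ?_, fun a i j ha hne => ?_⟩, ?_, ?_⟩
  · rw [val a i j (by omega), hσ' a i j ha]
    by_cases hx : a = 4 ∧ i = 0 ∧ j = 0
    · rw [if_pos hx, if_pos hx]
    rw [if_neg hx, if_neg hx]
    by_cases hy : a = b ∧ i < σ.n ∧ j < σ.n
    · rw [if_pos hy, if_pos hy]
    rw [if_neg hy, if_neg hy, if_neg (by omega), if_neg (by omega), if_neg (by omega),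
      if_neg (by omega), hs.1 a ha]
    by_cases hab : a = b
    · rw [if_pos hab]
      subst hab
      rcases hb with rfl | rfl
      · exact ind_false fun h => hy ⟨rfl, σ.cur_lt _ _ h⟩
      · exact ind_false fun h => hy ⟨rfl, σ.root_lt _ _ h⟩
    · rw [if_neg hab]
  · rw [hn']
    by_cases hr : a = 10 ∧ 0 ≤ i ∧ i < 0 + H ∧ j = 0
    · exact Or.inr (Or.inr ⟨hr.1, by omega, hr.2.2.2⟩)
    rw [val a i j hr] at hne ⊢
    rw [if_neg (by omega), if_neg (by omega)] at hne ⊢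
    have hab : 2 ≤ auxBound σ.n := by unfold auxBound; omega
    split_ifs at hne ⊢ with h2 h3 h4 h5
    · have := ind_le_one (Q σ); omega
    · have := ind_le_one (P σ); omega
    · omega
    · have := ind_le_one (C σ i j); omega
    · exact hs.2 a i j ha hne
  · rw [val _ _ _ (by omega), if_neg (by omega), if_neg (by omega), if_neg (by omega),
      if_pos ⟨rfl, rfl, rfl⟩]
  · rw [val _ _ _ (by omega), if_neg (by omega), if_neg (by omega), if_pos ⟨rfl, rfl, rfl⟩]

end RamWhile

namespace RamWhile

open EdgeDom

/-! ### The greedy matching -/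

namespace St

/-- The first endpoint of the pair number `idx`. -/
def fstEnd (σ : St) : ℕ := σ.idx / σ.n

/-- The second endpoint of the pair number `idx`. -/
def sndEnd (σ : St) : ℕ := σ.idx - σ.n * (σ.idx / σ.n)

/-- The root edge set together with the pair number `idx`, if this is an edge that can be added to
the matching. -/
def newRoot (σ : St) (u v : ℕ) : Prop :=
  σ.root u v ∨ (SamePair u v σ.fstEnd σ.sndEnd ∧ σ.adj σ.fstEnd σ.sndEnd ∧
    ¬ Cov σ.root σ.fstEnd ∧ ¬ Cov σ.root σ.sndEnd)

theorem newRoot_lt (σ : St) (u v : ℕ) (h : σ.newRoot u v) : u < σ.n ∧ v < σ.n := by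
  rcases h with h | ⟨h, h1, -⟩
  · exact σ.root_lt u v h
  · obtain ⟨h2, h3⟩ := σ.adj_lt _ _ h1
    rcases h with ⟨rfl, rfl⟩ | ⟨rfl, rfl⟩
    exacts [⟨h2, h3⟩, ⟨h3, h2⟩]

/-- One step of the construction of the matching. -/
def greedy (σ : St) : St :=
  { σ with root := σ.newRoot, idx := σ.idx + 1, root_lt := σ.newRoot_lt }

/-- The state in which the search starts. -/
def start (σ : St) : St := { σ with cur := σ.root, idx := 0, cur_lt := σ.root_lt }

theorem dfn_fstEnd : Dfn (fun σ : St => σ.fstEnd) := Dfn.div (Γ := St) Dfn.idx Dfn.n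

theorem dfn_sndEnd : Dfn (fun σ : St => σ.sndEnd) :=
  Dfn.sub (Γ := St) Dfn.idx (Dfn.mul Dfn.n (Dfn.div Dfn.idx Dfn.n))

theorem supp_root : Supp (fun σ : St => σ.root) := fun σ u v h => σ.root_lt u v h

theorem dfnR_newRoot : DfnR (fun σ : St => σ.newRoot) := by
  have h1 : DfnP (fun σ : St => ¬ Cov σ.root σ.fstEnd) :=
    (DfnR.cov (Γ := St) dfnR_root supp_root dfn_fstEnd).not
  have h2 : DfnP (fun σ : St => ¬ Cov σ.root σ.sndEnd) :=
    (DfnR.cov (Γ := St) dfnR_root supp_root dfn_sndEnd).not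
  have h3 : DfnP (fun σ : St => σ.adj σ.fstEnd σ.sndEnd) :=
    DfnR.app (Γ := St) dfnR_adj dfn_fstEnd dfn_sndEnd
  have h4 : DfnP (fun γ : (St × ℕ) × ℕ => γ.1.1.adj γ.1.1.fstEnd γ.1.1.sndEnd ∧
      ¬ Cov γ.1.1.root γ.1.1.fstEnd ∧ ¬ Cov γ.1.1.root γ.1.1.sndEnd) :=
    Dfn.ren (h3.and (h1.and h2)) ren2
  exact DfnP.or (dfnR_root (Γ := St))
    ((dfnP_samePair (dfn_fstEnd.ren ren2) (dfn_sndEnd.ren ren2) dvar1 dvar0).and h4)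

/-- What the construction of the matching maintains. -/
structure Partial (σ : St) : Prop where
  symm : ∀ u v, σ.root u v → σ.root v u
  sub : ∀ u v, σ.root u v → σ.adj u v
  matching : IsMatching σ.root
  dom : ∀ u v, σ.adj u v → u * σ.n + v < σ.idx → Cov σ.root u ∨ Cov σ.root v

/-- Coverage only grows, so pairs treated earlier stay dominated. The pair with number idx = u n + v
is decoded by division; if it is an edge with both endpoints free, it is added. -/
theorem Partial.greedy {σ : St} (hA : IsGraph σ.n σ.adj) (h : σ.Partial) : σ.greedy.Partial := by
  have hmono : ∀ u, Cov σ.root u → Cov σ.newRoot u := fun u ⟨v, hv⟩ => ⟨v, Or.inl hv⟩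
  refine ⟨fun u v huv => ?_, fun u v huv => ?_, fun u v w huv huw => ?_, fun u v huv hlt => ?_⟩
  · rcases huv with huv | ⟨hp, hr⟩
    · exact Or.inl (h.symm u v huv)
    · exact Or.inr ⟨by unfold SamePair at hp ⊢; omega, hr⟩
  · rcases huv with huv | ⟨⟨rfl, rfl⟩ | ⟨rfl, rfl⟩, hr⟩
    exacts [h.sub u v huv, hr.1, hA.symm _ _ hr.1]
  · have hne : ∀ x, Cov σ.root x → ∀ y, ¬ Cov σ.root y → x ≠ y := fun x hx y hy hxy =>
      hy (hxy ▸ hx)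
    rcases huv with huv | ⟨hp, hr⟩ <;> rcases huw with huw | ⟨hp', hr'⟩
    · exact h.matching u v w huv huw
    · have h1 := hne u ⟨v, huv⟩ _ hr'.2.1
      have h2 := hne u ⟨v, huv⟩ _ hr'.2.2
      unfold SamePair at hp'
      omega
    · have h1 := hne u ⟨w, huw⟩ _ hr.2.1
      have h2 := hne u ⟨w, huw⟩ _ hr.2.2
      unfold SamePair at hp
      omega
    · have h1 : σ.fstEnd ≠ σ.sndEnd := fun he => hA.irrefl _ (he ▸ hr.1)
      unfold SamePair at hp hp'
      omega
  · have hlt' : u * σ.n + v < σ.idx + 1 := hlt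
    rcases Nat.lt_succ_iff_lt_or_eq.1 hlt' with hlt' | he
    · exact (h.dom u v huv hlt').imp (hmono u) (hmono v)
    · have hv := hA.lt' huv
      have e1 : σ.fstEnd = u := by
        unfold fstEnd
        rw [← he, Nat.mul_comm, Nat.mul_add_div (by omega), Nat.div_eq_of_lt hv, add_zero]
      have e2 : σ.sndEnd = v := by
        have : σ.idx / σ.n = u := e1
        unfold sndEnd
        rw [this, ← he, Nat.mul_comm]
        omega
      by_cases hu' : Cov σ.root u
      · exact Or.inl (hmono u hu')
      by_cases hv' : Cov σ.root v
      · exact Or.inr (hmono v hv')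
      refine Or.inl ⟨v, Or.inr ?_⟩
      rw [e1, e2]
      exact ⟨Or.inl ⟨rfl, rfl⟩, huv, hu', hv'⟩

theorem greedy_iterate {σ : St} (hA : IsGraph σ.n σ.adj) (h : σ.Partial) (k : ℕ) :
    (greedy^[k] σ).n = σ.n ∧ (greedy^[k] σ).adj = σ.adj ∧ (greedy^[k] σ).idx = σ.idx + k ∧
      (greedy^[k] σ).Partial := by
  induction k with
  | zero => exact ⟨rfl, rfl, rfl, h⟩
  | succ k ih =>
    rw [Function.iterate_succ_apply']
    obtain ⟨h1, h2, h3, h4⟩ := ih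
    refine ⟨h1, h2, ?_, h4.greedy (by rw [h1, h2]; exact hA)⟩
    exact (congrArg (· + 1) h3).trans (add_assoc _ _ _)

theorem Partial.valid_start {σ : St} (hA : IsGraph σ.n σ.adj) (h : σ.Partial)
    (hidx : σ.n * σ.n ≤ σ.idx) : σ.start.Valid := by
  have hgood : IsGood σ.adj σ.root := by
    refine ⟨h.symm, h.sub, fun u v huv => h.dom u v huv ?_, fun c b b' hb hb' hne =>
      absurd (h.matching _ _ _ hb hb') hne⟩
    have h1 := hA.lt _ _ huv
    have h2 := hA.lt' huv
    have h3 : (u + 1) * σ.n ≤ σ.n * σ.n := Nat.mul_le_mul h1 le_rfl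
    rw [Nat.add_mul] at h3
    omega
  exact ⟨hA, hgood, h.matching, hgood, Nat.zero_le _⟩

/-- The extreme value occurs only after the last step of the search, which the program still carries
out before it tests the flag. -/
theorem newIdx_le {σ : St} (h : σ.idx ≤ numMoves σ.n) : σ.newIdx ≤ numMoves σ.n + 1 := by
  have : σ.move ≤ numMoves σ.n := by
    rcases σ.move_cases with h | h <;> omega
  unfold newIdx
  split
  · omega
  · split <;> omega

end St

/-! ### The program -/

/-- A bound for all addresses and contents between the steps of the search. -/
def sizeBound (n : ℕ) : ℕ := n + auxBound n + 7

/-- `Tidy` does not bound the contents of registers, hence the width 0; `clean` establishes it at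
the end of each step. -/
theorem Tidy.small {σ : St} {s : Store} (hs : Tidy 0 σ s) (hidx : σ.idx ≤ auxBound σ.n) :
    Small (sizeBound σ.n) (sizeBound σ.n ^ 3) s := by
  have hab : 2 ≤ auxBound σ.n := by unfold auxBound; omega
  have key : ∀ a i j, s (a, i, j) ≠ 0 → a < sizeBound σ.n ∧ i < sizeBound σ.n ∧
      j < sizeBound σ.n ∧ s (a, i, j) < sizeBound σ.n := by
    intro a i j hne
    unfold sizeBound
    by_cases ha : a < 5
    · have hind : ∀ (R : ℕ → ℕ → Prop), (∀ u v, R u v → u < σ.n ∧ v < σ.n) →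
          s (a, i, j) = ind (R i j) → i < σ.n ∧ j < σ.n ∧ s (a, i, j) ≤ 1 := by
        intro R hR h
        by_cases hr : R i j
        · exact ⟨(hR i j hr).1, (hR i j hr).2, h ▸ ind_le_one _⟩
        · rw [ind_false hr] at h
          exact absurd h hne
      have h := hs.1 a ha i j
      interval_cases a
      · simp only [St.cells] at h
        split at h <;> omega
      · have := hind _ σ.adj_lt h; omega
      · have := hind _ σ.cur_lt h; omega
      · have := hind _ σ.root_lt h; omega
      · simp only [St.cells] at h
        split at h <;> omega
    · rcases hs.2 a i j (by omega) hne with h | h | h <;> omega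
  constructor
  · rintro ⟨a, i, j⟩ hne
    have hpow : sizeBound σ.n < 2 ^ sizeBound σ.n := Nat.lt_two_pow_self
    obtain ⟨h1, h2, h3, h4⟩ := key a i j hne
    exact ⟨h1.trans hpow, h2.trans hpow, h3.trans hpow, h4.trans hpow⟩
  · have hsub : s.support ⊆ Finset.range (sizeBound σ.n) ×ˢ Finset.range (sizeBound σ.n) ×ˢ
        Finset.range (sizeBound σ.n) := by
      rintro ⟨a, i, j⟩ hp
      obtain ⟨h1, h2, h3, -⟩ := key a i j (Finsupp.mem_support_iff.1 hp)
      simp [h1, h2, h3]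
    refine (Finset.card_le_card hsub).trans_eq ?_
    simp only [Finset.card_product, Finset.card_range]
    ring

/-- The flag that ends a loop. -/
def running : Expr := .eq (.cell 6 (.const 1) (.const 0)) (.const 0)

theorem eval_running (s : Store) : running.eval s = if s (6, 1, 0) = 0 then 1 else 0 := rfl

/-- The flag is raised in the round that starts with idx = n², whence n² + 1 rounds. The surplus
round adds no edge, as n² is not the number of a pair of vertices. The greedy matching is then
copied to the current set and printed. -/
theorem exists_setup : ∃ (c : ℕ → Cmd) (h : ℕ) (p : ℕ → Polynomial ℕ), ∀ H ≥ h, ∀ (σ : St)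
    (s : Store), IsGraph σ.n σ.adj → σ.Partial → σ.idx = 0 → Tidy 0 σ s → s (6, 1, 0) = 0 →
    Runs (c H) s ((encodeRel σ.n (St.greedy^[σ.n * σ.n + 1] σ).root).map some ++ [none])
      ((p H).eval (sizeBound σ.n))
      (fun s' => Tidy 0 (St.greedy^[σ.n * σ.n + 1] σ).start s' ∧ s' (6, 1, 0) = 0) := by
  obtain ⟨cg, hg, pg, Hg⟩ := exists_transition St.dfnR_newRoot
    ((Dfn.idx (Γ := St)).add (Dfn.const 1))
    (DfnP.lt (Dfn.idx (Γ := St)) (Dfn.mul (Γ := St) Dfn.n Dfn.n)).not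
    (DfnP.lt (Dfn.const (Γ := St) 0) (Dfn.const 0)) (b := 3) (Or.inr rfl)
  -- The predicate 0 < 0 is false, so this transition lowers the flag for the search loop.
  obtain ⟨cs, hs, ps, Hs⟩ := exists_transition (dfnR_root (Γ := St)) (Dfn.const 0)
    (DfnP.lt (Dfn.const (Γ := St) 0) (Dfn.const 0))
    (DfnP.lt (Dfn.const (Γ := St) 0) (Dfn.const 0)) (b := 2) (Or.inl rfl)
  refine ⟨fun H => .seq (.loop running cg) (.seq cs (.seq printCur (clean H))), hg + hs + 2,
    fun H => (Polynomial.X * Polynomial.X + 1) * (pg + 1) + ps +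
      Polynomial.X * (Polynomial.X * 7 + 6) + Polynomial.C (2 * H) + 10,
    fun H hH σ s hA hpart hidx hsT hs6 => ?_⟩
  set B := sizeBound σ.n with hB
  have hnB : σ.n ≤ B := by rw [hB]; unfold sizeBound; omega
  have h1B : 1 ≤ B := by rw [hB]; unfold sizeBound; omega
  have hnnB : σ.n * σ.n + 1 ≤ B := by rw [hB]; unfold sizeBound auxBound; omega
  have hloop := runs_loop_nil (e := running) (c := cg) (m := σ.n * σ.n + 1) (T := pg.eval B)
    (fun k s' => Tidy H (St.greedy^[k] σ) s' ∧
      s' (6, 1, 0) = if k = σ.n * σ.n + 1 then 1 else 0) (by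
      rintro k hk s₁ ⟨ht, h6⟩
      rw [if_neg hk.ne] at h6
      refine ⟨by rw [eval_running, if_pos h6]; omega, ?_⟩
      obtain ⟨e1, e2, e3, e4⟩ := St.greedy_iterate hA hpart k
      rw [hidx, zero_add] at e3
      refine (Hg H (by omega) (St.greedy^[k] σ) (St.greedy^[k + 1] σ) B s₁ (by rw [e1]; exact hnB)
        (by rw [e3]; omega) h1B ht ?_ ?_ ?_).mono le_rfl fun s₂ hs₂ => ⟨hs₂.1, ?_⟩
      · show (St.greedy^[k] σ).idx + 1 ≤ auxBound (St.greedy^[k] σ).n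
        rw [e1, e3]
        unfold auxBound
        omega
      · rw [Function.iterate_succ_apply']; rfl
      · intro a i j ha
        rw [Function.iterate_succ_apply']
        set τ := St.greedy^[k] σ
        interval_cases a
        · rfl
        · rfl
        · rfl
        · by_cases hij : i < τ.n ∧ j < τ.n
          · simp only [hij]; rfl
          · simp only [hij]
            exact ind_false fun h => hij (τ.newRoot_lt _ _ h)
        · by_cases hij : i = 0 ∧ j = 0
          · simp only [hij]; rfl
          · simp [St.cells, hij]
      · rw [hs₂.2.1]
        show ind (¬ (St.greedy^[k] σ).idx < (St.greedy^[k] σ).n * (St.greedy^[k] σ).n) = _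
        rw [e1, e3]
        by_cases hkn : k < σ.n * σ.n
        · rw [ind_false (by omega), if_neg (by omega)]
        · rw [ind_true hkn, if_pos (by omega)])
    (by
      rintro s₁ ⟨-, h6⟩
      rw [eval_running, h6, if_pos rfl]
      rfl)
    (s := s) ⟨hsT.mono (Nat.zero_le _), by rw [hs6, if_neg (by omega)]⟩
  set τ := St.greedy^[σ.n * σ.n + 1] σ with hτ
  obtain ⟨e1, e2, e3, e4⟩ := St.greedy_iterate hA hpart (σ.n * σ.n + 1)
  rw [hidx, zero_add] at e3
  rw [← hτ] at e1 e2 e3 e4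
  have hout : (encodeRel σ.n τ.root).map some ++ [none] =
      ((encodeRel τ.start.n τ.start.cur).map some ++ [none]) ++ [] := by
    rw [List.append_nil]
    show _ = (encodeRel τ.n τ.root).map some ++ [none]
    rw [e1]
  rw [hout]
  refine (hloop.seq_nil fun s₁ hs₁ => ((Hs H (by omega) τ τ.start B s₁ (by rw [e1]; exact hnB)
    (by rw [e3]; exact hnnB) h1B hs₁.1 (Nat.zero_le _) rfl ?_).seq_nil fun s₂ hs₂ =>
      ((runs_printCur hs₂.1.1).seq fun s₃ hs₃ => (runs_clean H s₃).mono le_rfl fun s₄ hs₄ =>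
        ⟨?_, ?_⟩))).mono ?_ fun _ h => h
  · intro a i j ha
    interval_cases a
    · rfl
    · rfl
    · by_cases hij : i < τ.n ∧ j < τ.n
      · simp only [hij]; rfl
      · simp only [hij]
        exact ind_false fun h => hij (τ.root_lt _ _ h)
    · rfl
    · by_cases hij : i = 0 ∧ j = 0
      · simp only [hij]; rfl
      · simp [St.cells, hij]
  · show _ ≤ Polynomial.eval B _
    have h2 : τ.start.n = σ.n := e1
    have h3 : σ.n * (σ.n * 7 + 6) ≤ B * (B * 7 + 6) :=
      Nat.mul_le_mul hnB (Nat.add_le_add_right (Nat.mul_le_mul hnB le_rfl) _)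
    have h4 : (σ.n * σ.n + 1) * (pg.eval B + 1) ≤ (B * B + 1) * (pg.eval B + 1) :=
      Nat.mul_le_mul (Nat.add_le_add_right (Nat.mul_le_mul hnB hnB) _) le_rfl
    rw [h2]
    simp only [Polynomial.eval_add, Polynomial.eval_mul, Polynomial.eval_X, Polynomial.eval_ofNat,
      Polynomial.eval_one, Polynomial.eval_C]
    omega
  · exact (hs₂.1.agree hs₃ (by omega)).clean hs₄.1 hs₄.2
  · rw [hs₄.1 _ _ _ (by omega), hs₃ _ _ _ (by omega), hs₂.2.1]
    exact ind_false (by omega)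

open Classical in
/-- The output of a step of the search. -/
noncomputable def St.out (σ : St) : List (Option ℕ) :=
  if σ.IsChild then (encodeRel σ.n σ.look).map some ++ [none] else []

/-- A child is printed after the transition, when it has become the current set; whether to print is
decided by the bit that the transition computed from the old state. -/
theorem exists_body : ∃ (c : ℕ → Cmd) (h : ℕ) (p : ℕ → Polynomial ℕ), ∀ H ≥ h, ∀ (σ : St)
    (s : Store), σ.idx ≤ numMoves σ.n → Tidy 0 σ s →
    Runs (c H) s σ.out ((p H).eval (sizeBound σ.n))
      (fun s' => Tidy 0 σ.next s' ∧ s' (6, 1, 0) = ind σ.IsLast) := by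
  obtain ⟨cm, hm, pm, Hm⟩ := exists_transition St.dfnR_newCur St.dfn_newIdx St.dfnP_isLast
    St.dfnP_isChild (b := 2) (Or.inl rfl)
  refine ⟨fun H => .seq cm (.seq (.cond (.cell 6 (.const 2) (.const 0)) printCur .skip) (clean H)),
    hm + 2, fun H => pm + Polynomial.X * (Polynomial.X * 7 + 6) + Polynomial.C (2 * H) + 10,
    fun H hH σ s hidx hsT => ?_⟩
  set B := sizeBound σ.n with hB
  have hnB : σ.n ≤ B := by rw [hB]; unfold sizeBound; omega
  have h1B : 1 ≤ B := by rw [hB]; unfold sizeBound; omega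
  have hiB : σ.idx ≤ B := by rw [hB]; unfold sizeBound auxBound; omega
  have hout : σ.out = σ.out ++ [] := (List.append_nil _).symm
  rw [hout]
  refine ((Hm H (by omega) σ σ.next B s hnB hiB h1B (hsT.mono (Nat.zero_le _)) ?_ rfl ?_).seq_nil
    fun s₂ hs₂ => (?_ : Runs _ s₂ σ.out (σ.n * (σ.n * 7 + 6) + 5 + 1)
      (fun s' => Agree 2 s₂ s')).seq fun s₃ hs₃ => (runs_clean H s₃).mono le_rfl fun s₄ hs₄ =>
        ⟨?_, ?_⟩).mono ?_ fun _ h => h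
  · have := St.newIdx_le hidx
    unfold auxBound
    omega
  · intro a i j ha
    interval_cases a
    · rfl
    · rfl
    · by_cases hij : i < σ.n ∧ j < σ.n
      · simp only [hij]; rfl
      · simp only [hij]
        exact ind_false fun h => hij (σ.newCur_lt _ _ h)
    · rfl
    · by_cases hij : i = 0 ∧ j = 0
      · simp only [hij]; rfl
      · simp [St.cells, hij]
  · unfold St.out
    by_cases hc : σ.IsChild
    · rw [if_pos hc]
      refine runs_cond_true ?_ ?_
      · show s₂ (6, 2, 0) ≠ 0
        rw [hs₂.2.2, ind_true hc]
        omega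
      · have := runs_printCur hs₂.1.1
        rw [(St.next_of_child hc).1] at this
        exact this
    · rw [if_neg hc]
      refine (runs_cond_false ?_ (runs_skip (Frame.refl _ _ _))).mono (by omega) fun _ h => h
      show s₂ (6, 2, 0) = 0
      rw [hs₂.2.2, ind_false hc]
  · show _ ≤ Polynomial.eval B _
    have h3 : σ.n * (σ.n * 7 + 6) ≤ B * (B * 7 + 6) :=
      Nat.mul_le_mul hnB (Nat.add_le_add_right (Nat.mul_le_mul hnB le_rfl) _)
    simp only [Polynomial.eval_add, Polynomial.eval_mul, Polynomial.eval_X, Polynomial.eval_ofNat,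
      Polynomial.eval_C]
    omega
  · exact (hs₂.1.agree hs₃ (by omega)).clean hs₄.1 hs₄.2
  · rw [hs₄.1 _ _ _ (by omega), hs₃ _ _ _ (by omega), hs₂.2.1]

end RamWhile

/-! ### The complete program and its resource bounds. -/

namespace RamWhile

open EdgeDom

open Polynomial in
theorem exists_sizeBound_poly : ∃ p : Polynomial ℕ, ∀ n, p.eval n = sizeBound n :=
  ⟨X + (X * X + X ^ 10 + 2) + 7, fun n => by simp [sizeBound, auxBound, numMoves]⟩

open Polynomial in
theorem exists_gapBound_poly : ∃ p : Polynomial ℕ, ∀ n, p.eval n = St.gapBound n :=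
  ⟨(X ^ 10 + 2) * ((X * (X * (X + X)) + 1) * (X * X) + X * (X * (X + X))) + (X ^ 10 + 1),
    fun n => by simp [St.gapBound, numMoves, rankBound]⟩

theorem St.out_eq_flatMap_found (σ : St) (k : ℕ) :
    (List.range k).flatMap (fun j => (σ.walk j).out) =
      ((σ.found k).map (encodeRel σ.n)).flatMap (fun w => w.map some ++ [none]) := by
  unfold St.found
  rw [List.map_flatMap, List.flatMap_assoc]
  congr 1
  funext j
  unfold St.out
  rw [(σ.walk_const j).1]
  split <;> simp

theorem St.found_succ_of_last {σ : St} {K : ℕ} (h : (σ.walk K).IsLast) :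
    σ.found (K + 1) = σ.found K := by
  unfold St.found
  rw [List.range_succ, List.flatMap_append, List.flatMap_singleton, if_neg fun hc => h.1 hc.1,
    List.append_nil]

/-- The setup prints the root and every round of the loop performs one search step. There are K + 1
rounds, because the last state K must itself be processed for the flag to rise; that round prints
nothing. -/
theorem exists_program : ∃ (c : Cmd) (p q r : Polynomial ℕ), ∀ (σ : St) (s : Store),
    IsGraph σ.n σ.adj → (∀ u v, ¬ σ.root u v) → σ.idx = 0 → Tidy 0 σ s → s (6, 1, 0) = 0 →
    ∃ Ds : List (ℕ → ℕ → Prop), Ds.Nodup ∧ (∀ D, D ∈ Ds ↔ IsGood σ.adj D) ∧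
      Enumerates c s (Ds.map (encodeRel σ.n)) (p.eval σ.n) (q.eval σ.n) (r.eval σ.n) := by
  obtain ⟨ci, hi, pi, Hi⟩ := exists_setup
  obtain ⟨cb, hb, pb, Hb⟩ := exists_body
  obtain ⟨ps, hps⟩ := exists_sizeBound_poly
  obtain ⟨pg, hpg⟩ := exists_gapBound_poly
  set c : Cmd := .seq (ci (hi + hb)) (.loop running (cb (hi + hb))) with hc
  set pT : Polynomial ℕ := (pi (hi + hb) + pb (hi + hb)).comp ps with hpT
  refine ⟨c, (pT + 1) * (pg + 2 + 2), (pT + 1) * (pg + 2 + 2 + 1),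
    (ps ^ 3 + (pT + 1)) * (4 * (ps + (pT + 1) * Polynomial.C c.sz)),
    fun σ s hA hroot hidx hs h6 => ?_⟩
  have hpart : σ.Partial := ⟨fun u v h => absurd h (hroot u v), fun u v h => absurd h (hroot u v),
    fun u v w h => absurd h (hroot u v), fun u v _ h => absurd h (by omega)⟩
  obtain ⟨e1, e2, e3, e4⟩ := St.greedy_iterate hA hpart (σ.n * σ.n + 1)
  have hsetup := Hi (hi + hb) (by omega) σ s hA hpart hidx hs h6
  set τ := (St.greedy^[σ.n * σ.n + 1] σ).start with hτ
  have hn : τ.n = σ.n := e1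
  have hadj : τ.adj = σ.adj := e2
  have hv : τ.Valid := e4.valid_start (by rw [e1, e2]; exact hA) (by rw [e1, e3]; omega)
  obtain ⟨K, hK, hlast⟩ := St.exists_last hv rfl rfl
  have hwn : ∀ k, (τ.walk k).n = σ.n := fun k => (τ.walk_const k).1.trans hn
  have hwv : ∀ k ≤ K, (τ.walk k).Valid := fun k hk => hv.walk fun j hj => hK j (by omega)
  have hwi : ∀ k ≤ K + 1, (τ.walk k).idx ≤ numMoves σ.n + 1 := by
    intro k hk
    cases k with
    | zero => exact Nat.zero_le _
    | succ k =>
      rw [St.walk_succ, ← hwn k]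
      exact St.newIdx_le (hwv k (by omega)).idx_le
  have hT : ∀ n, pT.eval n = (pi (hi + hb)).eval (sizeBound n) + (pb (hi + hb)).eval (sizeBound n) :=
    fun n => by simp [hpT, hps]
  refine ⟨τ.root :: τ.found K, ?_, fun D => ?_, ?_⟩
  · rw [List.nodup_cons]
    refine ⟨fun h => ?_, St.nodup_found hK hlast⟩
    exact ((St.mem_found_iff hv rfl rfl hlast _).1 h).2 rfl
  · rw [List.mem_cons, St.mem_found_iff hv rfl rfl hlast, hadj]
    constructor
    · rintro (rfl | h)
      · exact hadj ▸ hv.root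
      · exact h.1
    · intro h
      by_cases hD : D = τ.root
      · exact Or.inl hD
      · exact Or.inr ⟨h, hD⟩
  · have hE := enumerates_loop (setup := ci (hi + hb)) (body := cb (hi + hb)) (e := running)
      (s₀ := s) (fun k s' => Tidy 0 (τ.walk k) s' ∧ s' (6, 1, 0) = if k = K + 1 then 1 else 0)
      (m := K + 1) (T := pT.eval σ.n) (b := sizeBound σ.n) (M := sizeBound σ.n ^ 3)
      -- One more than the window in `exists_child`, which only concerns the K rounds before the
      -- last.
      (G := St.gapBound σ.n + 2) (w := (encodeRel σ.n τ.root).map some ++ [none])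
      (o := fun k => (τ.walk k).out) (ws := (τ.root :: τ.found K).map (encodeRel σ.n))
      ?_ ?_ ?_ ?_ ?_ ?_ (by simp) ?_
    · refine hE.mono (le_of_eq ?_) (le_of_eq ?_) (le_of_eq ?_)
      · simp [hpg]
      · simp [hpg]
      · simp [hps, hc]
    · refine hsetup.mono (by rw [hT]; omega) fun s' hs' => ⟨hs'.1, ?_⟩
      rw [hs'.2, if_neg (by omega)]
    · rintro k hk s' ⟨h1, h2⟩
      rw [if_neg (by omega)] at h2
      refine ⟨by rw [eval_running, if_pos h2]; omega, ?_⟩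
      refine (Hb (hi + hb) (by omega) (τ.walk k) s' (hwv k (by omega)).idx_le h1).mono
        (by rw [hwn, hT]; omega) fun s₂ hs₂ => ⟨by rw [St.walk_succ]; exact hs₂.1, ?_⟩
      rw [hs₂.2]
      by_cases hkK : k = K
      · rw [hkK, ind_true hlast, if_pos rfl]
      · rw [ind_false (hK k (by omega)), if_neg (by omega)]
    · rintro s' ⟨-, h2⟩
      rw [eval_running, h2, if_pos rfl]
      rfl
    · exact hs.small (by rw [hidx]; exact Nat.zero_le _)
    · rintro k hk s' ⟨h1, -⟩
      have := h1.small (by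
        rw [hwn]
        have := hwi k hk
        unfold auxBound
        omega)
      rwa [hwn] at this
    · rw [St.out_eq_flatMap_found, St.found_succ_of_last hlast, hn]
      rfl
    · intro k hk
      obtain ⟨j, hj1, hj2, hj3⟩ := St.exists_child (k := k) hK (by rw [hn]; omega)
      rw [hn] at hj2
      refine ⟨j, hj1, by omega, ?_⟩
      unfold St.out
      rw [if_pos hj3]
      simp

/-! ### Edge sets as relations -/

section
variable {n : ℕ}

/-- The relation on `ℕ` given by a relation on `Fin n`. -/
def liftRel (R : Fin n → Fin n → Prop) (u v : ℕ) : Prop := ∃ (hu : u < n) (hv : v < n), R ⟨u, hu⟩ ⟨v, hv⟩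

theorem liftRel_coe (R : Fin n → Fin n → Prop) (u v : Fin n) : liftRel R u v ↔ R u v :=
  ⟨fun ⟨_, _, h⟩ => h, fun h => ⟨u.2, v.2, h⟩⟩

/-- The relation given by a set of edges. -/
def edgeRel (D : Set (Sym2 (Fin n))) : ℕ → ℕ → Prop := liftRel fun u v => s(u, v) ∈ D

theorem edgeRel_coe (D : Set (Sym2 (Fin n))) (u v : Fin n) : edgeRel D u v ↔ s(u, v) ∈ D :=
  liftRel_coe _ u v

theorem cov_edgeRel (D : Set (Sym2 (Fin n))) (u : Fin n) :
    Cov (edgeRel D) u ↔ ∃ v : Fin n, s(u, v) ∈ D :=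
  ⟨fun ⟨_, _, hv, h⟩ => ⟨⟨_, hv⟩, h⟩, fun ⟨v, h⟩ => ⟨v, u.2, v.2, h⟩⟩

theorem edgeRel_injective : Function.Injective (edgeRel (n := n)) := by
  intro D D' h
  ext e
  induction e with
  | h u v => rw [← edgeRel_coe, ← edgeRel_coe, h]

theorem isGraph_liftRel (G : SimpleGraph (Fin n)) : IsGraph n (liftRel G.Adj) :=
  ⟨fun _ _ ⟨hu, hv, h⟩ => ⟨hv, hu, h.symm⟩, fun _ ⟨_, _, h⟩ => G.loopless.irrefl _ h,
    fun _ _ ⟨hu, _, _⟩ => hu⟩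

theorem isEdgeDominatingSet_iff (G : SimpleGraph (Fin n)) (D : Set (Sym2 (Fin n))) :
    IsEdgeDominatingSet G D ↔ (∀ u v, s(u, v) ∈ D → G.Adj u v) ∧
      ∀ u v, G.Adj u v → (∃ x, s(u, x) ∈ D) ∨ ∃ x, s(v, x) ∈ D := by
  have hsub : D ⊆ G.edgeSet ↔ ∀ u v, s(u, v) ∈ D → G.Adj u v :=
    ⟨fun h u v huv => h huv, fun h e => by
      induction e with
      | h u v => exact h u v⟩
  unfold IsEdgeDominatingSet
  rw [hsub]
  refine and_congr_right fun h => ⟨fun hd u v huv => ?_, fun hd e he => ?_⟩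
  · obtain ⟨f, ⟨-, x, hx, hxf⟩, hfD⟩ := hd s(u, v) huv
    obtain ⟨y, rfl⟩ := hxf
    rcases Sym2.mem_iff.1 hx with rfl | rfl
    exacts [Or.inl ⟨y, hfD⟩, Or.inr ⟨y, hfD⟩]
  · induction e with
    | h u v =>
      rcases hd u v he with ⟨x, hx⟩ | ⟨x, hx⟩
      · exact ⟨s(u, x), ⟨h u x hx, u, by simp, by simp⟩, hx⟩
      · exact ⟨s(v, x), ⟨h v x hx, v, by simp, by simp⟩, hx⟩

theorem isGood_edgeRel_iff (G : SimpleGraph (Fin n)) (D : Set (Sym2 (Fin n))) :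
    IsGood (liftRel G.Adj) (edgeRel D) ↔ IsEdgeDominatingSet G D ∧
      ∀ c b b' : Fin n, s(c, b) ∈ D → s(c, b') ∈ D → b ≠ b' →
        (∀ x, s(b, x) ∈ D → x = c) ∧ ∃ w, G.Adj b w ∧ ∀ y, s(w, y) ∉ D := by
  rw [isEdgeDominatingSet_iff]
  constructor
  · intro h
    refine ⟨⟨fun u v huv => ?_, fun u v huv => ?_⟩, fun c b b' hb hb' hne => ?_⟩
    · exact (liftRel_coe _ u v).1 (h.sub _ _ ((edgeRel_coe D u v).2 huv))
    · rw [← cov_edgeRel, ← cov_edgeRel]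
      exact h.dom _ _ ((liftRel_coe _ u v).2 huv)
    · obtain ⟨h1, w, ⟨hb'', hw, hbw⟩, hcov⟩ := h.star c b b' ((edgeRel_coe D c b).2 hb)
        ((edgeRel_coe D c b').2 hb') fun h => hne (Fin.ext h)
      refine ⟨fun x hx => Fin.ext (h1 x ((edgeRel_coe D b x).2 hx)), ⟨w, hw⟩, hbw, fun y hy => ?_⟩
      exact hcov ((cov_edgeRel D ⟨w, hw⟩).2 ⟨y, hy⟩)
  · rintro ⟨⟨h1, h2⟩, h3⟩
    refine ⟨fun u v ⟨hu, hv, h⟩ => ⟨hv, hu, (Sym2.eq_swap ▸ h : s((⟨v, hv⟩ : Fin n), ⟨u, hu⟩) ∈ D)⟩,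
      fun u v ⟨hu, hv, h⟩ => ⟨hu, hv, h1 _ _ h⟩, fun u v ⟨hu, hv, h⟩ => ?_, ?_⟩
    · have := h2 _ _ h
      rwa [← cov_edgeRel, ← cov_edgeRel] at this
    · rintro c b b' ⟨hc, hb, h⟩ ⟨_, hb', h'⟩ hne
      obtain ⟨h4, w, hw, h5⟩ := h3 ⟨c, hc⟩ ⟨b, hb⟩ ⟨b', hb'⟩ h h' (by simpa using hne)
      refine ⟨fun x ⟨_, hx, hbx⟩ => congrArg Fin.val (h4 ⟨x, hx⟩ hbx), w,
        (liftRel_coe _ ⟨b, hb⟩ w).2 hw, fun hcov => ?_⟩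
      obtain ⟨y, hy⟩ := (cov_edgeRel D w).1 hcov
      exact h5 y hy

/-- An edge dominating set is minimal if and only if no edge can be removed. -/
theorem minimal_iff_erase (G : SimpleGraph (Fin n)) (D : Set (Sym2 (Fin n))) :
    Minimal (IsEdgeDominatingSet G) D ↔
      IsEdgeDominatingSet G D ∧ ∀ e ∈ D, ¬ IsEdgeDominatingSet G (D \ {e}) := by
  constructor
  · intro h
    refine ⟨h.1, fun e he hd => ?_⟩
    exact (h.2 hd Set.sdiff_subset he).2 rfl
  · rintro ⟨h1, h2⟩
    refine ⟨h1, fun D' hD' hle e he => ?_⟩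
    by_contra hne
    refine h2 e he ⟨Set.sdiff_subset.trans h1.1, fun f hf => ?_⟩
    obtain ⟨g, hg, hgD⟩ := hD'.2 f hf
    exact ⟨g, hg, hle hgD, fun h => hne (h ▸ hgD)⟩

/-- Removing cb fails precisely if some edge loses its last covered endpoint. If c has a further
edge, that endpoint is b, so b is a leaf and the other end of the undominated edge is uncovered.
Conversely, for a leaf b of a larger star the edge to its uncovered neighbour is lost, and for an
isolated edge of D the edge itself. -/
theorem minimal_iff_isGood (G : SimpleGraph (Fin n)) (D : Set (Sym2 (Fin n))) :
    Minimal (IsEdgeDominatingSet G) D ↔ IsGood (liftRel G.Adj) (edgeRel D) := by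
  rw [minimal_iff_erase, isGood_edgeRel_iff]
  refine and_congr_right fun hD => ?_
  obtain ⟨hsub, hdom⟩ := (isEdgeDominatingSet_iff G D).1 hD
  have hsub' : ∀ e, ∀ u v, s(u, v) ∈ D \ {e} → G.Adj u v := fun e u v h => hsub u v h.1
  constructor
  · intro h c b b' hb hb' hne
    have h1 := h _ hb
    rw [isEdgeDominatingSet_iff, and_iff_right (hsub' _)] at h1
    push Not at h1
    obtain ⟨u, v, huv, hu, hv⟩ := h1
    -- the endpoint that is no longer covered is `b`, since `c` has another edge
    have hcb : c ≠ b := (hsub _ _ hb).ne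
    have hlost : ∀ z, (∀ x, s(z, x) ∉ D \ {s(c, b)}) → (∃ x, s(z, x) ∈ D) → z = b := by
      rintro z hz ⟨x, hx⟩
      have : s(z, x) = s(c, b) := by
        by_contra hne
        exact hz x ⟨hx, hne⟩
      rcases Sym2.eq_iff.1 this with ⟨rfl, rfl⟩ | ⟨rfl, rfl⟩
      · refine absurd ?_ (hz b')
        refine ⟨hb', fun h => ?_⟩
        rcases Sym2.eq_iff.1 h with ⟨_, h⟩ | ⟨h, h'⟩
        exacts [hne h.symm, hcb h]
      · rfl
    have huncov : ∀ z, (∀ x, s(z, x) ∉ D \ {s(c, b)}) → z ≠ b → ∀ y, s(z, y) ∉ D :=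
      fun z hz hzb y hy => hzb (hlost z hz ⟨y, hy⟩)
    have key : ∀ w, G.Adj b w → (∀ x, s(b, x) ∉ D \ {s(c, b)}) →
        (∀ x, s(w, x) ∉ D \ {s(c, b)}) →
        (∀ x, s(b, x) ∈ D → x = c) ∧ ∃ w, G.Adj b w ∧ ∀ y, s(w, y) ∉ D := by
      intro w hbw hb1 hw1
      refine ⟨fun x hx => ?_, w, hbw, huncov w hw1 hbw.ne'⟩
      have : s(b, x) = s(c, b) := by
        by_contra hne
        exact hb1 x ⟨hx, hne⟩
      rcases Sym2.eq_iff.1 this with ⟨h, _⟩ | ⟨_, h⟩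
      exacts [absurd h.symm hcb, h]
    rcases hdom u v huv with hc | hc
    · obtain rfl := hlost u hu hc
      exact key v huv hu hv
    · obtain rfl := hlost v hv hc
      exact key u huv.symm hv hu
  · intro h e he h1
    rw [isEdgeDominatingSet_iff, and_iff_right (hsub' _)] at h1
    induction e with
    | h c b =>
      have hcase : ∀ c b, s(c, b) ∈ D → (∃ b', b' ≠ b ∧ s(c, b') ∈ D) →
          ¬ ∀ u v, G.Adj u v → (∃ x, s(u, x) ∈ D \ {s(c, b)}) ∨ ∃ x, s(v, x) ∈ D \ {s(c, b)} := by
        rintro c b hb ⟨b', hne, hb'⟩ h1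
        obtain ⟨h2, w, hw, h3⟩ := h c b b' hb hb' hne.symm
        rcases h1 b w hw with ⟨x, hx⟩ | ⟨x, hx⟩
        · refine hx.2 ?_
          rw [h2 x hx.1]
          exact Sym2.eq_swap
        · exact h3 x hx.1
      rcases h1 c b (hsub _ _ he) with ⟨x, hx⟩ | ⟨x, hx⟩
      · exact hcase c b he ⟨x, fun h => hx.2 (by rw [h]; rfl), hx.1⟩ h1
      · rw [Sym2.eq_swap] at he h1
        refine hcase b c he ⟨x, fun h => hx.2 ?_, hx.1⟩ h1
        rw [h]
        exact Sym2.eq_swap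

theorem isGood_eq_edgeRel {G : SimpleGraph (Fin n)} {R : ℕ → ℕ → Prop}
    (h : IsGood (liftRel G.Adj) R) : ∃ D : Set (Sym2 (Fin n)), edgeRel D = R := by
  refine ⟨{e | ∃ u v : Fin n, e = s(u, v) ∧ R u v}, ?_⟩
  funext u v
  refine propext ⟨?_, fun huv => ?_⟩
  · rintro ⟨hu, hv, u', v', he, hR⟩
    rcases Sym2.eq_iff.1 he with ⟨h1, h2⟩ | ⟨h1, h2⟩
    · rw [← h1, ← h2] at hR
      exact hR
    · rw [← h1, ← h2] at hR
      exact h.symm _ _ hR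
  · obtain ⟨hu, hv, -⟩ := h.sub u v huv
    exact ⟨hu, hv, ⟨u, hu⟩, ⟨v, hv⟩, rfl, huv⟩

theorem flatMap_range_eq {α : Type*} (n : ℕ) (f : ℕ → List α) :
    (List.range n).flatMap f = (List.finRange n).flatMap fun i : Fin n => f i.val := by
  rw [← List.map_coe_finRange_eq_range, List.flatMap_map]

theorem encodeRel_edgeRel (D : Finset (Sym2 (Fin n))) :
    encodeRel n (edgeRel (D : Set (Sym2 (Fin n)))) = encode D := by
  classical
  unfold encodeRel encode
  rw [flatMap_range_eq]
  congr 1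
  funext u
  rw [flatMap_range_eq]
  congr 1
  funext v
  simp only [edgeRel_coe, Finset.mem_coe, Fin.lt_def]

/-! ### The input -/

/-- The initial state. -/
def inputState (G : SimpleGraph (Fin n)) : St where
  n := n
  adj := liftRel G.Adj
  cur := fun _ _ => False
  root := fun _ _ => False
  idx := 0
  adj_lt := fun _ _ ⟨hu, hv, _⟩ => ⟨hu, hv⟩
  cur_lt := fun _ _ h => h.elim
  root_lt := fun _ _ h => h.elim

theorem inputStore_apply (G : SimpleGraph (Fin n)) (a i j : ℕ) :
    inputStore G (a, i, j) = (inputState G).cells a i j := by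
  classical
  have h0 : inputStore G (a, i, j) = (if a = 0 ∧ i = 0 ∧ j = 0 then n else 0) +
      if a = 1 then ind (liftRel G.Adj i j) else 0 := by
    unfold inputStore
    rw [Finsupp.add_apply, Finsupp.finsetSum_apply]
    congr 1
    · rw [Finsupp.single_apply]
      congr 1
      simp [eq_comm]
    · simp only [Finsupp.single_apply]
      rw [Finset.sum_ite, Finset.sum_const_zero, add_zero, Finset.sum_const, smul_eq_mul, mul_one]
      by_cases ha : a = 1
      · rw [if_pos ha]
        by_cases hR : liftRel G.Adj i j
        · rw [ind_true hR]
          obtain ⟨hi, hj, h⟩ := hR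
          rw [Finset.card_eq_one]
          refine ⟨(⟨i, hi⟩, ⟨j, hj⟩), ?_⟩
          ext ⟨u, v⟩
          simp only [Finset.mem_filter, Finset.mem_univ, true_and, Finset.mem_singleton,
            Prod.mk.injEq, Fin.ext_iff]
          constructor
          · rintro ⟨-, -, h1, h2⟩
            exact ⟨h1, h2⟩
          · rintro ⟨h1, h2⟩
            refine ⟨?_, ha.symm, h1, h2⟩
            have e1 : u = ⟨i, hi⟩ := Fin.ext h1
            have e2 : v = ⟨j, hj⟩ := Fin.ext h2
            rw [e1, e2]
            exact h
        · rw [ind_false hR, Finset.card_eq_zero, Finset.filter_eq_empty_iff]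
          rintro ⟨u, v⟩ hp he
          simp only [Finset.mem_filter, Finset.mem_univ, true_and] at hp
          simp only [Prod.mk.injEq] at he
          refine hR ?_
          rw [← he.2.1, ← he.2.2]
          exact (liftRel_coe _ u v).2 hp
      · rw [if_neg ha, Finset.card_eq_zero, Finset.filter_eq_empty_iff]
        rintro ⟨u, v⟩ hp he
        simp only [Prod.mk.injEq] at he
        exact ha he.1.symm
  rw [h0]
  match a with
  | 0 | 1 => simp [St.cells, inputState]
  | 2 | 3 | 4 | a + 5 => simp [St.cells, inputState, ind_false]

theorem tidy_inputStore (G : SimpleGraph (Fin n)) : Tidy 0 (inputState G) (inputStore G) := by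
  refine ⟨fun a _ i j => inputStore_apply G a i j, fun a i j ha hne => absurd ?_ hne⟩
  rw [inputStore_apply]
  unfold St.cells
  split <;> omega

end

end RamWhile

/-! ### The main theorem. -/

theorem theorem5p1 :
    (∃ (c : RamWhile.Cmd) (p q r : Polynomial ℕ),
      ∀ (n : ℕ) (G : SimpleGraph (Fin n)),
        ∃ Ds : List (Finset (Sym2 (Fin n))),
          Ds.Nodup ∧
          (∀ D : Finset (Sym2 (Fin n)),
            D ∈ Ds ↔ Minimal (EdgeDom.IsEdgeDominatingSet G) (D : Set (Sym2 (Fin n)))) ∧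
          RamWhile.Enumerates c (RamWhile.inputStore G) (Ds.map RamWhile.encode)
            (p.eval (EdgeDom.graphSize G)) (q.eval (EdgeDom.graphSize G))
            (r.eval (EdgeDom.graphSize G))) ∧
    (∀ (n : ℕ) (G : SimpleGraph (Fin n)) (D : Set (Sym2 (Fin n))),
      Minimal (EdgeDom.IsEdgeDominatingSet G) D ↔
        Minimal (EdgeDom.edgeNbhdHypergraph G).IsTransversal D) := by
  classical
  constructor
  · obtain ⟨c, p, q, r, H⟩ := RamWhile.exists_program
    refine ⟨c, p, q, r, fun n G => ?_⟩
    have ht := RamWhile.tidy_inputStore G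
    obtain ⟨Rs, hnd, hmem, hen⟩ := H (RamWhile.inputState G) (RamWhile.inputStore G)
      (RamWhile.isGraph_liftRel G) (fun _ _ h => h) rfl ht
      (by rw [RamWhile.inputStore_apply]; rfl)
    -- The relations found are turned back into sets of edges; off the list the empty set is a dummy
    -- value.
    have hex : ∀ R, ∃ D : Finset (Sym2 (Fin n)), R ∈ Rs →
        RamWhile.edgeRel (D : Set (Sym2 (Fin n))) = R := by
      intro R
      by_cases hR : R ∈ Rs
      · obtain ⟨D, hD⟩ := RamWhile.isGood_eq_edgeRel ((hmem R).1 hR)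
        exact ⟨D.toFinset, fun _ => by rw [Set.coe_toFinset]; exact hD⟩
      · exact ⟨∅, fun h => absurd h hR⟩
    choose F hF using hex
    refine ⟨Rs.map F, ?_, fun D => ?_, ?_⟩
    · refine hnd.map_on fun R hR R' hR' h => ?_
      rw [← hF R hR, ← hF R' hR', h]
    · rw [RamWhile.minimal_iff_isGood, List.mem_map]
      constructor
      · rintro ⟨R, hR, rfl⟩
        rw [hF R hR]
        exact (hmem R).1 hR
      · intro h
        have hR := (hmem _).2 h
        exact ⟨_, hR, Finset.coe_injective (RamWhile.edgeRel_injective (hF _ hR))⟩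
    -- The bounds of the program are polynomials in n alone with natural coefficients, hence
    -- monotone, so they may be evaluated at the size.
    · have hle : n ≤ EdgeDom.graphSize G := Nat.le_add_right _ _
      have e : (Rs.map F).map RamWhile.encode = Rs.map (RamWhile.encodeRel n) := by
        rw [List.map_map]
        refine List.map_congr_left fun R hR => ?_
        rw [Function.comp_apply, ← RamWhile.encodeRel_edgeRel, hF R hR]
      rw [e]
      exact hen.mono (RamWhile.eval_mono p hle) (RamWhile.eval_mono q hle)
        (RamWhile.eval_mono r hle)
  · intro n G D
    have h : EdgeDom.IsEdgeDominatingSet G = (EdgeDom.edgeNbhdHypergraph G).IsTransversal := by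
      funext T
      refine propext (and_congr_right fun _ => ⟨?_, fun h e he => h _ ⟨e, he, rfl⟩⟩)
      rintro h _ ⟨e, he, rfl⟩
      exact h e he
    rw [h]
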